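/- Let $p$ be an odd prime, $F$ a number field with algebraic closure $\bar F$, and $E/F$ an elliptic curve with good reduction at every prime of $F$ above $p$. Let $F_\infty\subset\bar F$ be a $\mathbb{Z}_p$-extension of $F$, i.e. a Galois extension with $\Gamma=\mathrm{Gal}(F_\infty/F)$ topologically isomorphic to $\mathbb{Z}_p$. Let $\gamma$ be a topological generator of $\Gamma$ and identify the Iwasawa algebra $\Lambda=\varprojlim_n \mathbb{Z}_p[\Gamma/\Gamma^{p^n}]$ with $\mathbb{Z}_p[[T]]$ by $T=\gamma-1$. Let $S$ be the (finite) set of finite primes $v$ of $F$ such that $v\mid p$ or $E$ has bad reduction at $v$, and let $F_S\subset\bar F$ be the maximal extension of $F$ in which every finite prime $v\notin S$ is unramified; it contains $F_\infty$. For $M=E[p]$ and $M=E[p^\infty]$ put $\mathcal{H}_v(F_\infty,M)=\prod_{w\mid v}H^1(F_{\infty,w},M)$, where $w$ runs over the primes of $F_\infty$ above $v$, $F_{\infty,w}$ is the completion of $F_\infty$ at $w$, and $H^1$ is continuous Galois cohomology. Define $$R(M/F_\infty)=\ker\Big(H^1(\mathrm{Gal}(F_S/F_\infty),M)\longrightarrow\bigoplus_{v\in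 S}\mathcal{H}_v(F_\infty,M)\Big)$$ (restriction maps), and write $R(E/F_\infty)=R(E[p^\infty]/F_\infty)$ for the fine Selmer group, a discrete $\Lambda$-module with Pontryagin dual $R(E/F_\infty)^\vee=\mathrm{Hom}(R(E/F_\infty),\mathbb{Q}_p/\mathbb{Z}_p)$. Let $$h:\bigoplus_{v\in S}\mathcal{H}_v(F_\infty,E[p])\longrightarrow\bigoplus_{v\in S}\mathcal{H}_v(F_\infty,E[p^\infty])[p]$$ be the map induced by the inclusion $E[p]\subset E[p^\infty]$. For a finitely generated $\Lambda$-module $X$ there is a $\Lambda$-homomorphism with finite kernel and cokernel $$X\to\Lambda^r\oplus\bigoplus_{i=1}^s\Lambda/(p^{\mu_i})\oplus\bigoplus_{j=1}^t\Lambda/(f_j^{\lambda_j})$$ with $r\ge 0$, positive integers $\mu_i,\lambda_j$ and irreducible distinguished polynomials $f_j$; put $\mu(X)=\sum_i\mu_i$ and $\lambda(X)=\sum_j\lambda_j\deg f_j$. Write $\mu(E/F_\infty)$ and $\lambda(E/F_\infty)$ for the invariants of $R(E/F_\infty)^\vee$. Assume that $\ker(h)$ is finite and that the residual fine Selmer group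 $R(E[p]/F_\infty)$ is finite. Then $R(E/F_\infty)^\vee$ is a finitely generated torsion $\Lambda$-module with $\mu(E/F_\infty)=0$, and $$\lambda(E/F_\infty)\le\dim_{\mathbb{Z}/p\mathbb{Z}}R(E[p]/F_\infty)+\dim_{\mathbb{Z}/p\mathbb{Z}}\ker(h).$$ -/

import Mathlib

noncomputable section

/-! ### Continuous cohomology in degree one with discrete coefficients -/

namespace ContH1

variable {G G' M M' : Type*} [Group G] [TopologicalSpace G] [Group G'] [TopologicalSpace G']
  [AddCommGroup M] [AddCommGroup M']

/-- Continuous 1-cocycles of `G` with values in the discrete `G`-module `M`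
(for a discrete target, continuous means locally constant). -/
def Z1 (ρ : G →* AddMonoid.End M) : AddSubgroup (G → M) where
  carrier := {c | IsLocallyConstant c ∧ ∀ g h, c (g * h) = c g + ρ g (c h)}
  zero_mem' := ⟨IsLocallyConstant.const 0, by simp⟩
  add_mem' := by
    rintro a b ⟨ha, ha'⟩ ⟨hb, hb'⟩
    refine ⟨ha.add hb, fun g h => ?_⟩
    simp only [Pi.add_apply, ha', hb', map_add]
    abel
  neg_mem' := by
    rintro a ⟨ha, ha'⟩
    refine ⟨ha.neg, fun g h => ?_⟩
    simp only [Pi.neg_apply, ha', map_neg]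
    abel

/-- 1-coboundaries `g ↦ g m - m`. -/
def B1 (ρ : G →* AddMonoid.End M) : AddSubgroup (Z1 ρ) where
  carrier := {c | ∃ m : M, ∀ g, c.1 g = ρ g m - m}
  zero_mem' := ⟨0, by simp⟩
  add_mem' := by
    rintro a b ⟨m, hm⟩ ⟨n, hn⟩
    refine ⟨m + n, fun g => ?_⟩
    simp only [AddSubgroup.coe_add, Pi.add_apply, hm, hn, map_add]
    abel
  neg_mem' := by
    rintro a ⟨m, hm⟩
    refine ⟨-m, fun g => ?_⟩
    simp only [AddSubgroup.coe_neg, Pi.neg_apply, hm, map_neg]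
    abel

/-- The first continuous cohomology group `H¹(G, M)` of a discrete `G`-module `M`. -/
def H1 (ρ : G →* AddMonoid.End M) : Type _ := Z1 ρ ⧸ B1 ρ

instance (ρ : G →* AddMonoid.End M) : AddCommGroup (H1 ρ) :=
  inferInstanceAs (AddCommGroup (Z1 ρ ⧸ B1 ρ))

/-- The class of a cocycle. -/
def H1.mk (ρ : G →* AddMonoid.End M) : Z1 ρ →+ H1 ρ := QuotientAddGroup.mk' (B1 ρ)

theorem H1.mk_surjective (ρ : G →* AddMonoid.End M) : Function.Surjective (H1.mk ρ) :=
  QuotientAddGroup.mk'_surjective (B1 ρ)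

/-- The map on cocycles induced by a continuous homomorphism `φ : G' → G` and a compatible
homomorphism `u : M → M'`: `c ↦ u ∘ c ∘ φ`. -/
def Z1.map {ρ : G →* AddMonoid.End M} {ρ' : G' →* AddMonoid.End M'}
    (φ : G' →* G) (hφ : Continuous φ) (u : M →+ M')
    (hu : ∀ g m, u (ρ (φ g) m) = ρ' g (u m)) : Z1 ρ →+ Z1 ρ' where
  toFun c := ⟨fun g => u (c.1 (φ g)), (c.2.1.comp_continuous hφ).comp u, fun g h => by
    simp only [map_mul, c.2.2, map_add, hu]⟩
  map_zero' := by ext g; simp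
  map_add' a b := by ext g; simp

/-- The map `H¹(G, M) → H¹(G', M')` induced by a continuous homomorphism `φ : G' → G` and a
compatible homomorphism `u : M → M'`. -/
def H1.map {ρ : G →* AddMonoid.End M} {ρ' : G' →* AddMonoid.End M'}
    (φ : G' →* G) (hφ : Continuous φ) (u : M →+ M')
    (hu : ∀ g m, u (ρ (φ g) m) = ρ' g (u m)) : H1 ρ →+ H1 ρ' :=
  QuotientAddGroup.map (B1 ρ) (B1 ρ') (Z1.map φ hφ u hu) (by
    rintro c ⟨m, hm⟩
    exact ⟨u m, fun g => by simp [Z1.map, hm, hu]⟩)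

theorem H1.map_mk {ρ : G →* AddMonoid.End M} {ρ' : G' →* AddMonoid.End M'}
    (φ : G' →* G) (hφ : Continuous φ) (u : M →+ M')
    (hu : ∀ g m, u (ρ (φ g) m) = ρ' g (u m)) (c : Z1 ρ) :
    H1.map φ hφ u hu (H1.mk ρ c) = H1.mk ρ' (Z1.map φ hφ u hu c) := rfl

theorem H1.mk_eq_zero {ρ : G →* AddMonoid.End M} (c : Z1 ρ) :
    H1.mk ρ c = 0 ↔ ∃ m : M, ∀ g, c.1 g = ρ g m - m :=
  QuotientAddGroup.eq_zero_iff c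

theorem H1.nsmul_eq_zero {ρ : G →* AddMonoid.End M} {n : ℕ} (h : ∀ m : M, n • m = 0)
    (c : H1 ρ) : n • c = 0 := by
  obtain ⟨c, rfl⟩ := H1.mk_surjective ρ c
  have : n • c = 0 := by ext g; simp [h]
  rw [← map_nsmul, this, map_zero]

theorem H1.map_mk_eq_zero {ρ : G →* AddMonoid.End M} {ρ' : G' →* AddMonoid.End M'}
    (φ : G' →* G) (hφ : Continuous φ) (u : M →+ M')
    (hu : ∀ g m, u (ρ (φ g) m) = ρ' g (u m)) (c : Z1 ρ) :
    H1.map φ hφ u hu (H1.mk ρ c) = 0 ↔ ∃ m : M', ∀ g, u (c.1 (φ g)) = ρ' g m - m :=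
  H1.mk_eq_zero (Z1.map φ hφ u hu c)

end ContH1

/-! ### Torsion -/

/-- `A[p ^ k]` for `k : ℕ∞`; for `k = ⊤` this is the `p`-primary torsion subgroup `A[p ^ ∞]`. -/
def pTors (p : ℕ) (k : ℕ∞) (A : Type*) [AddCommGroup A] : AddSubgroup A where
  carrier := {a | ∃ n : ℕ, (n : ℕ∞) ≤ k ∧ p ^ n • a = 0}
  zero_mem' := ⟨0, by simp, by simp⟩
  add_mem' := by
    rintro a b ⟨m, hm, ha⟩ ⟨n, hn, hb⟩
    rcases le_total m n with h | h
    · refine ⟨n, hn, ?_⟩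
      obtain ⟨d, rfl⟩ := Nat.exists_eq_add_of_le h
      rw [smul_add, hb, pow_add, mul_comm, mul_smul, ha]; simp
    · refine ⟨m, hm, ?_⟩
      obtain ⟨d, rfl⟩ := Nat.exists_eq_add_of_le h
      rw [smul_add, ha, pow_add, mul_comm, mul_smul, hb]; simp
  neg_mem' := by
    rintro a ⟨n, hn, ha⟩
    exact ⟨n, hn, by rw [smul_neg, ha, neg_zero]⟩

/-- A homomorphism `A → B` restricts to `A[p ^ k] → B[p ^ k]`. -/
def pTors.map (p : ℕ) (k : ℕ∞) {A B : Type*} [AddCommGroup A] [AddCommGroup B] (f : A →+ B) :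
    pTors p k A →+ pTors p k B :=
  (f.comp (pTors p k A).subtype).codRestrict (pTors p k B) (by
    rintro ⟨a, n, hn, ha⟩
    exact ⟨n, hn, by simp [← map_nsmul, ha]⟩)

/-- The inclusion `A[p ^ k] → A[p ^ ∞]`. -/
def pTors.incl (p : ℕ) (k : ℕ∞) (A : Type*) [AddCommGroup A] :
    pTors p k A →+ pTors p ⊤ A :=
  AddSubgroup.inclusion (by rintro a ⟨n, -, ha⟩; exact ⟨n, le_top, ha⟩)

/-- The action on `A[p ^ k]` induced by an action on `A`. -/
def pTors.rep (p : ℕ) (k : ℕ∞) {G A : Type*} [Group G] [AddCommGroup A]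
    (ρ : G →* AddMonoid.End A) : G →* AddMonoid.End (pTors p k A) where
  toFun g := pTors.map p k (ρ g)
  map_one' := by rw [map_one]; rfl
  map_mul' g h := by rw [map_mul]; rfl

theorem pTors.nsmul_eq_zero {p : ℕ} {A : Type*} [AddCommGroup A] (a : pTors p 1 A) :
    p • a = 0 := by
  obtain ⟨a, n, hn, ha⟩ := a
  ext
  have hn : n ≤ 1 := by exact_mod_cast hn
  change p • a = 0
  interval_cases n
  · simp at ha; simp [ha]
  · simpa using ha


/-! ### Completions and local Galois groups -/

/-- The completion `L_w` of a field `L` at a place `w`, a place being given by its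
valuation ring. -/
def CompletionAt {L : Type*} [Field L] (w : ValuationSubring L) : Type _ :=
  w.valuation.Completion

namespace CompletionAt

variable {L : Type*} [Field L] (w : ValuationSubring L)

instance : Field (CompletionAt w) := inferInstanceAs (Field w.valuation.Completion)

/-- The canonical embedding `L → L_w`. -/
def emb : L →+* CompletionAt w :=
  (UniformSpace.Completion.coeRingHom (α := WithVal w.valuation)).comp
    (WithVal.equiv w.valuation).symm.toRingHom

instance {F : Type*} [CommSemiring F] [Algebra F L] : Algebra F (CompletionAt w) :=
  ((emb w).comp (algebraMap F L)).toAlgebra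

theorem algebraMap_eq (x : L) : algebraMap L (CompletionAt w) x = emb w x := rfl

instance {F : Type*} [CommSemiring F] [Algebra F L] : IsScalarTower F L (CompletionAt w) :=
  IsScalarTower.of_algebraMap_eq fun _ => rfl

variable {w}

theorem continuous_congr {w' : ValuationSubring L} (σ : L ≃+* L)
    (h : ∀ x, x ∈ w' ↔ σ x ∈ w) :
    Continuous (WithVal.congr w'.valuation w.valuation σ) := by
  have hlt : ∀ x y, w'.valuation x < w'.valuation y ↔ w.valuation (σ x) < w.valuation (σ y) := by
    have he : w'.valuation.IsEquiv (w.valuation.comap (σ : L →+* L)) := by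
      refine Valuation.isEquiv_of_val_le_one fun x => ?_
      simp [ValuationSubring.valuation_le_one_iff, h]
    exact fun x y => he.lt_iff_lt
  refine continuous_of_continuousAt_zero (WithVal.congr w'.valuation w.valuation σ) ?_
  simp_rw [ContinuousAt, map_zero, (Valued.hasBasis_nhds_zero _ _).tendsto_iff
    (Valued.hasBasis_nhds_zero _ _), true_and, forall_const]
  intro γ
  obtain ⟨r, s, hr, hs, hrs⟩ := Valuation.restrict_exists_div_eq
    (Valued.v (R := WithVal w.valuation)) γ
  have hr0 : r ≠ 0 := fun h0 => by simp [h0] at hr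
  have hs0 : s ≠ 0 := fun h0 => by simp [h0] at hs
  obtain ⟨a, ha⟩ : ∃ a : WithVal w'.valuation,
      WithVal.congr w'.valuation w.valuation σ a = r / s :=
    (WithVal.congr w'.valuation w.valuation σ).surjective _
  have ha0 : Valued.v.restrict a ≠ 0 := by
    rw [Valuation.ne_zero_iff]
    rintro rfl
    rw [map_zero] at ha
    exact div_ne_zero hr0 hs0 ha.symm
  refine ⟨Units.mk0 _ ha0, fun x hx => ?_⟩
  rw [Set.mem_ofPred_eq, ← hrs, ← map_div₀, ← ha, Valuation.restrict_lt_iff]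
  rw [Set.mem_ofPred_eq, Units.val_mk0, Valuation.restrict_lt_iff] at hx
  exact (hlt _ _).1 hx

/-- An automorphism of `L` that carries the place `w'` to the place `w` extends to an
isomorphism of the completions. -/
def congr {w' : ValuationSubring L} (σ : L ≃+* L)
    (h : ∀ x, x ∈ w' ↔ σ x ∈ w) : CompletionAt w' ≃+* CompletionAt w :=
  UniformSpace.Completion.mapRingEquiv (WithVal.congr w'.valuation w.valuation σ)
    (continuous_congr σ h)
    (continuous_congr σ.symm (fun x => by simp [h]))

theorem congr_emb {w' : ValuationSubring L} (σ : L ≃+* L)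
    (h : ∀ x, x ∈ w' ↔ σ x ∈ w) (x : L) : congr σ h (emb w' x) = emb w (σ x) :=
  UniformSpace.Completion.mapRingHom_coe (continuous_congr σ h) (WithVal.toVal _ x)

end CompletionAt

section resHom

variable {F Ω K : Type*} [Field F] [Field Ω] [Field K] [Algebra F Ω] [Algebra F K]

/-- Restriction `Gal(K̄/K) → Gal(Ω/F)` along an embedding `ι : Ω → K̄` over `F`,
for a normal extension `Ω/F`. -/
def resHom [Normal F Ω] (ι : Ω →ₐ[F] AlgebraicClosure K) :
    Gal(AlgebraicClosure K/K) →* Gal(Ω/F) :=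
  letI : Algebra Ω (AlgebraicClosure K) := ι.toRingHom.toAlgebra
  haveI : IsScalarTower F Ω (AlgebraicClosure K) :=
    IsScalarTower.of_algebraMap_eq fun x => (ι.commutes x).symm
  (AlgEquiv.restrictNormalHom Ω).comp (AlgEquiv.restrictScalarsHom F)

theorem resHom_commutes [Normal F Ω] (ι : Ω →ₐ[F] AlgebraicClosure K)
    (τ : Gal(AlgebraicClosure K/K)) (x : Ω) : ι (resHom ι τ x) = τ (ι x) := by
  let _ : Algebra Ω (AlgebraicClosure K) := ι.toRingHom.toAlgebra
  have : IsScalarTower F Ω (AlgebraicClosure K) :=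
    IsScalarTower.of_algebraMap_eq fun x => (ι.commutes x).symm
  exact AlgEquiv.restrictNormal_commutes (τ.restrictScalars F) Ω x

theorem resHom_continuous [Normal F Ω] (ι : Ω →ₐ[F] AlgebraicClosure K) :
    Continuous (resHom ι) := by
  refine continuous_of_continuousAt_one (resHom ι) ?_
  rw [ContinuousAt, map_one]
  intro s hs
  rw [krullTopology_mem_nhds_one_iff] at hs
  obtain ⟨E, hE, hs⟩ := hs
  rw [Filter.mem_map, krullTopology_mem_nhds_one_iff]
  obtain ⟨t, ht⟩ := (IntermediateField.essFiniteType_iff (K := E)).1 inferInstance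
  refine ⟨IntermediateField.adjoin K (ι '' t), ?_, ?_⟩
  · have : (ι '' (t : Set Ω)).Finite := t.finite_toSet.image _
    have := this.to_subtype
    exact IntermediateField.finiteDimensional_adjoin fun x _ =>
      Algebra.IsIntegral.isIntegral x
  · intro τ hτ
    refine hs ?_
    rw [SetLike.mem_coe, ← ht, IntermediateField.mem_fixingSubgroup_iff]
    rw [SetLike.mem_coe, IntermediateField.mem_fixingSubgroup_iff] at hτ
    have key : IntermediateField.adjoin F (t : Set Ω) ≤
        IntermediateField.fixedField (Subgroup.zpowers (resHom ι τ)) := by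
      rw [IntermediateField.adjoin_le_iff]
      intro x hx
      rw [SetLike.mem_coe, IntermediateField.mem_fixedField_iff]
      have h1 : resHom ι τ x = x := ι.injective (by
        refine (resHom_commutes ι τ x).trans ?_
        exact hτ _ (IntermediateField.subset_adjoin _ _ ⟨x, hx, rfl⟩))
      have : Subgroup.zpowers (resHom ι τ) ≤ MulAction.stabilizer Gal(Ω/F) x := by
        rw [Subgroup.zpowers_le]; exact h1
      exact fun f hf => this hf
    intro x hx
    exact (IntermediateField.mem_fixedField_iff _ _).1 (key hx) _ (Subgroup.mem_zpowers _)

end resHom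

/-! ### The conjugation action on `H¹` of a normal subgroup -/

namespace ContH1

variable {G M : Type*} [Group G] [TopologicalSpace G] [IsTopologicalGroup G] [AddCommGroup M]
  (ρ : G →* AddMonoid.End M) (N : Subgroup G) [N.Normal]

/-- Conjugation `n ↦ σ⁻¹ n σ` on a normal subgroup. -/
def conjHom (σ : G) : N →* N := (MulAut.conjNormal σ⁻¹ : MulAut N).toMonoidHom

theorem coe_conjHom (σ : G) (n : N) : (conjHom N σ n : G) = σ⁻¹ * n * σ := by
  simp [conjHom]

theorem continuous_conjHom (σ : G) : Continuous (conjHom N σ) := by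
  refine continuous_induced_rng.2 ?_
  have : (Subtype.val ∘ conjHom N σ) = fun n : N => σ⁻¹ * (n : G) * σ := by
    ext n; exact coe_conjHom N σ n
  rw [this]
  fun_prop

/-- The natural action of `σ ∈ G` on `H¹(N, M)` for a normal subgroup `N` and a `G`-module `M`:
on cocycles it is `(σ c)(n) = σ (c (σ⁻¹ n σ))`. -/
def conj (σ : G) : AddMonoid.End (H1 (ρ.comp N.subtype)) :=
  H1.map (conjHom N σ) (continuous_conjHom N σ) (ρ σ) (by
    intro n m
    simp only [MonoidHom.comp_apply, Subgroup.coe_subtype, coe_conjHom, map_mul]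
    change (ρ σ * (ρ σ⁻¹ * ρ n * ρ σ)) m = (ρ n * ρ σ) m
    rw [← map_mul, ← map_mul, ← map_mul, ← map_mul]
    congr 2
    group)

theorem conj_mul (σ τ : G) : conj ρ N (σ * τ) = conj ρ N σ * conj ρ N τ := by
  refine AddMonoidHom.ext fun c => ?_
  obtain ⟨c, rfl⟩ := H1.mk_surjective _ c
  refine congrArg (H1.mk _) ?_
  ext n
  change ρ (σ * τ) (c.1 (conjHom N (σ * τ) n)) = ρ σ (ρ τ (c.1 (conjHom N τ (conjHom N σ n))))
  rw [map_mul]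
  have : conjHom N (σ * τ) n = conjHom N τ (conjHom N σ n) := by
    ext; simp only [coe_conjHom]; group
  rw [this]; rfl

theorem conj_of_mem {σ : G} (hσ : σ ∈ N) : conj ρ N σ = 1 := by
  refine AddMonoidHom.ext fun c => ?_
  obtain ⟨c, rfl⟩ := H1.mk_surjective _ c
  rw [← sub_eq_zero]
  refine (H1.mk_eq_zero (Z1.map (conjHom N σ) (continuous_conjHom N σ) (ρ σ) _ c - c)).2
    ⟨c.1 ⟨σ, hσ⟩, fun n => ?_⟩
  have h1 := c.2.2 n ⟨σ, hσ⟩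
  have h2 := c.2.2 ⟨σ, hσ⟩ (conjHom N σ n)
  have h3 : (⟨σ, hσ⟩ : N) * conjHom N σ n = n * ⟨σ, hσ⟩ := by
    ext; simp only [Subgroup.coe_mul, coe_conjHom]; group
  rw [h3, h1] at h2
  change ρ σ (c.1 (conjHom N σ n)) - c.1 n = _
  have h4 : (ρ.comp N.subtype) ⟨σ, hσ⟩ (c.1 (conjHom N σ n)) = ρ σ (c.1 (conjHom N σ n)) := rfl
  rw [h4] at h2
  rw [sub_eq_sub_iff_add_eq_add, add_comm, ← h2, add_comm]

theorem conj_congr {σ σ' : G} (h : σ⁻¹ * σ' ∈ N) : conj ρ N σ = conj ρ N σ' := by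
  have h2 : conj ρ N (σ * (σ⁻¹ * σ')) = conj ρ N σ := by
    rw [conj_mul, conj_of_mem ρ N h, mul_one]
  rw [← h2, mul_inv_cancel_left]

variable {ρ N} in
theorem H1.map_conj_mk_eq_zero {G' M' : Type*} [Group G'] [TopologicalSpace G'] [AddCommGroup M']
    {ρ' : G' →* AddMonoid.End M'} (φ : G' →* N) (hφ : Continuous φ) (u : M →+ M')
    (hu : ∀ g m, u ((ρ.comp N.subtype) (φ g) m) = ρ' g (u m)) (c : Z1 (ρ.comp N.subtype)) (σ : G) :
    H1.map φ hφ u hu (conj ρ N σ (H1.mk _ c)) = 0 ↔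
      ∃ m : M', ∀ g, u (ρ σ (c.1 (conjHom N σ (φ g)))) = ρ' g m - m :=
  H1.mk_eq_zero (Z1.map φ hφ u hu (Z1.map (conjHom N σ) (continuous_conjHom N σ) (ρ σ) _ c))

open Topology in
theorem conj_eventually [CompactSpace N] (hρ : ∀ m : M, ∀ᶠ σ in 𝓝 (1 : G), ρ σ m = m)
    (c : H1 (ρ.comp N.subtype)) : ∀ᶠ σ in 𝓝 (1 : G), conj ρ N σ c = c := by
  obtain ⟨c, rfl⟩ := H1.mk_surjective _ c
  · have key : ∀ᶠ σ in 𝓝 (1 : G), ∀ n ∈ (Set.univ : Set N), ρ σ (c.1 (conjHom N σ n)) = c.1 n := by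
      refine isCompact_univ.eventually_forall_of_forall_eventually fun n _ => ?_
      have hcont : Continuous fun x : G × N => conjHom N x.1 x.2 := by
        refine continuous_induced_rng.2 ?_
        have : (Subtype.val ∘ fun x : G × N => conjHom N x.1 x.2) =
            fun x : G × N => x.1⁻¹ * (x.2 : G) * x.1 := by
          ext x; exact coe_conjHom N x.1 x.2
        rw [this]
        fun_prop
      have h1 : ∀ᶠ x : G × N in 𝓝 (1, n), c.1 (conjHom N x.1 x.2) = c.1 n := by
        have h0 : conjHom N 1 n = n := by ext; simp [coe_conjHom]
        have := (c.2.1.comp_continuous hcont).eventually_eq (1, n)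
        simpa [h0] using this
      have h2 : ∀ᶠ x : G × N in 𝓝 (1, n), c.1 x.2 = c.1 n :=
        (continuous_snd.tendsto ((1 : G), n)).eventually (c.2.1.eventually_eq n)
      have h3 : ∀ᶠ x : G × N in 𝓝 (1, n), ρ x.1 (c.1 n) = c.1 n :=
        (continuous_fst.tendsto ((1 : G), n)).eventually (hρ (c.1 n))
      filter_upwards [h1, h2, h3] with x hx1 hx2 hx3
      rw [hx1, hx2, hx3]
    filter_upwards [key] with σ hσ
    refine congrArg (H1.mk _) ?_
    ext n
    exact hσ n trivial

theorem H1.exists_pow_nsmul {G : Type*} [Group G] [TopologicalSpace G] [CompactSpace G] {p : ℕ} {k : ℕ∞} {A : Type*} [AddCommGroup A]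
    (ρ : G →* AddMonoid.End (pTors p k A)) (c : H1 ρ) : ∃ n : ℕ, p ^ n • c = 0 := by
  obtain ⟨c, rfl⟩ := H1.mk_surjective _ c
  · have hfin := c.2.1.range_finite
    choose n _ hn using fun a : pTors p k A => a.2
    obtain ⟨b, hb⟩ := (hfin.image n).bddAbove
    refine ⟨b, ?_⟩
    have : p ^ b • c = 0 := by
      ext g
      have hle : n (c.1 g) ≤ b := hb ⟨_, ⟨g, rfl⟩, rfl⟩
      obtain ⟨d, hd⟩ := Nat.exists_eq_add_of_le hle
      simp only [AddSubgroup.coe_nsmul, Pi.smul_apply, AddSubgroup.coe_zero, Pi.zero_apply]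
      rw [hd, pow_add, mul_comm, mul_smul, hn, smul_zero]
    rw [← map_nsmul, this, map_zero]

end ContH1

/-- If `e ^ (p ^ m)` fixes `x` and `p ^ n x = 0`, then a power of `e - 1` kills `x`. -/
theorem exists_pow_sub_one_apply_eq_zero {A : Type*} [AddCommGroup A] {p : ℕ} (hp : p.Prime)
    (e : AddMonoid.End A) (x : A) {m n : ℕ} (hm : (e ^ p ^ m) x = x) (hn : p ^ n • x = 0) :
    ∃ k : ℕ, ((e - 1) ^ k : AddMonoid.End A) x = 0 := by
  obtain ⟨r, hr⟩ := exists_add_pow_prime_pow_eq hp (Polynomial.X : Polynomial ℤ) 1 m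
  set t : AddMonoid.End A := e - 1 with ht
  have h1 := congrArg (Polynomial.aeval t) hr
  set R : Polynomial ℤ := -(Polynomial.X * r)
  have h2 : t ^ p ^ m = e ^ p ^ m - 1 + p * Polynomial.aeval t R := by
    simp only [R, map_pow, map_add, map_mul, Polynomial.aeval_X, map_one, one_pow, mul_one,
      map_natCast, map_neg] at h1 ⊢
    rw [ht, sub_add_cancel] at h1
    rw [ht, h1]
    noncomm_ring
  have h3 : (t ^ p ^ m : AddMonoid.End A) x = p • (Polynomial.aeval t R) x := by
    rw [h2]
    change (e ^ p ^ m) x - x + (p : AddMonoid.End A) ((Polynomial.aeval t R) x) = _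
    rw [hm, sub_self, zero_add, AddMonoid.End.natCast_apply]
  have h4 : ∀ j : ℕ, (t ^ (p ^ m * j) : AddMonoid.End A) x =
      p ^ j • (Polynomial.aeval t (R ^ j)) x := by
    intro j
    induction j with
    | zero => simp
    | succ j ih =>
      have hc : t ^ p ^ m * Polynomial.aeval t (R ^ j) = Polynomial.aeval t (R ^ j) * t ^ p ^ m := by
        have : t ^ p ^ m = Polynomial.aeval t (Polynomial.X ^ p ^ m : Polynomial ℤ) := by simp
        rw [this, ← map_mul, mul_comm, map_mul]
      have hc' : (t ^ p ^ m : AddMonoid.End A) ((Polynomial.aeval t (R ^ j)) x) =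
          (Polynomial.aeval t (R ^ j)) ((t ^ p ^ m : AddMonoid.End A) x) :=
        DFunLike.congr_fun hc x
      rw [Nat.mul_succ, add_comm, pow_add]
      change (t ^ p ^ m : AddMonoid.End A) ((t ^ (p ^ m * j) : AddMonoid.End A) x) = _
      rw [ih, map_nsmul, hc', h3, map_nsmul, ← mul_smul, ← pow_succ]
      congr 1
      rw [pow_succ, map_mul]
      rfl
  refine ⟨p ^ m * n, ?_⟩
  rw [h4, ← map_nsmul, hn, map_zero]

/-! ### Modules over the Iwasawa algebra `Λ = ℤ_p⟦T⟧` -/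

/-- The Iwasawa algebra `Λ = ℤ_p⟦T⟧`. -/
abbrev IwasawaAlg (p : ℕ) [Fact p.Prime] : Type := PowerSeries ℤ_[p]

namespace IwasawaAlg

open Polynomial

variable (p : ℕ) [Fact p.Prime]

/-- The natural map `ℤ[T] → Λ`. -/
def ofPoly : ℤ[X] →+* IwasawaAlg p :=
  (Polynomial.coeToPowerSeries.ringHom).comp (Polynomial.mapRingHom (Int.castRingHom ℤ_[p]))

theorem coeff_ofPoly (q : ℤ[X]) (i : ℕ) :
    PowerSeries.coeff i (ofPoly p q) = (q.coeff i : ℤ_[p]) := by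
  simp [ofPoly]

/-- The ideal of power series whose first `k` coefficients are divisible by `p ^ k`. -/
def trivIdeal (k : ℕ) : Ideal (IwasawaAlg p) where
  carrier := {g | ∀ i < k, (p : ℤ_[p]) ^ k ∣ PowerSeries.coeff i g}
  zero_mem' := by intro i _; simp
  add_mem' := by
    intro a b ha hb i hi
    rw [map_add]
    exact dvd_add (ha i hi) (hb i hi)
  smul_mem' := by
    intro c a ha i hi
    rw [smul_eq_mul, PowerSeries.coeff_mul]
    refine Finset.dvd_sum fun x hx => Dvd.dvd.mul_left (ha _ ?_) _
    have := Finset.HasAntidiagonal.mem_antidiagonal.1 hx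
    omega

theorem trivIdeal_anti {j k : ℕ} (h : j ≤ k) : trivIdeal p k ≤ trivIdeal p j :=
  fun _ hg i hi => (pow_dvd_pow _ h).trans (hg i (hi.trans_le h))

/-- An integral polynomial of degree `< k` that is congruent to `g` modulo
`(p ^ k, T ^ k)`. -/
def approx (k : ℕ) (g : IwasawaAlg p) : ℤ[X] :=
  ∑ i ∈ Finset.range k, Polynomial.monomial i (((PowerSeries.coeff i g).appr k : ℕ) : ℤ)

theorem approx_sub_mem (k : ℕ) (g : IwasawaAlg p) : ofPoly p (approx p k g) - g ∈ trivIdeal p k := by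
  intro i hi
  rw [map_sub, coeff_ofPoly, approx, Polynomial.finsetSum_coeff]
  simp only [Polynomial.coeff_monomial]
  rw [Finset.sum_ite_eq' (Finset.range k) i, if_pos (Finset.mem_range.2 hi)]
  have := PadicInt.appr_spec k (PowerSeries.coeff i g)
  rw [Ideal.mem_span_singleton] at this
  rw [← dvd_neg, neg_sub]
  simpa using this

variable {p} {A : Type*} [AddCommGroup A] {τ : AddMonoid.End A}

theorem aeval_eq_zero {k : ℕ} {a : A} (h1 : p ^ k • a = 0) (h2 : (τ ^ k : AddMonoid.End A) a = 0)
    {q : ℤ[X]} (hq : ofPoly p q ∈ trivIdeal p k) : (Polynomial.aeval τ q) a = 0 := by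
  rw [Polynomial.aeval_eq_sum_range]
  refine (AddMonoidHom.finsetSum_apply _ _ _).trans (Finset.sum_eq_zero fun i _ => ?_)
  change q.coeff i • ((τ ^ i : AddMonoid.End A) a) = 0
  rcases lt_or_ge i k with hi | hi
  · have := hq i hi
    rw [coeff_ofPoly, PadicInt.pow_p_dvd_int_iff] at this
    obtain ⟨c, hc⟩ := this
    rw [← map_zsmul, hc, mul_comm, mul_smul]
    have h3 : ((p : ℤ) ^ k) • a = 0 := by
      rw [← h1, ← natCast_zsmul]; push_cast; rfl
    rw [h3, smul_zero, map_zero]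
  · obtain ⟨d, rfl⟩ := Nat.exists_eq_add_of_le hi
    rw [add_comm, pow_add]
    change q.coeff _ • (τ ^ d : AddMonoid.End A) ((τ ^ k : AddMonoid.End A) a) = 0
    rw [h2, map_zero, smul_zero]

open Classical in
/-- The element `g • a = ∑ i, g_i τ ^ i a`: since `p ^ k` and `τ ^ k` kill `a` for some `k`, only
`g` modulo `(p ^ k, T ^ k)` matters, and an integral polynomial congruent to `g` is applied. -/
def discreteSMul (hτ : ∀ a : A, ∃ k : ℕ, p ^ k • a = 0 ∧ (τ ^ k : AddMonoid.End A) a = 0)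
    (g : IwasawaAlg p) (a : A) : A :=
  (Polynomial.aeval τ (approx p (Nat.find (hτ a)) g)) a

theorem discreteSMul_eq
    (hτ : ∀ a : A, ∃ k : ℕ, p ^ k • a = 0 ∧ (τ ^ k : AddMonoid.End A) a = 0)
    {g : IwasawaAlg p} {a : A} {k : ℕ} (h1 : p ^ k • a = 0)
    (h2 : (τ ^ k : AddMonoid.End A) a = 0) {q : ℤ[X]} (hq : ofPoly p q - g ∈ trivIdeal p k) :
    discreteSMul hτ g a = (Polynomial.aeval τ q) a := by
  classical
  have hle : Nat.find (hτ a) ≤ k := Nat.find_min' (hτ a) ⟨h1, h2⟩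
  have hs := Nat.find_spec (hτ a)
  rw [discreteSMul, ← sub_eq_zero]
  change (Polynomial.aeval τ _ - Polynomial.aeval τ q : AddMonoid.End A) a = 0
  rw [← map_sub]
  refine aeval_eq_zero (p := p) (k := Nat.find (hτ a)) ?_ ?_ ?_
  · convert hs.1
  · convert hs.2
  · rw [map_sub]
    have h3 := approx_sub_mem p (Nat.find (hτ a)) g
    have h4 := trivIdeal_anti p hle hq
    convert Ideal.sub_mem _ h3 h4 using 1
    ring

/-- A `p`-primary abelian group with a locally nilpotent endomorphism `τ` is a `Λ`-module on which
`T` acts as `τ`. -/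
@[reducible]
def discreteModule (hτ : ∀ a : A, ∃ k : ℕ, p ^ k • a = 0 ∧ (τ ^ k : AddMonoid.End A) a = 0) :
    Module (IwasawaAlg p) A where
  smul := discreteSMul hτ
  one_smul a := by
    obtain ⟨k, h1, h2⟩ := hτ a
    refine (discreteSMul_eq hτ h1 h2 (q := 1) (by simp)).trans ?_
    simp
  mul_smul g g' a := by
    obtain ⟨k, h1, h2⟩ := hτ a
    have e1 : discreteSMul hτ g' a = _ := discreteSMul_eq hτ h1 h2 (approx_sub_mem p k g')
    change discreteSMul hτ (g * g') a = discreteSMul hτ g (discreteSMul hτ g' a)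
    have h2' : (τ ^ k : AddMonoid.End A) ((Polynomial.aeval τ (approx p k g')) a) = 0 := by
      have hc : τ ^ k * Polynomial.aeval τ (approx p k g') =
          Polynomial.aeval τ (approx p k g') * τ ^ k := by
        have : τ ^ k = Polynomial.aeval τ (Polynomial.X ^ k : ℤ[X]) := by simp
        rw [this, ← map_mul, mul_comm, map_mul]
      refine (DFunLike.congr_fun hc a).trans ?_
      change (Polynomial.aeval τ (approx p k g')) ((τ ^ k : AddMonoid.End A) a) = 0
      rw [h2, map_zero]
    rw [e1, discreteSMul_eq hτ (k := k) (by rw [← map_nsmul, h1, map_zero]) h2'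
      (approx_sub_mem p k g), discreteSMul_eq hτ h1 h2 (q := approx p k g * approx p k g'),
      map_mul]
    · rfl
    · have h3 := Ideal.mul_mem_right (ofPoly p (approx p k g')) _ (approx_sub_mem p k g)
      have h4 := Ideal.mul_mem_left _ g (approx_sub_mem p k g')
      convert Ideal.add_mem _ h3 h4 using 1
      rw [map_mul]
      ring
  smul_zero g := by
    change (Polynomial.aeval τ _) 0 = 0
    rw [map_zero]
  smul_add g a b := by
    obtain ⟨j, a1, a2⟩ := hτ a
    obtain ⟨k, b1, b2⟩ := hτ b
    have a1' : p ^ (k + j) • a = 0 := by rw [pow_add, mul_smul, a1, smul_zero]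
    have b1' : p ^ (k + j) • b = 0 := by rw [add_comm, pow_add, mul_smul, b1, smul_zero]
    have a2' : (τ ^ (k + j) : AddMonoid.End A) a = 0 := by
      rw [pow_add]
      change (τ ^ k : AddMonoid.End A) ((τ ^ j : AddMonoid.End A) a) = 0
      rw [a2, map_zero]
    have b2' : (τ ^ (k + j) : AddMonoid.End A) b = 0 := by
      rw [add_comm, pow_add]
      change (τ ^ j : AddMonoid.End A) ((τ ^ k : AddMonoid.End A) b) = 0
      rw [b2, map_zero]
    change discreteSMul hτ g (a + b) = discreteSMul hτ g a + discreteSMul hτ g b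
    rw [discreteSMul_eq hτ a1' a2' (approx_sub_mem p _ g),
      discreteSMul_eq hτ b1' b2' (approx_sub_mem p _ g),
      discreteSMul_eq hτ (by rw [smul_add, a1', b1', add_zero])
        (by rw [map_add, a2', b2', add_zero]) (approx_sub_mem p (k + j) g), map_add]
  add_smul g g' a := by
    obtain ⟨k, h1, h2⟩ := hτ a
    change discreteSMul hτ (g + g') a = discreteSMul hτ g a + discreteSMul hτ g' a
    rw [discreteSMul_eq hτ h1 h2 (approx_sub_mem p k g),
      discreteSMul_eq hτ h1 h2 (approx_sub_mem p k g'),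
      discreteSMul_eq hτ h1 h2 (q := approx p k g + approx p k g'), map_add]
    · rfl
    · convert Ideal.add_mem _ (approx_sub_mem p k g) (approx_sub_mem p k g') using 1
      rw [map_add]
      ring
  zero_smul a := by
    obtain ⟨k, h1, h2⟩ := hτ a
    refine (discreteSMul_eq hτ h1 h2 (q := 0) (by simp)).trans ?_
    simp

theorem X_discreteSMul
    (hτ : ∀ a : A, ∃ k : ℕ, p ^ k • a = 0 ∧ (τ ^ k : AddMonoid.End A) a = 0) (a : A) :
    discreteSMul hτ (PowerSeries.X : IwasawaAlg p) a = τ a := by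
  obtain ⟨k, h1, h2⟩ := hτ a
  rw [discreteSMul_eq hτ h1 h2 (q := Polynomial.X) (by simp [ofPoly])]
  simp

end IwasawaAlg

/-- The Pontryagin dual `Hom(A, ℚ_p / ℤ_p)` of a discrete `p`-primary abelian group. -/
def PontDual (p : ℕ) [Fact p.Prime] (A : Type*) [AddCommGroup A] : Type _ :=
  A →+ ℚ_[p] ⧸ (PadicInt.subring p).toAddSubgroup

namespace PontDual

variable (p : ℕ) [Fact p.Prime] (A : Type*) [AddCommGroup A]

instance : AddCommGroup (PontDual p A) :=
  inferInstanceAs (AddCommGroup (A →+ ℚ_[p] ⧸ (PadicInt.subring p).toAddSubgroup))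

/-- The dual of a module over a commutative ring: `(r f)(a) = f (r a)`. -/
instance {R : Type*} [CommRing R] [Module R A] : Module R (PontDual p A) where
  smul r f := AddMonoidHom.comp f (DistribSMul.toAddMonoidHom A r)
  one_smul f := AddMonoidHom.ext fun a => congrArg f.toFun (one_smul R a)
  mul_smul r s f := AddMonoidHom.ext fun a =>
    congrArg f.toFun (by rw [mul_comm]; exact mul_smul s r a)
  smul_zero r := rfl
  smul_add r f g := rfl
  add_smul r s f := AddMonoidHom.ext fun a =>
    (congrArg f.toFun (add_smul r s a)).trans (AddMonoidHom.map_add f _ _)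
  zero_smul f := AddMonoidHom.ext fun a =>
    (congrArg f.toFun (zero_smul R a)).trans (AddMonoidHom.map_zero f)

end PontDual

/-- The data of an elementary `Λ`-module
`Λ ^ r ⊕ ⨁ i, Λ / (p ^ μ_i) ⊕ ⨁ j, Λ / (f_j ^ λ_j)` with positive `μ_i`, `λ_j` and irreducible
distinguished polynomials `f_j`. -/
structure ElementaryData (p : ℕ) [Fact p.Prime] where
  r : ℕ
  s : ℕ
  mu : Fin s → ℕ
  mu_pos : ∀ i, 0 < mu i
  t : ℕ
  f : Fin t → Polynomial ℤ_[p]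
  distinguished : ∀ j, (f j).IsDistinguishedAt (Ideal.span {(p : ℤ_[p])})
  irreducible : ∀ j, Irreducible (f j)
  lam : Fin t → ℕ
  lam_pos : ∀ j, 0 < lam j

/-- The elementary `Λ`-module attached to the data. -/
abbrev ElementaryData.Mod {p : ℕ} [Fact p.Prime] (D : ElementaryData p) : Type :=
  (Fin D.r → IwasawaAlg p) ×
  ((i : Fin D.s) → IwasawaAlg p ⧸ Ideal.span {(p : IwasawaAlg p) ^ D.mu i}) ×
  ((j : Fin D.t) → IwasawaAlg p ⧸ Ideal.span {(D.f j : IwasawaAlg p) ^ D.lam j})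

/-- A pseudo-isomorphism: a linear map with finite kernel and cokernel. -/
def IsPseudoIso {R M N : Type*} [CommRing R] [AddCommGroup M] [AddCommGroup N] [Module R M]
    [Module R N] (φ : M →ₗ[R] N) : Prop :=
  Finite (LinearMap.ker φ) ∧ Finite (N ⧸ LinearMap.range φ)

/-- `M` has Iwasawa invariants `μ(M) = m` and `λ(M) = l`: it is pseudo-isomorphic to an
elementary module with `∑ μ_i = m` and `∑ λ_j deg f_j = l`. -/
def HasIwasawaInvariants (p : ℕ) [Fact p.Prime] (M : Type*) [AddCommGroup M]
    [Module (IwasawaAlg p) M] (m l : ℕ) : Prop :=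
  ∃ (D : ElementaryData p) (φ : M →ₗ[IwasawaAlg p] D.Mod), IsPseudoIso φ ∧
    ∑ i, D.mu i = m ∧ ∑ j, D.lam j * (D.f j).natDegree = l

/-! ### Points of elliptic curves as Galois modules -/

/-- The group `E(L)` of `L`-points of a Weierstrass curve `E` over `F`. -/
def Pts {F : Type*} [Field F] (E : WeierstrassCurve F) (L : Type*) [Field L] [Algebra F L] :
    Type _ :=
  (E.baseChange L).toAffine.Point

namespace Pts

open Classical in
instance {F : Type*} [Field F] (E : WeierstrassCurve F) (L : Type*) [Field L] [Algebra F L] :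
    AddCommGroup (Pts E L) :=
  inferInstanceAs (AddCommGroup (E.baseChange L).toAffine.Point)

variable {F : Type*} [Field F] (E : WeierstrassCurve F) {L L' : Type*} [Field L] [Algebra F L]
  [Field L'] [Algebra F L']

open Classical in
/-- The homomorphism `E(L) → E(L')` induced by an embedding `L → L'` over `F`. -/
def map (f : L →ₐ[F] L') : Pts E L →+ Pts E L' :=
  WeierstrassCurve.Affine.Point.map (W' := E.toAffine) f

theorem map_map {L'' : Type*} [Field L''] [Algebra F L''] (f : L →ₐ[F] L') (g : L' →ₐ[F] L'')
    (P : Pts E L) : map E g (map E f P) = map E (g.comp f) P := by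
  classical
  exact WeierstrassCurve.Affine.Point.map_map (W' := E.toAffine) f g P

variable (L) in
/-- The action of `Gal(L/F)` on `E(L)`. -/
def rep : Gal(L/F) →* AddMonoid.End (Pts E L) where
  toFun σ := map E σ.toAlgHom
  map_one' := by
    ext P
    rcases P with _ | ⟨x, y, h⟩ <;> rfl
  map_mul' σ τ := by
    ext P
    exact (map_map E τ.toAlgHom σ.toAlgHom P).symm

open Topology in
theorem rep_eventually [Algebra.IsAlgebraic F L] (P : Pts E L) :
    ∀ᶠ σ in 𝓝 (1 : Gal(L/F)), rep E L σ P = P := by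
  rcases P with _ | ⟨x, y, h⟩
  · exact Filter.Eventually.of_forall fun σ => rfl
  · rw [Filter.Eventually, krullTopology_mem_nhds_one_iff]
    refine ⟨IntermediateField.adjoin F {x, y}, ?_, ?_⟩
    · exact IntermediateField.finiteDimensional_adjoin fun z _ =>
        Algebra.IsIntegral.isIntegral z
    · intro σ hσ
      rw [SetLike.mem_coe, IntermediateField.mem_fixingSubgroup_iff] at hσ
      have hx : σ x = x := hσ _ (IntermediateField.subset_adjoin _ _ (by simp))
      have hy : σ y = y := hσ _ (IntermediateField.subset_adjoin _ _ (by simp))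
      have key : ∀ (x' y' : L) (h' : (E.baseChange L).toAffine.Nonsingular x' y'),
          x' = x → y' = y → WeierstrassCurve.Affine.Point.some x' y' h' =
            WeierstrassCurve.Affine.Point.some x y h := by
        rintro _ _ _ rfl rfl
        rfl
      exact key _ _ _ hx hy

end Pts

/-! ### The fine Selmer groups -/

namespace FineSelmer

open NumberField IsDedekindDomain ContH1 Topology

variable {F : Type*} [Field F] [NumberField F]

/-- `E` has good reduction at the prime `v`: a Weierstrass equation of `E` that is minimal at `v`
has good reduction. -/
def HasGoodReductionAt (E : WeierstrassCurve F) (v : HeightOneSpectrum (𝓞 F)) : Prop :=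
  (E.minimal (v.valuation F).valuationSubring).HasGoodReduction (v.valuation F).valuationSubring

/-- The set `S` of primes of `F` that lie above `p` or at which `E` has bad reduction. -/
def badPrimes (E : WeierstrassCurve F) (p : ℕ) : Set (HeightOneSpectrum (𝓞 F)) :=
  {v | (p : 𝓞 F) ∈ v.asIdeal ∨ ¬ HasGoodReductionAt E v}

/-- The set `v(L)` of places of an algebraic extension `L` above the prime `v` of `F`, a place
being given by its valuation ring. -/
def placesOver (L : Type*) [Field L] [Algebra F L] (v : HeightOneSpectrum (𝓞 F)) :
    Set (ValuationSubring L) :=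
  {w | w.comap (algebraMap F L) = (v.valuation F).valuationSubring}

/-- The extension `L/F` is unramified at `v`: the inertia groups in `Gal(F̄/F)` of all places
above `v` act trivially on `L`. -/
def IsUnramifiedAt (L : IntermediateField F (AlgebraicClosure F)) (v : HeightOneSpectrum (𝓞 F)) :
    Prop :=
  ∀ w ∈ placesOver (AlgebraicClosure F) v, ∀ σ ∈ w.inertiaSubgroup F,
    ∀ x ∈ L, (σ : Gal(AlgebraicClosure F/F)) x = x

/-- The maximal extension `F_S` of `F` in `F̄` that is unramified at all primes outside `S`. -/
def maxUnram (S : Set (HeightOneSpectrum (𝓞 F))) : IntermediateField F (AlgebraicClosure F) :=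
  sSup {L | ∀ v ∉ S, IsUnramifiedAt L v}

theorem mem_inertia_iff (w : ValuationSubring (AlgebraicClosure F))
    (σ : w.decompositionSubgroup F) :
    σ ∈ w.inertiaSubgroup F ↔ ∀ x ∈ w, (σ : Gal(AlgebraicClosure F/F)) x - x = 0 ∨
      ((σ : Gal(AlgebraicClosure F/F)) x - x)⁻¹ ∉ w := by
  have key : ∀ a : w, (σ • IsLocalRing.residue w a = IsLocalRing.residue w a ↔
      ((σ : Gal(AlgebraicClosure F/F)) a - a = 0 ∨
        ((σ : Gal(AlgebraicClosure F/F)) a - a)⁻¹ ∉ w)) := by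
    intro a
    rw [← IsLocalRing.ResidueField.residue_smul, ← sub_eq_zero, ← map_sub,
      IsLocalRing.residue_eq_zero_iff, IsLocalRing.mem_maximalIdeal, mem_nonunits_iff]
    have hcoe : ((σ • a - a : w) : AlgebraicClosure F) =
        (σ : Gal(AlgebraicClosure F/F)) a - a := rfl
    rw [← hcoe]
    generalize σ • a - a = b
    constructor
    · intro h
      by_contra! hc
      refine h (isUnit_iff_exists_inv.2 ⟨⟨_, hc.2⟩, Subtype.ext (mul_inv_cancel₀ hc.1)⟩)
    · rintro h hu
      obtain ⟨c, hc⟩ := isUnit_iff_exists_inv.1 hu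
      have hc' : (b : AlgebraicClosure F) * c = 1 := congrArg Subtype.val hc
      rcases h with h | h
      · rw [h, zero_mul] at hc'
        exact zero_ne_one hc'
      · exact h (by rw [inv_eq_of_mul_eq_one_right hc']; exact c.2)
  rw [ValuationSubring.inertiaSubgroup, MonoidHom.mem_ker]
  constructor
  · intro h x hx
    exact (key ⟨x, hx⟩).1 (RingEquiv.congr_fun h _)
  · intro h
    ext y
    obtain ⟨a, rfl⟩ := IsLocalRing.residue_surjective y
    exact (key a).2 (h a a.2)

theorem smul_mem_placesOver {L : Type*} [Field L] [Algebra F L] {v : HeightOneSpectrum (𝓞 F)}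
    {w w' : ValuationSubring L} (g : L ≃ₐ[F] L) (h : ∀ x, x ∈ w' ↔ g x ∈ w)
    (hw : w ∈ placesOver L v) : w' ∈ placesOver L v := by
  rw [placesOver, Set.mem_ofPred_eq] at hw ⊢
  rw [← hw]
  ext x
  simp [h]

open Pointwise in
theorem IsUnramifiedAt.map {L : IntermediateField F (AlgebraicClosure F)}
    {v : HeightOneSpectrum (𝓞 F)} (h : IsUnramifiedAt L v) (g : Gal(AlgebraicClosure F/F)) :
    IsUnramifiedAt (L.map g.toAlgHom) v := by
  rintro w hw σ hσ _ ⟨x, hx, rfl⟩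
  let w' : ValuationSubring (AlgebraicClosure F) := w.comap (g : AlgebraicClosure F →+* _)
  have hmem : ∀ x, x ∈ w' ↔ g x ∈ w := fun x => Iff.rfl
  have hst : ∀ x, (σ : Gal(AlgebraicClosure F/F)) x ∈ w ↔ x ∈ w := by
    intro x
    have h2 := ValuationSubring.smul_mem_pointwise_smul_iff
      (g := (σ : Gal(AlgebraicClosure F/F))) (S := w) (x := x)
    rwa [show (σ : Gal(AlgebraicClosure F/F)) • w = w from σ.2] at h2
  have hdec : g⁻¹ * σ * g ∈ w'.decompositionSubgroup F := by
    rw [MulAction.mem_stabilizer_iff]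
    ext x
    rw [ValuationSubring.mem_pointwise_smul_iff_inv_smul_mem]
    have h3 : g ((g⁻¹ * σ * g)⁻¹ • x) = (σ : Gal(AlgebraicClosure F/F))⁻¹ (g x) := by
      simp [mul_assoc, AlgEquiv.smul_def]
    rw [hmem, h3, ← hst, ← AlgEquiv.mul_apply, mul_inv_cancel, hmem]
    rfl
  have hin : (⟨_, hdec⟩ : w'.decompositionSubgroup F) ∈ w'.inertiaSubgroup F := by
    rw [mem_inertia_iff] at hσ ⊢
    intro x hx
    have h4 : (g⁻¹ * σ * g) x - x =
        g⁻¹ ((σ : Gal(AlgebraicClosure F/F)) (g x) - g x) := by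
      simp
    rcases hσ (g x) hx with h5 | h5
    · left; rw [h4, h5, map_zero]
    · right
      rw [hmem, h4, map_inv₀]
      simpa using h5
  have := h w' (smul_mem_placesOver g hmem hw) _ hin x hx
  have h6 := congrArg g this
  simpa using h6

instance (S : Set (HeightOneSpectrum (𝓞 F))) : Normal F (maxUnram S) := by
  rw [IntermediateField.normal_iff_forall_map_le']
  intro g
  rw [IntermediateField.map_le_iff_le_comap, maxUnram, sSup_le_iff]
  intro L hL
  rw [← IntermediateField.map_le_iff_le_comap]
  exact le_sSup fun v hv => (hL v hv).map g

instance (S : Set (HeightOneSpectrum (𝓞 F))) : IsGalois F (maxUnram S) := ⟨⟩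

variable (E : WeierstrassCurve F) (p : ℕ) (k : ℕ∞)
  (Finf : IntermediateField F (AlgebraicClosure F))

/-- The field `F_S` for the set `S` of primes above `p` or of bad reduction. -/
abbrev FS : IntermediateField F (AlgebraicClosure F) := maxUnram (badPrimes E p)

/-- The Galois group `Gal(F_S/F_∞)` for `F ⊆ F_∞ ⊆ F_S`, as the subgroup of `Gal(F_S/F)` of
automorphisms that fix `F_∞`. -/
def galS : Subgroup Gal(FS E p/F) := (Finf.comap (FS E p).val).fixingSubgroup

theorem mem_galS {τ : Gal(FS E p/F)} :
    τ ∈ galS E p Finf ↔ ∀ x : FS E p, (x : AlgebraicClosure F) ∈ Finf → τ x = x := by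
  rw [galS, IntermediateField.mem_fixingSubgroup_iff]
  rfl

/-- The restriction map `Gal(F̄/F) → Gal(F_S/F)`. -/
def resS : Gal(AlgebraicClosure F/F) →* Gal(FS E p/F) := AlgEquiv.restrictNormalHom (FS E p)

theorem coe_resS (σ : Gal(AlgebraicClosure F/F)) (x : FS E p) :
    (resS E p σ x : AlgebraicClosure F) = σ x :=
  AlgEquiv.restrictNormalHom_apply (FS E p) σ x

theorem resS_mem_galS {σ : Gal(AlgebraicClosure F/F)} (hσ : ∀ x ∈ Finf, σ x = x) :
    resS E p σ ∈ galS E p Finf := by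
  rw [mem_galS]
  intro x hx
  ext
  rw [coe_resS, hσ x hx]

instance [Normal F Finf] : (galS E p Finf).Normal := by
  refine ⟨fun τ hτ g => ?_⟩
  rw [mem_galS] at hτ ⊢
  intro x hx
  obtain ⟨σ, rfl⟩ : ∃ σ, resS E p σ = g := AlgEquiv.restrictNormalHom_surjective _ g
  have h1 : (((resS E p σ)⁻¹ x : FS E p) : AlgebraicClosure F) ∈ Finf := by
    rw [← map_inv, coe_resS]
    exact (IntermediateField.normal_iff_forall_map_le'.1 ‹_› σ⁻¹) ⟨_, hx, rfl⟩
  rw [AlgEquiv.mul_apply, AlgEquiv.mul_apply, hτ _ h1, ← AlgEquiv.mul_apply, mul_inv_cancel]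
  rfl

instance : CompactSpace (galS E p Finf) :=
  isCompact_iff_compactSpace.1 (InfiniteGalois.fixingSubgroup_isClosed _).isCompact

/-- The `Gal(F_S/F)`-module `E[p ^ k]`; since `F_S` contains the coordinates of all points of
`p`-power order, these are the points of `E[p ^ k]` over `F_S`. -/
abbrev globalRep : Gal(FS E p/F) →* AddMonoid.End (pTors p k (Pts E (FS E p))) :=
  pTors.rep p k (Pts.rep E (FS E p))

/-- `H¹(F_S/F_∞, E[p ^ k])`. -/
def GlobalH1 : Type _ := H1 ((globalRep E p k).comp (galS E p Finf).subtype)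

instance : AddCommGroup (GlobalH1 E p k Finf) :=
  inferInstanceAs (AddCommGroup (H1 ((globalRep E p k).comp (galS E p Finf).subtype)))

set_option synthInstance.maxHeartbeats 400000 in
variable {Finf} in
/-- A chosen embedding of `F̄` over `F_∞` into an algebraic closure of the completion `F_{∞,w}`. -/
def localEmb (w : ValuationSubring Finf) :
    AlgebraicClosure F →ₐ[Finf] AlgebraicClosure (CompletionAt w) :=
  IsAlgClosed.lift

variable {Finf} in
/-- The restriction map from the absolute Galois group of `F_{∞,w}` to `Gal(F̄/F)`. -/
def localRes (w : ValuationSubring Finf) :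
    Gal(AlgebraicClosure (CompletionAt w)/CompletionAt w) →* Gal(AlgebraicClosure F/F) :=
  resHom ((localEmb w).restrictScalars F)

variable {Finf} in
theorem localEmb_localRes (w : ValuationSubring Finf)
    (τ : Gal(AlgebraicClosure (CompletionAt w)/CompletionAt w)) (x : AlgebraicClosure F) :
    localEmb w (localRes w τ x) = τ (localEmb w x) :=
  resHom_commutes ((localEmb w).restrictScalars F) τ x

variable {Finf} in
theorem localEmb_coe (w : ValuationSubring Finf) (x : Finf) :
    localEmb w (x : AlgebraicClosure F) =
      algebraMap (CompletionAt w) (AlgebraicClosure (CompletionAt w)) (CompletionAt.emb w x) :=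
  (localEmb w).commutes x

variable {Finf} in
theorem localRes_fix (w : ValuationSubring Finf)
    (τ : Gal(AlgebraicClosure (CompletionAt w)/CompletionAt w)) :
    ∀ x ∈ Finf, localRes w τ x = x := by
  intro x hx
  refine (localEmb w).injective ((localEmb_localRes w τ x).trans ?_)
  change τ (localEmb w ((⟨x, hx⟩ : Finf) : AlgebraicClosure F)) =
    localEmb w ((⟨x, hx⟩ : Finf) : AlgebraicClosure F)
  rw [localEmb_coe, AlgEquiv.commutes]

variable {Finf} in
/-- The restriction map from the absolute Galois group of `F_{∞,w}` to `Gal(F_S/F_∞)`. -/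
def localResS (w : ValuationSubring Finf) :
    Gal(AlgebraicClosure (CompletionAt w)/CompletionAt w) →* galS E p Finf :=
  ((resS E p).comp (localRes w)).codRestrict (galS E p Finf) fun τ =>
    resS_mem_galS E p Finf (localRes_fix w τ)

variable {Finf} in
theorem continuous_localResS (w : ValuationSubring Finf) : Continuous (localResS E p w) :=
  continuous_induced_rng.2
    ((InfiniteGalois.restrictNormalHom_continuous (FS E p)).comp
      (resHom_continuous ((localEmb w).restrictScalars F)))

variable {Finf} in
/-- `E[p ^ k]`, the torsion of `E(F̄)`, as a module over the absolute Galois group of `F_{∞,w}`. -/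
abbrev localRep (w : ValuationSubring Finf) :
    Gal(AlgebraicClosure (CompletionAt w)/CompletionAt w) →*
      AddMonoid.End (pTors p k (Pts E (AlgebraicClosure F))) :=
  (pTors.rep p k (Pts.rep E (AlgebraicClosure F))).comp (localRes w)

variable {Finf} in
/-- `H¹(F_{∞,w}, E[p ^ k])`. -/
def LocalH1 (w : ValuationSubring Finf) : Type _ := H1 (localRep E p k w)

variable {Finf} in
instance (w : ValuationSubring Finf) : AddCommGroup (LocalH1 E p k w) :=
  inferInstanceAs (AddCommGroup (H1 (localRep E p k w)))

theorem incl_globalRep (σ : Gal(AlgebraicClosure F/F)) (P : pTors p k (Pts E (FS E p))) :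
    pTors.map p k (Pts.map E (FS E p).val) (globalRep E p k (resS E p σ) P) =
      pTors.rep p k (Pts.rep E (AlgebraicClosure F)) σ
        (pTors.map p k (Pts.map E (FS E p).val) P) := by
  ext
  change Pts.map E (FS E p).val (Pts.map E (resS E p σ).toAlgHom P) =
    Pts.map E σ.toAlgHom (Pts.map E (FS E p).val P)
  rw [Pts.map_map, Pts.map_map]
  congr 2
  ext x
  exact coe_resS E p σ x

variable {Finf} in
/-- The localization map `H¹(F_S/F_∞, E[p ^ k]) → H¹(F_{∞,w}, E[p ^ k])`. -/
def loc (w : ValuationSubring Finf) : GlobalH1 E p k Finf →+ LocalH1 E p k w :=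
  H1.map (localResS E p w) (continuous_localResS E p w) (pTors.map p k (Pts.map E (FS E p).val))
    fun τ P => incl_globalRep E p k (localRes w τ) P

/-- `⨁_{v ∈ S} 𝓗_v(F_∞, E[p ^ k])` with `𝓗_v` the product of the `H¹(F_{∞,w}, E[p ^ k])` over the
places `w` above `v`; as `S` is finite, the direct sum over `S` is a product. -/
abbrev LocalProd : Type _ :=
  (v : badPrimes E p) → (w : placesOver Finf v.1) → LocalH1 E p k w.1

/-- The map `H¹(F_S/F_∞, E[p ^ k]) → ⨁_{v ∈ S} 𝓗_v(F_∞, E[p ^ k])`. -/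
def locMap : GlobalH1 E p k Finf →+ LocalProd E p k Finf where
  toFun c v w := loc E p k w.1 c
  map_zero' := by ext v w; simp
  map_add' a b := by ext v w; simp

/-- The fine Selmer group of `E[p ^ k]` over `F_∞`: for `k = ⊤` this is `R(E/F_∞)`, and for
`k = 1` it is the residual fine Selmer group `R(E[p]/F_∞)`. -/
def fineSelmer : AddSubgroup (GlobalH1 E p k Finf) := (locMap E p k Finf).ker

variable {Finf} in
/-- The map `h_w : H¹(F_{∞,w}, E[p]) → H¹(F_{∞,w}, E[p ^ ∞])` induced by the inclusion
`E[p] → E[p ^ ∞]` (its image is killed by `p`). -/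
def hLocal (w : ValuationSubring Finf) : LocalH1 E p 1 w →+ LocalH1 E p ⊤ w :=
  H1.map (MonoidHom.id _) continuous_id (pTors.incl p 1 _) fun _ _ => rfl

/-- The map `h : ⨁_{v ∈ S} 𝓗_v(F_∞, E[p]) → ⨁_{v ∈ S} 𝓗_v(F_∞, E[p ^ ∞])`. -/
def hMap : LocalProd E p 1 Finf →+ LocalProd E p ⊤ Finf where
  toFun c v w := hLocal E p w.1 (c v w)
  map_zero' := by ext v w; simp
  map_add' a b := by ext v w; simp

instance : Module (ZMod p) (fineSelmer E p 1 Finf) :=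
  AddCommGroup.zmodModule fun c => Subtype.ext (H1.nsmul_eq_zero pTors.nsmul_eq_zero c.1)

instance : Module (ZMod p) (hMap E p Finf).ker :=
  AddCommGroup.zmodModule fun c => Subtype.ext <| funext fun v => funext fun w =>
    H1.nsmul_eq_zero pTors.nsmul_eq_zero (c.1 v w)


/-! ### The action of `Γ = Gal(F_∞/F)` and the `Λ`-module structure -/

variable {Finf} in
/-- The action of `σ ∈ Gal(F̄/F)` on `H¹(F_S/F_∞, E[p ^ k])` by conjugation. -/
def globalConj [Normal F Finf] (σ : Gal(AlgebraicClosure F/F)) :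
    AddMonoid.End (GlobalH1 E p k Finf) :=
  conj (globalRep E p k) (galS E p Finf) (resS E p σ)

variable {Finf} in
theorem globalConj_congr [Normal F Finf] {σ σ' : Gal(AlgebraicClosure F/F)}
    (h : ∀ x ∈ Finf, σ x = σ' x) :
    globalConj E p k σ = globalConj (Finf := Finf) E p k σ' := by
  refine conj_congr _ _ ?_
  rw [← map_inv, ← map_mul]
  refine resS_mem_galS E p Finf fun x hx => ?_
  rw [AlgEquiv.mul_apply, ← h x hx, ← AlgEquiv.mul_apply, inv_mul_cancel]
  rfl

variable {Finf} in
theorem globalConj_mul [Normal F Finf] (σ σ' : Gal(AlgebraicClosure F/F)) :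
    globalConj (Finf := Finf) E p k (σ * σ') = globalConj E p k σ * globalConj E p k σ' := by
  unfold globalConj
  rw [map_mul]
  exact conj_mul _ _ _ _

variable {Finf} in
theorem globalConj_one [Normal F Finf] : globalConj (Finf := Finf) E p k 1 = 1 := by
  unfold globalConj
  rw [map_one]
  exact conj_of_mem _ _ (Subgroup.one_mem _)

/-- Compatibility of conjugation by `σ` with the places `w' = σ⁻¹ w` and `w`: there are an
automorphism `σ'` with the same restriction to `F_∞` as `σ` and a map `τ ↦ τ'` of local Galois
groups such that the restriction of `τ'` is `σ'⁻¹ τ σ'`. -/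
theorem exists_conj_local [Normal F Finf] (σ : Gal(AlgebraicClosure F/F))
    (w : ValuationSubring Finf) :
    ∃ w' : ValuationSubring Finf, (∀ v : HeightOneSpectrum (𝓞 F), w ∈ placesOver Finf v → w' ∈ placesOver Finf v) ∧
    ∃ σ' : Gal(AlgebraicClosure F/F), (∀ x ∈ Finf, σ x = σ' x) ∧
    ∀ τ : Gal(AlgebraicClosure (CompletionAt w)/CompletionAt w),
    ∃ τ' : Gal(AlgebraicClosure (CompletionAt w')/CompletionAt w'),
      localRes w' τ' = σ'⁻¹ * localRes w τ * σ' := by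
  let s : Gal(Finf/F) := AlgEquiv.restrictNormalHom Finf σ
  have hs : ∀ x : Finf, (s x : AlgebraicClosure F) = σ x :=
    fun x => AlgEquiv.restrictNormalHom_apply Finf σ x
  let w' : ValuationSubring Finf := w.comap (s : Finf →+* Finf)
  have hmem : ∀ x, x ∈ w' ↔ s x ∈ w := fun x => Iff.rfl
  refine ⟨w', fun v hw => smul_mem_placesOver s hmem hw, ?_⟩
  let θ : CompletionAt w' ≃+* CompletionAt w := CompletionAt.congr s.toRingEquiv hmem
  obtain ⟨Θ, hΘ⟩ : ∃ Θ : AlgebraicClosure (CompletionAt w') ≃+* AlgebraicClosure (CompletionAt w),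
      ∀ x, Θ (algebraMap _ _ x) = algebraMap _ _ (θ x) :=
    ⟨IsAlgClosure.equivOfEquiv _ _ θ, IsAlgClosure.equivOfEquiv_algebraMap _ _ θ⟩
  have hθ : ∀ x : Finf, Θ (localEmb w' x) = localEmb w (s x : AlgebraicClosure F) := by
    intro x
    rw [localEmb_coe, localEmb_coe, hΘ]
    congr 1
    exact CompletionAt.congr_emb s.toRingEquiv hmem x
  obtain ⟨σ', hσ'⟩ : ∃ σ' : Gal(AlgebraicClosure F/F), ∀ x,
      localEmb w (σ' x) = Θ (localEmb w' x) := by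
    let a : AlgebraicClosure F →ₐ[F] AlgebraicClosure (CompletionAt w) :=
      (localEmb w).restrictScalars F
    let b : AlgebraicClosure F →ₐ[F] AlgebraicClosure (CompletionAt w) :=
      { toRingHom := Θ.toRingHom.comp (localEmb w').toRingHom
        commutes' := fun x => by
          have h1 := hθ (algebraMap F Finf x)
          rw [s.commutes] at h1
          refine h1.trans ?_
          exact a.commutes x }
    let _ : Algebra (AlgebraicClosure F) (AlgebraicClosure (CompletionAt w)) :=
      a.toRingHom.toAlgebra
    have : IsScalarTower F (AlgebraicClosure F) (AlgebraicClosure (CompletionAt w)) :=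
      IsScalarTower.of_algebraMap_eq fun x => (a.commutes x).symm
    refine ⟨b.restrictNormal' (AlgebraicClosure F), fun x => ?_⟩
    exact b.restrictNormal_commutes (AlgebraicClosure F) x
  refine ⟨σ', fun x hx => ?_, fun τ => ?_⟩
  · refine (localEmb w).injective ?_
    refine Eq.trans ?_ (hσ' x).symm
    refine Eq.trans ?_ (hθ ⟨x, hx⟩).symm
    exact congrArg (localEmb w) (hs ⟨x, hx⟩).symm
  · let τ' : Gal(AlgebraicClosure (CompletionAt w')/CompletionAt w') :=
      AlgEquiv.ofRingEquiv (f := (Θ.trans τ.toRingEquiv).trans Θ.symm) (fun x => by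
        simp only [RingEquiv.trans_apply, hΘ, AlgEquiv.coe_ringEquiv, AlgEquiv.commutes]
        rw [← hΘ, Θ.symm_apply_apply])
    refine ⟨τ', ?_⟩
    ext x
    refine (localEmb w').injective (Θ.injective ?_)
    refine (congrArg Θ (localEmb_localRes w' τ' x)).trans ?_
    have e1 : Θ (τ' (localEmb w' x)) = τ (Θ (localEmb w' x)) := Θ.apply_symm_apply _
    rw [e1]
    refine Eq.trans ?_ (hσ' _)
    rw [← hσ', ← localEmb_localRes, ← AlgEquiv.mul_apply, ← AlgEquiv.mul_apply]
    congr 2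
    group


/-- If `c` is locally trivial at all places above `v`, then so are its translates. -/
theorem loc_conj_eq_zero [Normal F Finf] {v : HeightOneSpectrum (𝓞 F)}
    {c : GlobalH1 E p k Finf} (hc : ∀ w ∈ placesOver Finf v, loc E p k w c = 0)
    (σ : Gal(AlgebraicClosure F/F)) {w : ValuationSubring Finf} (hw : w ∈ placesOver Finf v) :
    loc E p k w (globalConj E p k σ c) = 0 := by
  obtain ⟨w', hw', σ', hres, hτ⟩ := exists_conj_local Finf σ w
  rw [globalConj_congr E p k hres]
  obtain ⟨c, rfl⟩ := H1.mk_surjective _ c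
  · obtain ⟨m, hm⟩ := (H1.map_mk_eq_zero _ _ _ _ c).1 (hc w' (hw' v hw))
    refine (H1.map_conj_mk_eq_zero (localResS E p w) (continuous_localResS E p w)
      _ _ c (resS E p σ')).2 ⟨pTors.rep p k (Pts.rep E (AlgebraicClosure F)) σ' m, fun τ => ?_⟩
    obtain ⟨τ', hτ'⟩ := hτ τ
    have h1 : pTors.map p k (Pts.map E (FS E p).val) (c.1 (localResS E p w' τ')) =
        pTors.rep p k (Pts.rep E (AlgebraicClosure F)) (localRes w' τ') m - m := hm τ'
    have h2 : conjHom (galS E p Finf) (resS E p σ') (localResS E p w τ) = localResS E p w' τ' := by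
      ext1
      rw [coe_conjHom]
      change (resS E p σ')⁻¹ * resS E p (localRes w τ) * resS E p σ' = resS E p (localRes w' τ')
      rw [hτ', map_mul, map_mul, map_inv]
    change pTors.map p k (Pts.map E (FS E p).val) (globalRep E p k (resS E p σ')
      (c.1 (conjHom (galS E p Finf) (resS E p σ') (localResS E p w τ)))) =
      pTors.rep p k (Pts.rep E (AlgebraicClosure F)) (localRes w τ)
        (pTors.rep p k (Pts.rep E (AlgebraicClosure F)) σ' m) -
        pTors.rep p k (Pts.rep E (AlgebraicClosure F)) σ' m
    rw [h2, incl_globalRep, h1, map_sub, hτ']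
    congr 1
    have h3 : ∀ a b : Gal(AlgebraicClosure F/F), pTors.rep p k (Pts.rep E (AlgebraicClosure F)) a
        (pTors.rep p k (Pts.rep E (AlgebraicClosure F)) b m) =
        pTors.rep p k (Pts.rep E (AlgebraicClosure F)) (a * b) m := by
      intro a b
      rw [map_mul]
      rfl
    rw [h3, h3]
    congr 2
    group

theorem conj_mem_fineSelmer [Normal F Finf] (σ : Gal(AlgebraicClosure F/F))
    {c : GlobalH1 E p k Finf} (hc : c ∈ fineSelmer E p k Finf) :
    globalConj E p k σ c ∈ fineSelmer E p k Finf := by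
  have hc' : ∀ v ∈ badPrimes E p, ∀ w ∈ placesOver Finf v, loc E p k w c = 0 := by
    intro v hv w hw
    exact congrFun (congrFun hc ⟨v, hv⟩) ⟨w, hw⟩
  refine funext fun v => funext fun w => ?_
  exact loc_conj_eq_zero E p k Finf (hc' v.1 v.2) σ w.2

variable {Finf} in
/-- A lift of an element of `Gal(F_∞/F)` to `Gal(F̄/F)`. -/
def lift [Normal F Finf] (γ : Gal(Finf/F)) : Gal(AlgebraicClosure F/F) :=
  Function.surjInv (AlgEquiv.restrictNormalHom_surjective (F := F) (K₁ := Finf)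
    (AlgebraicClosure F)) γ

variable {Finf} in
theorem restrict_lift [Normal F Finf] (γ : Gal(Finf/F)) :
    AlgEquiv.restrictNormalHom Finf (lift γ) = γ :=
  Function.surjInv_eq _ γ

variable {Finf} in
/-- The natural action of `γ ∈ Γ = Gal(F_∞/F)` on the fine Selmer group: conjugation by a lift of
`γ`, which does not depend on the lift (see `coe_gammaAct`). -/
def gammaAct [Normal F Finf] (γ : Gal(Finf/F)) : AddMonoid.End (fineSelmer E p k Finf) :=
  ((globalConj E p k (lift γ)).comp
    (fineSelmer E p k Finf).subtype).codRestrict (fineSelmer E p k Finf)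
    fun c => conj_mem_fineSelmer E p k Finf (lift γ) c.2

variable {Finf} in
theorem coe_gammaAct [Normal F Finf] {γ : Gal(Finf/F)} {σ : Gal(AlgebraicClosure F/F)}
    (hσ : AlgEquiv.restrictNormalHom Finf σ = γ) (c : fineSelmer E p k Finf) :
    (gammaAct E p k γ c : GlobalH1 E p k Finf) =
      globalConj E p k σ c := by
  have h : ∀ x ∈ Finf, lift γ x = σ x := by
    intro x hx
    have h1 := AlgEquiv.restrictNormalHom_apply Finf (lift γ) ⟨x, hx⟩
    have h2 := AlgEquiv.restrictNormalHom_apply Finf σ ⟨x, hx⟩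
    rw [restrict_lift] at h1
    rw [hσ] at h2
    exact h1.symm.trans h2
  exact DFunLike.congr_fun (globalConj_congr E p k h) _

variable {Finf} in
theorem gammaAct_mul [Normal F Finf] (γ δ : Gal(Finf/F)) :
    gammaAct E p k (γ * δ) = gammaAct E p k γ * gammaAct E p k δ := by
  refine AddMonoidHom.ext fun c => Subtype.ext ?_
  have h : AlgEquiv.restrictNormalHom Finf (lift γ * lift δ) = γ * δ := by
    rw [map_mul, restrict_lift, restrict_lift]
  refine (coe_gammaAct E p k h c).trans ?_
  rw [globalConj_mul]
  rfl

variable {Finf} in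
theorem gammaAct_one [Normal F Finf] : gammaAct E p k (1 : Gal(Finf/F)) = 1 := by
  refine AddMonoidHom.ext fun c => Subtype.ext ?_
  refine (coe_gammaAct E p k (σ := 1) (map_one _) c).trans ?_
  rw [globalConj_one]
  rfl

variable {Finf} in
theorem gammaAct_pow [Normal F Finf] (γ : Gal(Finf/F)) (n : ℕ) :
    gammaAct E p k (γ ^ n) = gammaAct E p k γ ^ n := by
  induction n with
  | zero => rw [pow_zero, pow_zero, gammaAct_one]
  | succ n ih => rw [pow_succ, gammaAct_mul, ih, pow_succ]

variable {Finf} in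
theorem gammaAct_eventually [IsGalois F Finf] (c : fineSelmer E p k Finf) :
    ∀ᶠ γ in 𝓝 (1 : Gal(Finf/F)), gammaAct E p k γ c = c := by
  have h1 : ∀ᶠ g in 𝓝 (1 : Gal(FS E p/F)),
      conj (globalRep E p k) (galS E p Finf) g c.1 = c.1 := by
    refine conj_eventually _ _ (fun P => ?_) c.1
    filter_upwards [Pts.rep_eventually E P.1] with σ hσ
    exact Subtype.ext hσ
  have h2 : ∀ᶠ σ in 𝓝 (1 : Gal(AlgebraicClosure F/F)),
      globalConj E p k σ c.1 = c.1 := by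
    have hcont : Continuous (resS E p) := InfiniteGalois.restrictNormalHom_continuous (FS E p)
    have := hcont.tendsto 1
    rw [map_one] at this
    exact this.eventually h1
  have hr : Continuous (AlgEquiv.restrictNormalHom (F := F) (K₁ := AlgebraicClosure F) Finf) :=
    InfiniteGalois.restrictNormalHom_continuous Finf
  have hopen : IsOpenMap (AlgEquiv.restrictNormalHom (F := F) (K₁ := AlgebraicClosure F) Finf) :=
    (MonoidHom.isOpenQuotientMap_of_isQuotientMap
      (hr.isClosedMap.isQuotientMap hr
        (AlgEquiv.restrictNormalHom_surjective (AlgebraicClosure F)))).isOpenMap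
  have h3 := hopen.image_mem_nhds h2
  rw [map_one] at h3
  filter_upwards [h3] with γ hγ
  obtain ⟨σ, hσ, rfl⟩ := hγ
  exact Subtype.ext ((coe_gammaAct E p k rfl c).trans hσ)

/-- The extension `L/K` has Galois group topologically isomorphic to `ℤ_p`. -/
class IsZpExtension (p : ℕ) [Fact p.Prime] (K L : Type*) [Field K] [Field L] [Algebra K L] :
    Prop where
  nonempty_equiv : Nonempty (Gal(L/K) ≃ₜ* Multiplicative ℤ_[p])

theorem IsZpExtension.tendsto_pow (p : ℕ) [Fact p.Prime] {K L : Type*} [Field K] [Field L]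
    [Algebra K L] [IsZpExtension p K L] (γ : Gal(L/K)) :
    Filter.Tendsto (fun m : ℕ => γ ^ p ^ m) Filter.atTop (𝓝 1) := by
  obtain ⟨e⟩ := IsZpExtension.nonempty_equiv (p := p) (K := K) (L := L)
  have h1 : Filter.Tendsto (fun m : ℕ => (p : ℤ_[p]) ^ m * (e γ).toAdd) Filter.atTop (𝓝 0) := by
    have : Filter.Tendsto (fun m : ℕ => (p : ℤ_[p]) ^ m) Filter.atTop (𝓝 0) :=
      tendsto_pow_atTop_nhds_zero_of_norm_lt_one (by
        rw [PadicInt.norm_p]; exact inv_lt_one_of_one_lt₀ (by exact_mod_cast (Fact.out : p.Prime).one_lt))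
    simpa using this.mul_const (e γ).toAdd
  have h2 : Filter.Tendsto (fun m : ℕ => e.symm (Multiplicative.ofAdd ((p : ℤ_[p]) ^ m * (e γ).toAdd)))
      Filter.atTop (𝓝 (e.symm (Multiplicative.ofAdd 0))) :=
    ((e.symm.continuous.comp continuous_ofAdd).tendsto 0).comp h1
  have h3 : e.symm (Multiplicative.ofAdd 0) = 1 := map_one e.symm
  rw [h3] at h2
  refine h2.congr fun m => ?_
  apply e.injective
  rw [map_pow]
  refine (e.apply_symm_apply _).trans ?_
  apply Multiplicative.toAdd.injective
  simp [toAdd_pow]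

variable {Finf} in
theorem gammaAct_nilpotent [Fact p.Prime] [IsGalois F Finf] [IsZpExtension p F Finf]
    (γ : Gal(Finf/F)) (c : fineSelmer E p k Finf) :
    ∃ j : ℕ, p ^ j • c = 0 ∧
      ((gammaAct E p k γ - 1) ^ j : AddMonoid.End (fineSelmer E p k Finf)) c = 0 := by
  obtain ⟨n, hn⟩ := H1.exists_pow_nsmul _ c.1
  have hn' : p ^ n • c = 0 := Subtype.ext hn
  obtain ⟨m, hm⟩ := ((IsZpExtension.tendsto_pow p γ).eventually
    (gammaAct_eventually E p k c)).exists
  rw [gammaAct_pow] at hm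
  obtain ⟨j, hj⟩ := exists_pow_sub_one_apply_eq_zero Fact.out _ c hm hn'
  refine ⟨n + j, ?_, ?_⟩
  · rw [add_comm, pow_add, mul_smul, hn', smul_zero]
  · rw [pow_add]
    refine (congrArg ((gammaAct E p k γ - 1) ^ n : AddMonoid.End (fineSelmer E p k Finf)) hj).trans ?_
    exact map_zero _

variable {Finf} in
/-- The fine Selmer group `R(E/F_∞)`, regarded as a module over `Λ = ℤ_p⟦T⟧` on which `T` acts as
`γ - 1`. -/
def SelmerModule [IsGalois F Finf] (_γ : Gal(Finf/F)) : Type _ := fineSelmer E p ⊤ Finf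

variable {Finf} in
instance [IsGalois F Finf] (γ : Gal(Finf/F)) : AddCommGroup (SelmerModule E p γ) :=
  inferInstanceAs (AddCommGroup (fineSelmer E p ⊤ Finf))

variable {Finf} in
instance [Fact p.Prime] [IsGalois F Finf] [IsZpExtension p F Finf] (γ : Gal(Finf/F)) :
    Module (IwasawaAlg p) (SelmerModule E p γ) :=
  IwasawaAlg.discreteModule (A := fineSelmer E p ⊤ Finf) (τ := gammaAct E p ⊤ γ - 1)
    (gammaAct_nilpotent E p ⊤ γ)

variable {Finf} in
theorem X_smul [Fact p.Prime] [IsGalois F Finf] [IsZpExtension p F Finf] (γ : Gal(Finf/F))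
    (c : fineSelmer E p ⊤ Finf) :
    (PowerSeries.X : IwasawaAlg p) • (show SelmerModule E p γ from c) =
      (gammaAct E p ⊤ γ c - c : fineSelmer E p ⊤ Finf) :=
  IwasawaAlg.X_discreteSMul (gammaAct_nilpotent E p ⊤ γ) c

end FineSelmer

end

/-! Everything rests on one count. On points over `F_S` the sequence `0 → E[p] → E[p^∞] → E[p^∞] →
0`, with multiplication by `p` on the right, is exact, so `H¹(F_S/F_∞, E[p])` maps onto the
`p`-torsion of `H¹(F_S/F_∞, E[p^∞])`. A class in `R(E/F_∞)[p]` therefore lifts to a class whose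
localization lies in `ker h`. Localization maps the group of all such lifts to `ker h`, with kernel
`R(E[p]/F_∞)`. Hence `R(E/F_∞)[p]` has at most `p ^ B` elements, where `B` is the sum of the two
dimensions (`finite_torsion_and_card_le`).

Let `X` be the dual of `R(E/F_∞)`. An element of `X / pX` is determined by its restriction to
`R(E/F_∞)[p]`, and `X` is `p`-adically separated because `R(E/F_∞)` is `p`-primary. The complete
form of Nakayama's lemma gives a surjection from `ℤ_p ^ B` onto `X`
(`PontDual.exists_surjective_of_card_le`). So `X` is finitely generated over `ℤ_p`, of rank at most
`B`.

The rest is algebra over `Λ`. By Cayley–Hamilton and Weierstrass preparation a distinguished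
polynomial kills `X` (`exists_distinguished_smul_eq_zero`), so `X` is torsion. A pseudo-isomorphic
elementary module is also finitely generated over `ℤ_p`, which excludes the summands `Λ` and
`Λ/(p^μ)`; its rank is `λ`, and this is at most the rank of `X` (`invariants_of_finite`). An
elementary module exists by the structure theorem over the principal ideal domain `ℚ_p[T]`, after
clearing denominators (`exists_hasIwasawaInvariants`).

The exact sequence needs two facts about elliptic curves, both proved by explicit formulas. The
points over `F̄` form a divisible group (`exists_nsmul_eq`). Points of `p`-power order are fixed by
inertia outside `S`, so they are defined over `F_S` (`rep_eq_of_mem_inertia`); this is the easy half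
of the Néron–Ogg–Shafarevich criterion. -/

noncomputable section

/-! ### Changes of variables on points -/

namespace WeierstrassCurve.Affine

open WeierstrassCurve

variable {K : Type*} [Field K] (W : WeierstrassCurve K) (C : VariableChange K)

theorem variableChange_equation (x y : K) :
    (C • W).toAffine.Equation x y ↔ W.toAffine.Equation (C.u ^ 2 * x + C.r)
      (C.u ^ 3 * y + C.u ^ 2 * C.s * x + C.t) := by
  have hu : (C.u : K) ≠ 0 := C.u.ne_zero
  rw [equation_iff', equation_iff', ← mul_eq_zero_iff_left (pow_ne_zero 6 hu)]
  simp only [variableChange_a₁, variableChange_a₂, variableChange_a₃, variableChange_a₄,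
    variableChange_a₆, Units.val_inv_eq_inv_val]
  congr! 1
  field_simp
  ring

/-- Chain rule: the new partial derivatives are `u⁻³ F_Y` and `u⁻⁴ (F_X + s F_Y)`, which vanish
together exactly when `F_X` and `F_Y` do. -/
theorem variableChange_nonsingular (x y : K) :
    (C • W).toAffine.Nonsingular x y ↔ W.toAffine.Nonsingular (C.u ^ 2 * x + C.r)
      (C.u ^ 3 * y + C.u ^ 2 * C.s * x + C.t) := by
  have hu : (C.u : K) ≠ 0 := C.u.ne_zero
  rw [nonsingular_iff', nonsingular_iff', variableChange_equation]
  refine and_congr_right fun _ => ?_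
  set X := (C.u : K) ^ 2 * x + C.r with hX
  set Y := (C.u : K) ^ 3 * y + C.u ^ 2 * C.s * x + C.t with hY
  have h1 : 2 * y + (C • W).a₁ * x + (C • W).a₃ = (C.u : K)⁻¹ ^ 3 *
      (2 * Y + W.a₁ * X + W.a₃) := by
    simp only [variableChange_a₁, variableChange_a₃, Units.val_inv_eq_inv_val, hX, hY]
    field_simp
    ring
  have h2 : (C • W).a₁ * y - (3 * x ^ 2 + 2 * (C • W).a₂ * x + (C • W).a₄) = (C.u : K)⁻¹ ^ 4 *
      ((W.a₁ * Y - (3 * X ^ 2 + 2 * W.a₂ * X + W.a₄)) + C.s * (2 * Y + W.a₁ * X + W.a₃)) := by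
    simp only [variableChange_a₁, variableChange_a₂, variableChange_a₄, Units.val_inv_eq_inv_val,
      hX, hY]
    field_simp
    ring
  rw [h1, h2]
  have hi : (C.u : K)⁻¹ ≠ 0 := inv_ne_zero hu
  by_cases h : 2 * Y + W.a₁ * X + W.a₃ = 0
  · simp [h]
  · simp [h]

theorem variableChange_negY (x y : K) :
    W.toAffine.negY (C.u ^ 2 * x + C.r) (C.u ^ 3 * y + C.u ^ 2 * C.s * x + C.t) =
      C.u ^ 3 * (C • W).toAffine.negY x y + C.u ^ 2 * C.s * x + C.t := by
  have hu : (C.u : K) ≠ 0 := C.u.ne_zero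
  simp only [negY, variableChange_a₁, variableChange_a₃, Units.val_inv_eq_inv_val]
  field_simp
  ring

theorem variableChange_X_inj {x₁ x₂ : K} :
    (C.u : K) ^ 2 * x₁ + C.r = C.u ^ 2 * x₂ + C.r ↔ x₁ = x₂ := by
  have hu : (C.u : K) ≠ 0 := C.u.ne_zero
  simp [hu]

theorem variableChange_Y_inj {x y₁ y₂ : K} :
    (C.u : K) ^ 3 * y₁ + C.u ^ 2 * C.s * x + C.t = C.u ^ 3 * y₂ + C.u ^ 2 * C.s * x + C.t ↔
      y₁ = y₂ := by
  have hu : (C.u : K) ≠ 0 := C.u.ne_zero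
  simp [hu]

variable [DecidableEq K]

theorem variableChange_slope {x₁ x₂ y₁ y₂ : K} (h₁ : (C • W).toAffine.Equation x₁ y₁)
    (h₂ : (C • W).toAffine.Equation x₂ y₂)
    (hxy : ¬(x₁ = x₂ ∧ y₁ = (C • W).toAffine.negY x₂ y₂)) :
    W.toAffine.slope (C.u ^ 2 * x₁ + C.r) (C.u ^ 2 * x₂ + C.r)
      (C.u ^ 3 * y₁ + C.u ^ 2 * C.s * x₁ + C.t) (C.u ^ 3 * y₂ + C.u ^ 2 * C.s * x₂ + C.t) =
      C.u * (C • W).toAffine.slope x₁ x₂ y₁ y₂ + C.s := by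
  have hu : (C.u : K) ≠ 0 := C.u.ne_zero
  by_cases hx : x₁ = x₂
  · subst hx
    have hy : y₁ ≠ (C • W).toAffine.negY x₁ y₂ := fun h => hxy ⟨rfl, h⟩
    obtain rfl : y₁ = y₂ := Y_eq_of_Y_ne h₁ h₂ rfl hy
    have hd : y₁ - (C • W).toAffine.negY x₁ y₁ ≠ 0 := sub_ne_zero.2 hy
    rw [slope_of_Y_ne rfl hy, slope_of_Y_ne rfl (by
      rw [variableChange_negY]; exact fun h => hy ((variableChange_Y_inj C).1 h))]
    rw [variableChange_negY]
    have : C.u ^ 3 * y₁ + C.u ^ 2 * C.s * x₁ + C.t - (C.u ^ 3 * (C • W).toAffine.negY x₁ y₁ +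
        C.u ^ 2 * C.s * x₁ + C.t) = C.u ^ 3 * (y₁ - (C • W).toAffine.negY x₁ y₁) := by ring
    rw [this, div_eq_iff (mul_ne_zero (pow_ne_zero 3 hu) hd)]
    field_simp
    simp only [negY, variableChange_a₁, variableChange_a₂, variableChange_a₃, variableChange_a₄,
      Units.val_inv_eq_inv_val]
    field_simp
    ring
  · have hd : x₁ - x₂ ≠ 0 := sub_ne_zero.2 hx
    rw [slope_of_X_ne hx, slope_of_X_ne fun h => hx ((variableChange_X_inj C).1 h)]
    have : (C.u : K) ^ 2 * x₁ + C.r - (C.u ^ 2 * x₂ + C.r) = C.u ^ 2 * (x₁ - x₂) := by ring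
    rw [this]
    field_simp
    ring

/-- The homomorphism `(x, y) ↦ (u²x + r, u³y + u²sx + t)` from the points of `C • W` to the points
of `W`. -/
def variableChangeHom : (C • W).toAffine.Point →+ W.toAffine.Point where
  toFun P := match P with
    | .zero => .zero
    | .some _ _ h => .some _ _ ((variableChange_nonsingular W C _ _).1 h)
  map_zero' := rfl
  map_add' := by
    rintro (_ | ⟨x₁, y₁, h₁⟩) (_ | ⟨x₂, y₂, h₂⟩)
    · rfl
    · rw [← Point.zero_def, zero_add]; exact (zero_add _).symm
    · rw [← Point.zero_def, add_zero]; exact (add_zero _).symm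
    · by_cases hxy : x₁ = x₂ ∧ y₁ = (C • W).toAffine.negY x₂ y₂
      · rw [Point.add_of_Y_eq hxy.1 hxy.2, Point.add_of_Y_eq]
        · rfl
        · rw [hxy.1]
        · rw [variableChange_negY, hxy.1, hxy.2]
      · rw [Point.add_some hxy, Point.add_some]
        · have hu : (C.u : K) ≠ 0 := C.u.ne_zero
          simp only [Point.some.injEq]
          rw [variableChange_slope W C h₁.1 h₂.1 hxy]
          simp only [addX, addY, negAddY, negY, variableChange_a₁, variableChange_a₂,
            variableChange_a₃, Units.val_inv_eq_inv_val]
          constructor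
          · field_simp
            ring
          · field_simp
            ring
        · rintro ⟨h, h'⟩
          have h := (variableChange_X_inj C).1 h
          subst h
          rw [variableChange_negY] at h'
          exact hxy ⟨rfl, (variableChange_Y_inj C).1 h'⟩

theorem variableChangeHom_some {x y : K} (h : (C • W).toAffine.Nonsingular x y) :
    variableChangeHom W C (.some x y h) =
      .some _ _ ((variableChange_nonsingular W C _ _).1 h) := rfl

theorem variableChangeHom_injective : Function.Injective (variableChangeHom W C) := by
  rw [injective_iff_map_eq_zero]
  rintro (_ | ⟨x, y, h⟩) hP
  · rfl
  · exact absurd hP (Point.some_ne_zero _)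

theorem variableChangeHom_surjective : Function.Surjective (variableChangeHom W C) := by
  have hu : (C.u : K) ≠ 0 := C.u.ne_zero
  rintro (_ | ⟨x, y, h⟩)
  · exact ⟨0, rfl⟩
  · have hx : C.u ^ 2 * ((x - C.r) / C.u ^ 2) + C.r = x := by field_simp; ring
    have hy : C.u ^ 3 * ((y - C.t - C.s * (x - C.r)) / C.u ^ 3) +
        C.u ^ 2 * C.s * ((x - C.r) / C.u ^ 2) + C.t = y := by
      field_simp
      ring
    refine ⟨.some ((x - C.r) / C.u ^ 2) ((y - C.t - C.s * (x - C.r)) / C.u ^ 3) ?_, ?_⟩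
    · rwa [variableChange_nonsingular, hx, hy]
    · rw [variableChangeHom_some]
      simp only [Point.some.injEq]
      exact ⟨hx, hy⟩

end WeierstrassCurve.Affine

end

noncomputable section

/-! ### Reduction of points modulo a valuation ring -/

namespace WeierstrassCurve.Affine

open WeierstrassCurve IsLocalRing

variable {K : Type*} [Field K] [DecidableEq K] {W : WeierstrassCurve K}

set_option linter.unusedSectionVars false

/-- The elementary symmetric functions of the `x`-coordinates of the three points of a line
`y = ℓ x + ν` on a Weierstrass curve. -/
theorem slope_vieta {x₁ x₂ y₁ y₂ : K} (h₁ : W.toAffine.Equation x₁ y₁)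
    (h₂ : W.toAffine.Equation x₂ y₂) (hxy : ¬(x₁ = x₂ ∧ y₁ = W.toAffine.negY x₂ y₂))
    {ℓ x₃ ν : K} (hℓ : ℓ = W.toAffine.slope x₁ x₂ y₁ y₂) (hx₃ : x₃ = W.toAffine.addX x₁ x₂ ℓ)
    (hν : ν = y₁ - ℓ * x₁) :
    x₁ + x₂ + x₃ = ℓ ^ 2 + W.a₁ * ℓ - W.a₂ ∧
    x₁ * x₂ + x₁ * x₃ + x₂ * x₃ = W.a₄ - 2 * ℓ * ν - W.a₁ * ν - W.a₃ * ℓ ∧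
    x₁ * x₂ * x₃ = ν ^ 2 + W.a₃ * ν - W.a₆ := by
  have key := addPolynomial_slope h₁ h₂ hxy
  rw [← hℓ, ← hx₃, addPolynomial_eq, neg_inj, Cubic.prod_X_sub_C_eq] at key
  have hb := Cubic.b_of_eq key
  have hc := Cubic.c_of_eq key
  have hd := Cubic.d_of_eq key
  dsimp only at hb hc hd
  refine ⟨?_, ?_, ?_⟩
  · linear_combination hb
  · rw [hν]; linear_combination -hc
  · rw [hν]; linear_combination hd

theorem Y_eq_slope_mul {x₁ x₂ y₁ y₂ : K} (h₁ : W.toAffine.Equation x₁ y₁)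
    (h₂ : W.toAffine.Equation x₂ y₂) (hxy : ¬(x₁ = x₂ ∧ y₁ = W.toAffine.negY x₂ y₂)) :
    y₂ = W.toAffine.slope x₁ x₂ y₁ y₂ * (x₂ - x₁) + y₁ := by
  by_cases hx : x₁ = x₂
  · subst hx
    have hy := Y_eq_of_Y_ne h₁ h₂ rfl fun h => hxy ⟨rfl, h⟩
    rw [hy]; ring
  · have : x₁ - x₂ ≠ 0 := sub_ne_zero.2 hx
    rw [slope_of_X_ne hx]
    field_simp
    ring

variable (O : ValuationSubring K)

/-- `CuspParam O P κ`: the point `P` has coordinates `x = z / w`, `y = 1 / w` with `z` and `w` in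
the valuation ring `O`, and `κ` is the residue class of `z`. -/
def CuspParam (P : W.toAffine.Point) (κ : ResidueField O) : Prop :=
  match P with
  | .zero => κ = 0
  | .some x y _ => ∃ z w : O, (w : K) * y = 1 ∧ x = z * y ∧ residue O z = κ

variable {O}

theorem cuspParam_zero {κ : ResidueField O} : CuspParam O (0 : W.toAffine.Point) κ ↔ κ = 0 := Iff.rfl

theorem cuspParam_some {x y : K} {h : W.toAffine.Nonsingular x y} {κ : ResidueField O} :
    CuspParam O (Point.some x y h) κ ↔
      ∃ z w : O, (w : K) * y = 1 ∧ x = z * y ∧ residue O z = κ := Iff.rfl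

theorem exists_inv_of_residue_eq_one {a : O} (h : residue O a = 1) :
    ∃ b : O, a * b = 1 ∧ residue O b = 1 := by
  have : IsUnit a := by
    rw [← residue_ne_zero_iff_isUnit, h]
    exact one_ne_zero
  obtain ⟨b, hb⟩ := isUnit_iff_exists_inv.1 this
  refine ⟨b, hb, ?_⟩
  have := congrArg (residue O) hb
  rwa [map_mul, h, one_mul, map_one] at this

variable {W₀ : WeierstrassCurve O}

/-! ### Points reducing to smooth points of the cuspidal cubic `y² = x³`. -/

section Cusp

variable (h1 : residue O W₀.a₁ = 0) (h2 : residue O W₀.a₂ = 0) (h3 : residue O W₀.a₃ = 0)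
  (h4 : residue O W₀.a₄ = 0) (h6 : residue O W₀.a₆ = 0)

include h1 h3 in
theorem CuspParam.neg {P : (W₀.map O.subtype).toAffine.Point} {κ : ResidueField O}
    (h : CuspParam O P κ) : CuspParam O (-P) (-κ) := by
  rcases P with _ | ⟨x, y, hP⟩
  · have h : κ = 0 := h
    rw [← Point.zero_def, h, Point.neg_zero, cuspParam_zero, neg_zero]
  · obtain ⟨z, w, hw, hz, hκ⟩ := h
    rw [Point.neg_some, cuspParam_some]
    obtain ⟨b, hb, hb'⟩ := exists_inv_of_residue_eq_one (a := 1 + W₀.a₁ * z + W₀.a₃ * w)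
      (by simp [h1, h3])
    have hbK : (1 + (W₀.a₁ : K) * z + W₀.a₃ * w) * b = 1 := congrArg Subtype.val hb
    refine ⟨-(z * b), -(w * b), ?_, ?_, ?_⟩
    · change (-(w * b : K)) * (-y - W₀.a₁ * x - W₀.a₃) = 1
      rw [hz]
      linear_combination hbK + (b + b * W₀.a₁ * z) * hw
    · change x = (-(z * b : K)) * (-y - W₀.a₁ * x - W₀.a₃)
      rw [hz]
      linear_combination (-z * y) * hbK + (z * b * W₀.a₃ : K) * hw
    · simp [hb', hκ]

include h1 h2 h3 h4 h6 in
/-- The line through two points (or tangent to a point) in the coordinates `z = x / y` and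
`w = 1 / y` is `w = c + m z` with integral `c` and `m`. -/
theorem exists_line {x₁ x₂ y₁ y₂ : K} (e₁ : (W₀.map O.subtype).toAffine.Equation x₁ y₁)
    (e₂ : (W₀.map O.subtype).toAffine.Equation x₂ y₂)
    (hxy : ¬(x₁ = x₂ ∧ y₁ = (W₀.map O.subtype).toAffine.negY x₂ y₂))
    {z₁ w₁ z₂ w₂ : O} (hw₁ : (w₁ : K) * y₁ = 1) (hz₁ : x₁ = z₁ * y₁)
    (hw₂ : (w₂ : K) * y₂ = 1) (hz₂ : x₂ = z₂ * y₂) {ℓ : K}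
    (hℓ : ℓ = (W₀.map O.subtype).toAffine.slope x₁ x₂ y₁ y₂) :
    ∃ m c : O, (c : K) * (y₁ - ℓ * x₁) = 1 ∧ (m : K) = -ℓ * c := by
  have hy₁ : y₁ ≠ 0 := right_ne_zero_of_mul_eq_one hw₁
  have hy₂ : y₂ ≠ 0 := right_ne_zero_of_mul_eq_one hw₂
  -- Subtracting the curve equations of the two points in the coordinates `z`, `w` gives `(w₁ - w₂)
  -- D = (z₁ - z₂) N`. All coefficients reduce to `0`, so `D` reduces to `1`, and the slope `N / D`
  -- is integral even when the points coincide.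
  let D : O := 1 + W₀.a₁ * z₁ + W₀.a₃ * (w₁ + w₂) - W₀.a₂ * z₁ ^ 2 - W₀.a₄ * z₁ * (w₁ + w₂) -
    W₀.a₆ * (w₁ ^ 2 + w₁ * w₂ + w₂ ^ 2)
  let N : O := z₁ ^ 2 + z₁ * z₂ + z₂ ^ 2 + W₀.a₂ * w₂ * (z₁ + z₂) + W₀.a₄ * w₂ ^ 2 - W₀.a₁ * w₂
  have hDK : (D : K) = 1 + W₀.a₁ * z₁ + W₀.a₃ * (w₁ + w₂) - W₀.a₂ * z₁ ^ 2 -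
    W₀.a₄ * z₁ * (w₁ + w₂) - W₀.a₆ * (w₁ ^ 2 + w₁ * w₂ + w₂ ^ 2) := rfl
  have hNK : (N : K) = z₁ ^ 2 + z₁ * z₂ + z₂ ^ 2 + W₀.a₂ * w₂ * (z₁ + z₂) + W₀.a₄ * w₂ ^ 2 -
    W₀.a₁ * w₂ := rfl
  obtain ⟨b, hb, -⟩ := exists_inv_of_residue_eq_one (a := D) (by simp [D, h1, h2, h3, h4, h6])
  have hbK : (D : K) * b = 1 := congrArg Subtype.val hb
  have hD : (D : K) ≠ 0 := left_ne_zero_of_mul_eq_one hbK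
  have hb : (b : K) = (D : K)⁻¹ := eq_inv_of_mul_eq_one_right hbK
  have hw₁' : (w₁ : K) = y₁⁻¹ := eq_inv_of_mul_eq_one_left hw₁
  have hw₂' : (w₂ : K) = y₂⁻¹ := eq_inv_of_mul_eq_one_left hw₂
  have f₁ : (w₁ : K) + W₀.a₁ * z₁ * w₁ + W₀.a₃ * w₁ ^ 2 =
      z₁ ^ 3 + W₀.a₂ * z₁ ^ 2 * w₁ + W₀.a₄ * z₁ * w₁ ^ 2 + W₀.a₆ * w₁ ^ 3 := by
    have e : y₁ ^ 2 + (W₀.a₁ : K) * x₁ * y₁ + W₀.a₃ * y₁ = x₁ ^ 3 + W₀.a₂ * x₁ ^ 2 + W₀.a₄ * x₁ +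
      W₀.a₆ := (equation_iff ..).1 e₁
    rw [hz₁] at e
    rw [hw₁']
    field_simp
    linear_combination e
  have f₂ : (w₂ : K) + W₀.a₁ * z₂ * w₂ + W₀.a₃ * w₂ ^ 2 =
      z₂ ^ 3 + W₀.a₂ * z₂ ^ 2 * w₂ + W₀.a₄ * z₂ * w₂ ^ 2 + W₀.a₆ * w₂ ^ 3 := by
    have e : y₂ ^ 2 + (W₀.a₁ : K) * x₂ * y₂ + W₀.a₃ * y₂ = x₂ ^ 3 + W₀.a₂ * x₂ ^ 2 + W₀.a₄ * x₂ +
      W₀.a₆ := (equation_iff ..).1 e₂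
    rw [hz₂] at e
    rw [hw₂']
    field_simp
    linear_combination e
  have hDN : ((w₁ : K) - w₂) * D = (z₁ - z₂) * N := by
    rw [hDK, hNK]
    linear_combination f₁ - f₂
  -- Dividing `y = ℓ x + ν` by `ν y` gives `w = 1/ν - (ℓ/ν) z`. So the claim is that `m = N / D` and
  -- `c = w₁ - m z₁` are `-ℓ/ν` and `1/ν`; here both are multiplied by `D`.
  suffices h : (w₁ * D - N * z₁ : K) * (y₁ - ℓ * x₁) = D ∧ (N : K) = -ℓ * (w₁ * D - N * z₁) by
    refine ⟨N * b, w₁ - N * b * z₁, ?_, ?_⟩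
    · change ((w₁ : K) - N * b * z₁) * (y₁ - ℓ * x₁) = 1
      rw [hb]
      field_simp
      linear_combination h.1
    · change (N : K) * b = -ℓ * ((w₁ : K) - N * b * z₁)
      rw [hb]
      field_simp
      linear_combination h.2
  by_cases hx : x₁ = x₂
  · have hy : y₁ ≠ (W₀.map O.subtype).toAffine.negY x₂ y₂ := fun h => hxy ⟨hx, h⟩
    have hyy : y₁ = y₂ := Y_eq_of_Y_ne e₁ e₂ hx hy
    have hww : (w₂ : K) = w₁ := by rw [hw₁', hw₂', hyy]
    have hzz : (z₂ : K) = z₁ := by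
      have : (z₁ : K) * y₁ = z₂ * y₁ := by rw [← hz₁, hx, hz₂, hyy]
      exact (mul_right_cancel₀ hy₁ this).symm
    rw [hww] at hDK
    rw [hww, hzz] at hNK
    subst hx
    have hd : y₁ - (W₀.map O.subtype).toAffine.negY x₁ y₁ ≠ 0 := by
      rw [sub_ne_zero]; rwa [← hyy] at hy
    have hℓ' : ℓ * (2 * y₁ + W₀.a₁ * x₁ + W₀.a₃) =
        3 * x₁ ^ 2 + 2 * W₀.a₂ * x₁ + W₀.a₄ - W₀.a₁ * y₁ := by
      rw [hℓ, slope_of_Y_ne rfl hy]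
      have : (2 * y₁ + W₀.a₁ * x₁ + W₀.a₃ : K) = y₁ - (W₀.map O.subtype).toAffine.negY x₁ y₁ := by
        change _ = y₁ - (-y₁ - (W₀.a₁ : K) * x₁ - W₀.a₃)
        ring
      rw [this, div_mul_cancel₀ _ hd]
      rfl
    have e : y₁ ^ 2 + (W₀.a₁ : K) * x₁ * y₁ + W₀.a₃ * y₁ = x₁ ^ 3 + W₀.a₂ * x₁ ^ 2 +
      W₀.a₄ * x₁ + W₀.a₆ := (equation_iff ..).1 e₁
    -- For a tangent line, `N y₁²` and `-(w₁ D - N z₁) y₁²` are the numerator and the denominator of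
    -- the slope `ℓ`.
    have hS : (w₁ * D - N * z₁ : K) * y₁ ^ 2 = -(2 * y₁ + W₀.a₁ * x₁ + W₀.a₃) := by
      rw [hDK, hNK, hw₁']
      rw [hz₁] at e ⊢
      field_simp
      linear_combination 3 * e
    have hN : (N : K) * y₁ ^ 2 = 3 * x₁ ^ 2 + 2 * W₀.a₂ * x₁ + W₀.a₄ - W₀.a₁ * y₁ := by
      rw [hNK, hz₁, hw₁']
      field_simp
      ring
    have hD' : (D : K) * y₁ ^ 2 = y₁ ^ 2 + W₀.a₁ * x₁ * y₁ + 2 * W₀.a₃ * y₁ - W₀.a₂ * x₁ ^ 2 -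
        2 * W₀.a₄ * x₁ - 3 * W₀.a₆ := by
      rw [hDK, hz₁, hw₁']
      field_simp
      ring
    constructor
    · refine mul_right_cancel₀ (pow_ne_zero 2 hy₁) ?_
      linear_combination (y₁ - ℓ * x₁) * hS + x₁ * hℓ' - hD' - 3 * e
    · refine mul_right_cancel₀ (pow_ne_zero 2 hy₁) ?_
      linear_combination hN + ℓ * hS - hℓ'
  · have hx' : z₁ * y₁ - z₂ * y₂ ≠ (0 : K) := by rwa [← hz₁, ← hz₂, sub_ne_zero]
    have hz : (z₁ : K) - z₂ ≠ 0 := by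
      intro h
      rw [h, zero_mul, mul_eq_zero, or_iff_left hD, sub_eq_zero, hw₁', hw₂', inv_inj] at hDN
      apply hx'
      rw [hDN, sub_eq_zero.1 h, sub_self]
    have hN : (N : K) = (w₁ - w₂) * D / (z₁ - z₂) := by
      rw [hDN]; field_simp
    have hd : ℓ * (z₁ * y₁ - z₂ * y₂) = y₁ - y₂ := by
      rw [hℓ, slope_of_X_ne hx, ← hz₁, ← hz₂, div_mul_cancel₀ _ (sub_ne_zero.2 hx)]
    have hA : (w₁ * D - N * z₁ : K) * (z₁ - z₂) = D * (w₂ * z₁ - w₁ * z₂) := by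
      linear_combination (z₁ : K) * hDN
    have hB : (y₁ - ℓ * x₁) * (z₁ * y₁ - z₂ * y₂) = y₁ * y₂ * (z₁ - z₂) := by
      rw [hz₁]
      linear_combination (-z₁ * y₁) * hd
    have hC : (w₂ * z₁ - w₁ * z₂ : K) * (y₁ * y₂) = z₁ * y₁ - z₂ * y₂ := by
      linear_combination (z₁ * y₁) * hw₂ - (z₂ * y₂) * hw₁
    constructor
    · refine mul_right_cancel₀ (mul_ne_zero hz hx') ?_
      linear_combination ((y₁ - ℓ * x₁) * (z₁ * y₁ - z₂ * y₂)) * hA +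
        (D * (w₂ * z₁ - w₁ * z₂) : K) * hB + (D * (z₁ - z₂) : K) * hC
    · refine mul_right_cancel₀ (mul_ne_zero hz hx') ?_
      linear_combination (-(z₁ * y₁ - z₂ * y₂)) * hDN + (ℓ * (z₁ * y₁ - z₂ * y₂)) * hA +
        (D * (w₂ * z₁ - w₁ * z₂) : K) * hd + (D : K) * ((z₁ - z₂ : K) * hw₁ + (z₂ - z₁ : K) * hw₂)

include h1 h2 h3 h4 h6 in
-- In the coordinates `z`, `w` the reduced curve is `w = z³`. Its smooth points form the additive
-- group with parameter `z`: three collinear points have `z`-coordinates with sum zero. The proof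
-- lifts this to `O` by computing `z₁ + z₂ + z₃` from Vieta's formulas for the line.
theorem CuspParam.add {P Q : (W₀.map O.subtype).toAffine.Point} {κ κ' : ResidueField O}
    (hP : CuspParam O P κ) (hQ : CuspParam O Q κ') : CuspParam O (P + Q) (κ + κ') := by
  rcases P with _ | ⟨x₁, y₁, n₁⟩
  · have hP : κ = 0 := hP
    rw [← Point.zero_def, zero_add, hP, zero_add]
    exact hQ
  rcases Q with _ | ⟨x₂, y₂, n₂⟩
  · have hQ : κ' = 0 := hQ
    rw [← Point.zero_def, add_zero, hQ, add_zero]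
    exact hP
  by_cases hxy : x₁ = x₂ ∧ y₁ = (W₀.map O.subtype).toAffine.negY x₂ y₂
  · rw [Point.add_of_Y_eq hxy.1 hxy.2, cuspParam_zero]
    have h := CuspParam.neg h1 h3 hQ
    rw [Point.neg_some] at h
    obtain ⟨z, w, hw, hz, hκ⟩ := hP
    obtain ⟨z', w', hw', hz', hκ'⟩ := h
    rw [← hxy.2] at hw' hz'
    have hy₁ : y₁ ≠ 0 := right_ne_zero_of_mul_eq_one hw
    have : z = z' := Subtype.ext (mul_right_cancel₀ hy₁ (by rw [← hz, ← hz', hxy.1]))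
    rw [← hκ, this, hκ', neg_add_cancel]
  obtain ⟨z₁, w₁, hw₁, hz₁, hκ₁⟩ := hP
  obtain ⟨z₂, w₂, hw₂, hz₂, hκ₂⟩ := hQ
  obtain ⟨ℓ, hℓ⟩ : ∃ ℓ, ℓ = (W₀.map O.subtype).toAffine.slope x₁ x₂ y₁ y₂ := ⟨_, rfl⟩
  obtain ⟨x₃, hx₃⟩ : ∃ x₃, x₃ = (W₀.map O.subtype).toAffine.addX x₁ x₂ ℓ := ⟨_, rfl⟩
  obtain ⟨ν, hν⟩ : ∃ ν, ν = y₁ - ℓ * x₁ := ⟨_, rfl⟩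
  obtain ⟨m, c, hc, hm⟩ := exists_line h1 h2 h3 h4 h6 n₁.1 n₂.1 hxy hw₁ hz₁ hw₂ hz₂ hℓ
  rw [← hν] at hc
  obtain ⟨s1, s2, s3⟩ := slope_vieta n₁.1 n₂.1 hxy hℓ hx₃ hν
  have s1 : x₁ + x₂ + x₃ = ℓ ^ 2 + W₀.a₁ * ℓ - W₀.a₂ := s1
  have s2 : x₁ * x₂ + x₁ * x₃ + x₂ * x₃ = W₀.a₄ - 2 * ℓ * ν - W₀.a₁ * ν - W₀.a₃ * ℓ := s2
  have s3 : x₁ * x₂ * x₃ = ν ^ 2 + W₀.a₃ * ν - W₀.a₆ := s3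
  have hy₂' := Y_eq_slope_mul n₁.1 n₂.1 hxy
  rw [← hℓ] at hy₂'
  have hneg := nonsingular_negAdd n₁ n₂ hxy
  rw [← hℓ, ← hx₃] at hneg
  have hcusp : CuspParam O (Point.some _ _ hneg) (-(κ + κ')) := by
    rw [cuspParam_some]
    obtain ⟨y₃, hy₃⟩ : ∃ y₃, y₃ = (W₀.map O.subtype).toAffine.negAddY x₁ x₂ y₁ ℓ := ⟨_, rfl⟩
    rw [← hy₃]
    have hy₃ : y₃ = ℓ * x₃ + ν := by
      rw [hy₃, hν, hx₃, negAddY]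
      ring
    -- At each intersection point `c y = 1 - m x`, so `z = x / y = c x / (1 - m x)`. The sum of the
    -- three values of `z` is thus a symmetric function of the `x`-coordinates, with denominator `∏
    -- (1 - m xᵢ)`, a unit reducing to `1`.
    have g₁ : (c : K) * y₁ = 1 - m * x₁ := by
      rw [hm]; linear_combination hc - (c : K) * hν
    have g₂ : (c : K) * y₂ = 1 - m * x₂ := by
      rw [hm, hy₂']; linear_combination hc - (c : K) * hν
    have g₃ : (c : K) * y₃ = 1 - m * x₃ := by
      rw [hm, hy₃]; linear_combination hc
    obtain ⟨u, hu, -⟩ := exists_inv_of_residue_eq_one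
      (a := 1 + W₀.a₂ * m + W₀.a₄ * m ^ 2 + W₀.a₆ * m ^ 3) (by simp [h2, h4, h6])
    have hc0 : (c : K) ≠ 0 := left_ne_zero_of_mul_eq_one hc
    have hν' : ν = (c : K)⁻¹ := eq_inv_of_mul_eq_one_right hc
    have hℓ' : ℓ = -m / c := by rw [hm]; field_simp
    have hU : (1 - m * x₁) * (1 - m * x₂) * (1 - m * x₃) =
        1 + (W₀.a₂ : K) * m + W₀.a₄ * m ^ 2 + W₀.a₆ * m ^ 3 := by
      have : (1 - m * x₁) * (1 - m * x₂) * (1 - m * x₃) = 1 - m * (x₁ + x₂ + x₃) +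
        m ^ 2 * (x₁ * x₂ + x₁ * x₃ + x₂ * x₃) - m ^ 3 * (x₁ * x₂ * x₃) := by ring
      rw [this, s1, s2, s3, hℓ', hν']
      field_simp
      ring
    have huK : (1 + (W₀.a₂ : K) * m + W₀.a₄ * m ^ 2 + W₀.a₆ * m ^ 3) * u = 1 :=
      congrArg Subtype.val hu
    rw [← hU, ← g₁, ← g₂, ← g₃] at huK
    -- The numerator of `z₁ + z₂ + z₃`. Each term contains a coefficient of the curve, so `V`
    -- reduces to `0`.
    let V : O := W₀.a₁ * m + W₀.a₃ * m ^ 2 - W₀.a₂ * c - 2 * W₀.a₄ * m * c - 3 * W₀.a₆ * m ^ 2 * c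
    have hV : (c : K) * (x₁ * (c * y₂) * (c * y₃) + x₂ * (c * y₁) * (c * y₃) +
        x₃ * (c * y₁) * (c * y₂)) = V := by
      rw [g₁, g₂, g₃]
      have : (c : K) * (x₁ * (1 - m * x₂) * (1 - m * x₃) + x₂ * (1 - m * x₁) * (1 - m * x₃) +
        x₃ * (1 - m * x₁) * (1 - m * x₂)) = c * ((x₁ + x₂ + x₃) -
          2 * m * (x₁ * x₂ + x₁ * x₃ + x₂ * x₃) + 3 * m ^ 2 * (x₁ * x₂ * x₃)) := by ring
      rw [this, s1, s2, s3, hℓ', hν']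
      change _ = (W₀.a₁ : K) * m + W₀.a₃ * m ^ 2 - W₀.a₂ * c - 2 * W₀.a₄ * m * c -
        3 * W₀.a₆ * m ^ 2 * c
      field_simp
      ring
    have hz₃ : x₃ = ((V * u - z₁ - z₂ : O) : K) * y₃ := by
      change x₃ = ((V : K) * u - z₁ - z₂) * y₃
      rw [← hV]
      rw [hz₁, hz₂]
      linear_combination (-(z₁ * y₃ + z₂ * y₃ + x₃)) * huK
    refine ⟨V * u - z₁ - z₂, c + m * (V * u - z₁ - z₂), ?_, hz₃, ?_⟩
    · change ((c : K) + m * ((V * u - z₁ - z₂ : O) : K)) * y₃ = 1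
      linear_combination g₃ - m * hz₃
    · simp [V, h1, h2, h3, h4, h6, hκ₁, hκ₂]
      ring
  have := CuspParam.neg h1 h3 hcusp
  rw [Point.neg_some, neg_neg] at this
  rw [Point.add_some hxy]
  convert this using 2
  · rw [hx₃, hℓ]
  · rw [addY, hx₃, hℓ]

include h1 h2 h3 h4 h6 in
theorem CuspParam.nsmul {P : (W₀.map O.subtype).toAffine.Point} {κ : ResidueField O}
    (hP : CuspParam O P κ) (n : ℕ) : CuspParam O (n • P) (n • κ) := by
  induction n with
  | zero => rw [zero_smul, zero_smul, cuspParam_zero]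
  | succ n ih => rw [succ_nsmul, succ_nsmul]; exact CuspParam.add h1 h2 h3 h4 h6 ih hP

end Cusp

theorem mem_of_sq_add_mul_eq {b c y : K} (hb : b ∈ O) (hc : c ∈ O) (h : y ^ 2 + b * y = c) :
    y ∈ O := by
  rcases O.mem_or_inv_mem y with hy | hy
  · exact hy
  · by_cases hy0 : y = 0
    · rw [hy0]; exact O.zero_mem
    · have : y = -b + c * y⁻¹ := by
        rw [← h]; field_simp; ring
      rw [this]
      exact O.add_mem _ _ (O.neg_mem _ hb) (O.mul_mem _ _ hc hy)

theorem residue_eq_zero_of_inv_notMem {a : O} (h : (a : K)⁻¹ ∉ O) : residue O a = 0 := by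
  by_contra h0
  obtain ⟨b, hb⟩ := isUnit_iff_exists_inv.1 (residue_ne_zero_iff_isUnit a |>.1 h0)
  have hb : (a : K) * b = 1 := congrArg Subtype.val hb
  exact h (by rw [← eq_inv_of_mul_eq_one_right hb]; exact b.2)

/-- Torsion points of order invertible in `O` on an integral model have integral `x`-coordinate. -/
theorem X_mem_of_nsmul_eq_zero {n : ℕ} (hn : (n : ResidueField O) ≠ 0) {x y : K}
    {h : (W₀.map O.subtype).toAffine.Nonsingular x y} (hP : n • Point.some x y h = 0) : x ∈ O := by
  -- If `x` is not integral, then `z = x / y` is in the maximal ideal. Rescaling by `u = z⁻¹`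
  -- multiplies `aᵢ` by `zⁱ`, so the new curve reduces to the cusp, and the point becomes `(X, X)`
  -- with `X = x z²` reducing to `1`. Its parameter is `1`, so its `n`-th multiple has parameter `n
  -- ≠ 0` and cannot be zero. The argument holds over any valuation ring and replaces the formal
  -- group.
  by_contra hx
  have hx0 : x ≠ 0 := by rintro rfl; exact hx O.zero_mem
  have hq : x⁻¹ ∈ O := (O.mem_or_inv_mem x).resolve_left hx
  let q : O := ⟨x⁻¹, hq⟩
  have hqr : residue O q = 0 := residue_eq_zero_of_inv_notMem (by simpa [q] using hx)
  have e : y ^ 2 + (W₀.a₁ : K) * x * y + W₀.a₃ * y = x ^ 3 + W₀.a₂ * x ^ 2 + W₀.a₄ * x + W₀.a₆ :=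
    (equation_iff ..).1 h.1
  have e' : (y / x) ^ 2 + W₀.a₁ * (y / x) + W₀.a₃ * q * (y / x) = x + W₀.a₂ + W₀.a₄ * q +
      W₀.a₆ * q ^ 2 := by
    change (y / x) ^ 2 + W₀.a₁ * (y / x) + W₀.a₃ * x⁻¹ * (y / x) = x + W₀.a₂ + W₀.a₄ * x⁻¹ +
      W₀.a₆ * x⁻¹ ^ 2
    field_simp
    linear_combination e
  have ht : y / x ∉ O := by
    intro ht
    lift y / x to O using ht with t
    refine hx ?_
    have : x = ((t ^ 2 + W₀.a₁ * t + W₀.a₃ * q * t - W₀.a₂ - W₀.a₄ * q - W₀.a₆ * q ^ 2 : O) : K) := by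
      push_cast
      linear_combination -e'
    rw [this]
    exact Subtype.mem _
  have hy0 : y ≠ 0 := by rintro rfl; exact ht (by rw [zero_div]; exact O.zero_mem)
  have hz : x / y ∈ O := by
    have := (O.mem_or_inv_mem (y / x)).resolve_left ht
    rwa [inv_div] at this
  obtain ⟨z, hzx⟩ : ∃ z : O, (z : K) = x / y := ⟨⟨_, hz⟩, rfl⟩
  have hzr : residue O z = 0 := residue_eq_zero_of_inv_notMem (by rwa [hzx, inv_div])
  have hz0 : (z : K) ≠ 0 := by rw [hzx]; exact div_ne_zero hx0 hy0
  let X : O := 1 + W₀.a₁ * z + W₀.a₃ * q * z - W₀.a₂ * z ^ 2 - W₀.a₄ * q * z ^ 2 -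
    W₀.a₆ * q ^ 2 * z ^ 2
  have hX : (X : K) = x * z ^ 2 := by
    change 1 + (W₀.a₁ : K) * z + W₀.a₃ * q * z - W₀.a₂ * z ^ 2 - W₀.a₄ * q * z ^ 2 -
      W₀.a₆ * q ^ 2 * z ^ 2 = _
    have : y / x = (z : K)⁻¹ := by rw [hzx, inv_div]
    rw [this] at e'
    field_simp at e'
    linear_combination e'
  obtain ⟨b, hb, -⟩ := exists_inv_of_residue_eq_one (a := X) (by simp [X, hzr])
  have hbK : (X : K) * b = 1 := congrArg Subtype.val hb
  let C : VariableChange K := ⟨(Units.mk0 (z : K) hz0)⁻¹, 0, 0, 0⟩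
  have hCu : (C.u : K) = (z : K)⁻¹ := rfl
  let W₁ : WeierstrassCurve O := ⟨z * W₀.a₁, z ^ 2 * W₀.a₂, z ^ 3 * W₀.a₃, z ^ 4 * W₀.a₄,
    z ^ 6 * W₀.a₆⟩
  have hW₁ : C • W₀.map O.subtype = W₁.map O.subtype := by
    ext <;> simp [C, W₁, variableChange_def]
  have key : ∀ W' : WeierstrassCurve K, W' = W₁.map O.subtype → ∀ P' : W'.toAffine.Point,
      CuspParam O P' 1 → n • P' = 0 → False := by
    rintro _ rfl P' h1 h2
    have := CuspParam.nsmul (by simp [W₁, hzr]) (by simp [W₁, hzr]) (by simp [W₁, hzr])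
      (by simp [W₁, hzr]) (by simp [W₁, hzr]) h1 n
    rw [h2, cuspParam_zero, nsmul_one] at this
    exact hn this
  have hxX : (C.u : K) ^ 2 * X + C.r = x := by
    rw [hX, hCu]
    change _ + 0 = _
    field_simp
    ring
  have hyX : (C.u : K) ^ 3 * X + C.u ^ 2 * C.s * X + C.t = y := by
    rw [hX, hCu]
    change _ + _ * 0 * _ + 0 = _
    rw [hzx]
    field_simp
    ring
  have hns : (C • W₀.map O.subtype).toAffine.Nonsingular (X : K) X := by
    rw [variableChange_nonsingular, hxX, hyX]
    exact h
  refine key _ hW₁ (Point.some _ _ hns) ?_ ?_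
  · rw [cuspParam_some]
    exact ⟨1, b, by rw [mul_comm]; exact hbK, by simp, map_one _⟩
  · apply variableChangeHom_injective
    rw [map_nsmul, variableChangeHom_some, map_zero, ← hP]
    congr 2

theorem Y_mem_of_X_mem {x y : K} (h : (W₀.map O.subtype).toAffine.Equation x y) (hx : x ∈ O) :
    y ∈ O := by
  have e : y ^ 2 + (W₀.a₁ : K) * x * y + W₀.a₃ * y = x ^ 3 + W₀.a₂ * x ^ 2 + W₀.a₄ * x + W₀.a₆ :=
    (equation_iff ..).1 h
  lift x to O using hx
  refine mem_of_sq_add_mul_eq (b := ((W₀.a₁ * x + W₀.a₃ : O) : K))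
    (c := ((x ^ 3 + W₀.a₂ * x ^ 2 + W₀.a₄ * x + W₀.a₆ : O) : K)) (Subtype.mem _) (Subtype.mem _) ?_
  push_cast
  linear_combination e

/-- Torsion points of order invertible in `O` on a model with good reduction are determined by
their reduction. -/
theorem some_eq_some_of_residue_eq {n : ℕ} (hn : (n : ResidueField O) ≠ 0)
    (hΔ : residue O W₀.Δ ≠ 0) {x₁ y₁ x₂ y₂ : O}
    {h₁ : (W₀.map O.subtype).toAffine.Nonsingular (x₁ : K) y₁}
    {h₂ : (W₀.map O.subtype).toAffine.Nonsingular (x₂ : K) y₂}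
    (hP₁ : n • Point.some _ _ h₁ = 0) (hP₂ : n • Point.some _ _ h₂ = 0)
    (hx : residue O x₁ = residue O x₂) (hy : residue O y₁ = residue O y₂) :
    Point.some _ _ h₁ = Point.some _ _ h₂ := by
  by_contra hne
  have hne' : ¬((x₁ : K) = x₂ ∧ (y₁ : K) = y₂) := by simpa using hne
  -- The difference of the two points is `n`-torsion and nonzero, so its `x`-coordinate is integral.
  -- This makes the slope `ℓ` of the line through `P₁` and `-P₂` integral. The two relations
  -- satisfied by `ℓ` then reduce to the vanishing of both partial derivatives at the common
  -- reduction, against `Δ ≠ 0` there.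
  let y₂' : O := -y₂ - W₀.a₁ * x₂ - W₀.a₃
  have hy₂' : (W₀.map O.subtype).toAffine.negY x₂ y₂ = y₂' := rfl
  have hxy : ¬((x₁ : K) = x₂ ∧ (y₁ : K) = (W₀.map O.subtype).toAffine.negY x₂ y₂') := by
    rwa [← hy₂', negY_negY]
  have hn₂ : (W₀.map O.subtype).toAffine.Nonsingular (x₂ : K) y₂' := by
    rw [← hy₂', nonsingular_neg]; exact h₂
  have hsum : n • (Point.some _ _ h₁ + Point.some _ _ hn₂) = 0 := by
    have : Point.some _ _ hn₂ = -Point.some _ _ h₂ := rfl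
    rw [this, smul_add, smul_neg, hP₁, hP₂, neg_zero, add_zero]
  rw [Point.add_some hxy] at hsum
  have hmem := X_mem_of_nsmul_eq_zero hn hsum
  obtain ⟨ℓ, hℓ⟩ : ∃ ℓ, ℓ = (W₀.map O.subtype).toAffine.slope x₁ x₂ y₁ y₂' := ⟨_, rfl⟩
  rw [← hℓ] at hmem
  have hℓO : ℓ ∈ O := by
    obtain ⟨x₃, hx₃⟩ : ∃ x₃ : O, (x₃ : K) = ℓ ^ 2 + W₀.a₁ * ℓ - W₀.a₂ - x₁ - x₂ := ⟨⟨_, hmem⟩, rfl⟩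
    refine mem_of_sq_add_mul_eq (b := (W₀.a₁ : K)) (c := ((x₃ + W₀.a₂ + x₁ + x₂ : O) : K))
      (Subtype.mem _) (Subtype.mem _) ?_
    push_cast
    linear_combination -hx₃
  lift ℓ to O using hℓO
  have e₁ : (y₁ : K) ^ 2 + W₀.a₁ * x₁ * y₁ + W₀.a₃ * y₁ = x₁ ^ 3 + W₀.a₂ * x₁ ^ 2 + W₀.a₄ * x₁ +
    W₀.a₆ := (equation_iff ..).1 h₁.1
  have e₂ : (y₂' : K) ^ 2 + W₀.a₁ * x₂ * y₂' + W₀.a₃ * y₂' = x₂ ^ 3 + W₀.a₂ * x₂ ^ 2 + W₀.a₄ * x₂ +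
    W₀.a₆ := (equation_iff ..).1 hn₂.1
  have hchord : ℓ * (x₁ - x₂) = y₁ - y₂' := by
    have := Y_eq_slope_mul h₁.1 hn₂.1 hxy
    rw [← hℓ] at this
    refine Subtype.ext ?_
    push_cast
    linear_combination this
  -- The difference of the two curve equations with the factor `x₁ - x₂` removed; in this form it
  -- also covers the tangent case.
  have htan : ℓ * (y₁ - y₂ + W₀.a₁ * (x₁ - x₂)) = x₁ ^ 2 + x₁ * x₂ + x₂ ^ 2 + W₀.a₂ * (x₁ + x₂) +
      W₀.a₄ - W₀.a₁ * y₂' := by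
    refine Subtype.ext ?_
    have hy₂K : (y₂' : K) = -y₂ - W₀.a₁ * x₂ - W₀.a₃ := rfl
    have hchordK : (ℓ : K) * (x₁ - x₂) = y₁ - y₂' := congrArg Subtype.val hchord
    by_cases hxx : (x₁ : K) = x₂
    · have hyy : (y₁ : K) ≠ (W₀.map O.subtype).toAffine.negY x₂ y₂' := fun h => hxy ⟨hxx, h⟩
      have hy12 : (y₁ : K) = y₂' := Y_eq_of_Y_ne h₁.1 hn₂.1 hxx hyy
      rw [hxx, slope_of_Y_ne rfl hyy] at hℓ
      have hd : (y₁ : K) - (W₀.map O.subtype).toAffine.negY x₂ y₁ = y₁ - y₂ := by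
        rw [hy12, ← hy₂', negY_negY]
      have hd0 : (y₁ : K) - y₂ ≠ 0 := sub_ne_zero.2 fun h => hne' ⟨hxx, h⟩
      rw [hd, eq_div_iff hd0] at hℓ
      have hℓ : (ℓ : K) * (y₁ - y₂) = 3 * x₂ ^ 2 + 2 * W₀.a₂ * x₂ + W₀.a₄ - W₀.a₁ * y₁ := hℓ
      push_cast
      rw [hxx, ← hy12]
      linear_combination hℓ
    · refine mul_right_cancel₀ (sub_ne_zero.2 hxx) ?_
      push_cast
      linear_combination (y₁ - y₂ + W₀.a₁ * (x₁ - x₂) : K) * hchordK + e₁ - e₂ -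
        (y₁ - y₂' : K) * hy₂K
  have r1 := congrArg (residue O) hchord
  have r2 := congrArg (residue O) htan
  have e0 : y₂ ^ 2 + W₀.a₁ * x₂ * y₂ + W₀.a₃ * y₂ = x₂ ^ 3 + W₀.a₂ * x₂ ^ 2 + W₀.a₄ * x₂ +
    W₀.a₆ := Subtype.ext ((equation_iff ..).1 h₂.1)
  have r0 := congrArg (residue O) e0
  simp only [map_mul, map_sub, map_add, map_pow, map_neg, hx, hy, y₂'] at r0 r1 r2
  have heq : (W₀.map (residue O)).toAffine.Equation (residue O x₂) (residue O y₂) := by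
    rw [equation_iff]; exact r0
  rw [equation_iff_nonsingular_of_Δ_ne_zero (by rwa [map_Δ]), nonsingular_iff'] at heq
  have s1 : 2 * residue O y₂ + residue O W₀.a₁ * residue O x₂ + residue O W₀.a₃ = 0 := by
    linear_combination -r1
  rcases heq.2 with h | h
  · apply h
    change residue O W₀.a₁ * residue O y₂ - (3 * residue O x₂ ^ 2 + 2 * residue O W₀.a₂ *
      residue O x₂ + residue O W₀.a₄) = 0
    linear_combination r2 + residue O W₀.a₁ * s1
  · exact h s1

end WeierstrassCurve.Affine

end

noncomputable section

/-! ### Divisibility of the group of points over an algebraically closed field -/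

namespace WeierstrassCurve.Affine

open WeierstrassCurve Filter

variable {K : Type*} [Field K] {W : WeierstrassCurve K}

set_option linter.unusedSectionVars false

theorem exists_point [IsAlgClosed K] [W.IsElliptic] (x : K) :
    ∃ y, W.toAffine.Nonsingular x y := by
  obtain ⟨y, hy⟩ := IsAlgClosed.exists_root (Polynomial.X ^ 2 +
    Polynomial.C (W.a₁ * x + W.a₃) * Polynomial.X -
      Polynomial.C (x ^ 3 + W.a₂ * x ^ 2 + W.a₄ * x + W.a₆)) (by
    have : (Polynomial.X ^ 2 + Polynomial.C (W.a₁ * x + W.a₃) * Polynomial.X -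
      Polynomial.C (x ^ 3 + W.a₂ * x ^ 2 + W.a₄ * x + W.a₆)).natDegree = 2 := by compute_degree!
    exact Polynomial.degree_ne_of_natDegree_ne (by rw [this]; norm_num))
  refine ⟨y, equation_iff_nonsingular.1 ?_⟩
  rw [equation_iff]
  simp only [Polynomial.IsRoot.def, Polynomial.eval_add, Polynomial.eval_sub, Polynomial.eval_mul,
    Polynomial.eval_pow, Polynomial.eval_X, Polynomial.eval_C] at hy
  linear_combination hy

variable [DecidableEq K]

theorem eq_or_eq_neg_of_X_eq {x y y' : K} {h : W.toAffine.Nonsingular x y}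
    {h' : W.toAffine.Nonsingular x y'} :
    Point.some x y h = Point.some x y' h' ∨ Point.some x y h = -Point.some x y' h' :=
  Point.X_eq_iff.1 rfl

theorem finite_setOf_X_mem {T : Set K} (hT : T.Finite) :
    {P : W.toAffine.Point | ∃ x ∈ T, ∃ y h, P = Point.some x y h}.Finite := by
  have : {P : W.toAffine.Point | ∃ x ∈ T, ∃ y h, P = Point.some x y h} =
      ⋃ x ∈ T, {P : W.toAffine.Point | ∃ y h, P = Point.some x y h} := by
    ext P; simp
  rw [this]
  refine hT.biUnion fun x _ => ?_
  by_cases hx : ∃ y, W.toAffine.Nonsingular x y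
  · obtain ⟨y, h⟩ := hx
    refine (Set.toFinite {Point.some x y h, -Point.some x y h}).subset ?_
    rintro _ ⟨y', h', rfl⟩
    exact eq_or_eq_neg_of_X_eq
  · convert Set.finite_empty
    ext P
    simp only [Set.mem_ofPred_eq, Set.mem_empty_iff_false, iff_false]
    rintro ⟨y, h, -⟩
    exact hx ⟨y, h⟩

instance [IsAlgClosed K] [W.IsElliptic] : Infinite W.toAffine.Point := by
  have : Infinite K := IsAlgClosed.instInfinite
  choose y hy using exists_point (W := W)
  exact Infinite.of_injective (fun x => Point.some x (y x) (hy x)) fun x x' h => by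
    simpa using (Point.some.inj h).1

/-- A subgroup that contains all points above almost every `x` is everything. -/
theorem eq_top_of_eventually [IsAlgClosed K] [W.IsElliptic] (H : AddSubgroup W.toAffine.Point)
    (hH : ∀ᶠ x in cofinite, ∀ y h, Point.some x y h ∈ H) : H = ⊤ := by
  have hfin : ((H : Set W.toAffine.Point)ᶜ).Finite := by
    refine ((finite_setOf_X_mem (W := W) (eventually_cofinite.1 hH)).union
      (Set.finite_singleton 0)).subset ?_
    rintro (_ | ⟨x, y, h⟩) hP
    · exact Or.inr rfl
    · refine Or.inl ⟨x, ?_, y, h, rfl⟩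
      exact fun hx => hP (hx y h)
  by_contra hne
  obtain ⟨P, hP⟩ : ∃ P, P ∉ H := by
    by_contra! hall
    exact hne (eq_top_iff.2 fun P _ => hall P)
  -- The coset of a point outside `H` lies in the finite complement of `H`, so `H` would be finite,
  -- and with it the whole group.
  have hH' : (H : Set W.toAffine.Point).Finite := by
    refine Set.Finite.of_finite_image (f := fun Q => P + Q) (hfin.subset ?_)
      (add_right_injective P).injOn
    rintro _ ⟨Q, hQ, rfl⟩ hPQ
    exact hP ((AddSubgroup.add_mem_cancel_right H hQ).1 hPQ)
  refine Set.infinite_univ (α := W.toAffine.Point) ?_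
  rw [← Set.union_compl_self (H : Set W.toAffine.Point)]
  exact hH'.union hfin

/-- The duplication formula. The denominator is `(2y + a₁x + a₃)²`, so it is nonzero exactly when
the point is not `2`-torsion. -/
theorem two_nsmul_X {x y : K} {h : W.toAffine.Nonsingular x y}
    (hψ : 4 * x ^ 3 + W.b₂ * x ^ 2 + 2 * W.b₄ * x + W.b₆ ≠ 0) :
    ∃ x' y' h', 2 • Point.some x y h = Point.some x' y' h' ∧
      x' * (4 * x ^ 3 + W.b₂ * x ^ 2 + 2 * W.b₄ * x + W.b₆) =
        x ^ 4 - W.b₄ * x ^ 2 - 2 * W.b₆ * x - W.b₈ := by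
  have e := (equation_iff ..).1 h.1
  have hsq : (y - W.toAffine.negY x y) ^ 2 =
      4 * x ^ 3 + W.b₂ * x ^ 2 + 2 * W.b₄ * x + W.b₆ := by
    rw [negY, b₂, b₄, b₆]
    linear_combination 4 * e
  have hd : y - W.toAffine.negY x y ≠ 0 := by
    intro h0
    rw [h0] at hsq
    exact hψ (by rw [← hsq]; ring)
  have hy : y ≠ W.toAffine.negY x y := sub_ne_zero.1 hd
  refine ⟨_, _, _, (two_nsmul _).trans (Point.add_self_of_Y_ne hy), ?_⟩
  rw [← hsq, slope_of_Y_ne rfl hy, addX]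
  field_simp
  rw [negY, b₄, b₆, b₈]
  linear_combination (-(4 : K) * x * 2 - W.a₁ ^ 2 - 4 * W.a₂) * e

/-- The sum does not change when either point is negated, so it is a function of the two
`x`-coordinates alone. It provides a three-term recursion for the `x`-coordinates of multiples. -/
theorem add_X_add_sub_X {x₁ y₁ x₂ y₂ : K} (h₁ : W.toAffine.Nonsingular x₁ y₁)
    (h₂ : W.toAffine.Nonsingular x₂ y₂) (hx : x₁ ≠ x₂) :
    ∃ x y h x' y' h', Point.some x₁ y₁ h₁ + Point.some x₂ y₂ h₂ = Point.some x y h ∧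
      Point.some x₁ y₁ h₁ - Point.some x₂ y₂ h₂ = Point.some x' y' h' ∧
      (x + x') * (x₁ - x₂) ^ 2 =
        2 * x₁ * x₂ * (x₁ + x₂) + W.b₂ * x₁ * x₂ + W.b₄ * (x₁ + x₂) + W.b₆ := by
  have e₁ := (equation_iff ..).1 h₁.1
  have e₂ := (equation_iff ..).1 h₂.1
  have hsub := Point.add_of_X_ne (h₁ := h₁) (h₂ := (nonsingular_neg ..).2 h₂) hx
  refine ⟨_, _, _, _, _, _, Point.add_of_X_ne hx, (sub_eq_add_neg _ _).trans hsub, ?_⟩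
  have hd : x₁ - x₂ ≠ 0 := sub_ne_zero.2 hx
  rw [slope_of_X_ne hx, slope_of_X_ne hx, addX, addX]
  field_simp
  rw [negY, b₂, b₄, b₆]
  linear_combination 2 * e₁ + 2 * e₂

/-! ### Multiplication by `n` as a rational function of `x`, in characteristic zero. -/

variable [IsAlgClosed K] [CharZero K] [W.IsElliptic]

theorem exists_two_nsmul_eq (P : W.toAffine.Point) : ∃ Q, 2 • Q = P := by
  rcases P with _ | ⟨c, d, h⟩
  · exact ⟨0, smul_zero _⟩
  obtain ⟨x, hx⟩ := IsAlgClosed.exists_root (Polynomial.X ^ 4 -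
    Polynomial.C (4 * c) * Polynomial.X ^ 3 - Polynomial.C (W.b₄ + c * W.b₂) * Polynomial.X ^ 2 -
    Polynomial.C (2 * W.b₆ + 2 * c * W.b₄) * Polynomial.X - Polynomial.C (W.b₈ + c * W.b₆)) (by
    refine Polynomial.degree_ne_of_natDegree_ne (ne_of_eq_of_ne (b := 4) ?_ (by norm_num))
    compute_degree!)
  simp only [Polynomial.IsRoot.def, Polynomial.eval_sub, Polynomial.eval_mul,
    Polynomial.eval_pow, Polynomial.eval_X, Polynomial.eval_C] at hx
  have hx' : x ^ 4 - W.b₄ * x ^ 2 - 2 * W.b₆ * x - W.b₈ =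
      c * (4 * x ^ 3 + W.b₂ * x ^ 2 + 2 * W.b₄ * x + W.b₆) := by linear_combination hx
  have hψ : 4 * x ^ 3 + W.b₂ * x ^ 2 + 2 * W.b₄ * x + W.b₆ ≠ 0 := by
    intro h0
    rw [h0, mul_zero] at hx'
    -- The denominator and numerator of the duplication formula have no common zero: they are two
    -- coordinates of `addSubMap` for the pair `(x, x)`, and the third coordinate vanishes there.
    refine addSubMap_ne_zero W (x := ![x ^ 2, 2 * x, 1]) (fun h => ?_) ?_
    · simpa using congrFun h 2
    · ext i
      fin_cases i
      · simp [addSubMap]; linear_combination hx'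
      · simp [addSubMap]; linear_combination h0
      · simp [addSubMap]; ring
  obtain ⟨y, hy⟩ := exists_point (W := W) x
  obtain ⟨x', y', h', h2, hx2⟩ := two_nsmul_X (h := hy) hψ
  obtain rfl : x' = c := mul_right_cancel₀ hψ (hx2.trans hx')
  rcases eq_or_eq_neg_of_X_eq (h := h) (h' := h') with he | he
  · exact ⟨_, h2.trans he.symm⟩
  · exact ⟨-Point.some x y hy, by rw [smul_neg, h2, he]⟩

theorem exists_two_pow_nsmul_eq (k : ℕ) (P : W.toAffine.Point) : ∃ Q, 2 ^ k • Q = P := by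
  induction k generalizing P with
  | zero => exact ⟨P, by simp⟩
  | succ k ih =>
    obtain ⟨Q, rfl⟩ := ih P
    obtain ⟨R, rfl⟩ := exists_two_nsmul_eq Q
    exact ⟨R, by rw [pow_succ, mul_smul]⟩

variable (W) in
theorem exists_two_torsion : ∃ P : W.toAffine.Point, P ≠ 0 ∧ 2 • P = 0 := by
  obtain ⟨x, hx⟩ := IsAlgClosed.exists_root (Polynomial.C 4 * Polynomial.X ^ 3 +
    Polynomial.C W.b₂ * Polynomial.X ^ 2 + Polynomial.C (2 * W.b₄) * Polynomial.X +
    Polynomial.C W.b₆) (by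
    refine Polynomial.degree_ne_of_natDegree_ne (ne_of_eq_of_ne (b := 3) ?_ (by norm_num))
    compute_degree!)
  simp only [Polynomial.IsRoot.def, Polynomial.eval_add, Polynomial.eval_mul,
    Polynomial.eval_pow, Polynomial.eval_X, Polynomial.eval_C] at hx
  obtain ⟨y, h⟩ := exists_point (W := W) x
  refine ⟨Point.some x y h, Point.some_ne_zero _, ?_⟩
  rw [two_nsmul]
  refine Point.add_self_of_Y_eq ?_
  have e := (equation_iff ..).1 h.1
  rw [← sub_eq_zero, ← sq_eq_zero_iff, ← hx, negY, b₂, b₄, b₆]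
  linear_combination 4 * e

variable (W) in
-- Write `N = 2 ^ k m` with `m` odd and divide a nonzero `2`-torsion point by `2 ^ k`; then `N`
-- sends the quotient back to that `2`-torsion point.
theorem exists_nsmul_ne_zero {N : ℕ} (hN : N ≠ 0) : ∃ P : W.toAffine.Point, N • P ≠ 0 := by
  obtain ⟨k, m, hm, rfl⟩ := Nat.exists_eq_two_pow_mul_odd hN
  obtain ⟨P, hP, hP2⟩ := exists_two_torsion W
  obtain ⟨Q, hQ⟩ := exists_two_pow_nsmul_eq k P
  refine ⟨Q, ?_⟩
  obtain ⟨j, rfl⟩ := hm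
  rw [mul_comm, mul_smul, hQ, add_smul, mul_comm, mul_smul, hP2, smul_zero, zero_add, one_smul]
  exact hP

theorem eventually_eval_ne_zero {B : Polynomial K} (hB : B ≠ 0) :
    ∀ᶠ x in cofinite, B.eval x ≠ 0 := by
  rw [eventually_cofinite]
  refine (Polynomial.finite_setOfPred_isRoot hB).subset fun x hx => ?_
  simpa using hx

variable (W) in
/-- Multiplication by `n` is given on `x`-coordinates by the rational function `A / B`, for all but
finitely many `x`. -/
def IsGenericMul (n : ℕ) (A B : Polynomial K) : Prop :=
  ∀ᶠ x in cofinite, ∀ y h, ∃ x' y' h', n • Point.some (W' := W.toAffine) x y h =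
    Point.some x' y' h' ∧ x' * B.eval x = A.eval x

variable (W) in
theorem not_eventually_nsmul_eq_zero {N : ℕ} (hN : N ≠ 0) :
    ¬ ∀ᶠ x in cofinite, ∀ y h, N • Point.some (W' := W.toAffine) x y h = 0 := by
  intro hev
  obtain ⟨P, hP⟩ := exists_nsmul_ne_zero W hN
  have := eq_top_of_eventually (nsmulAddMonoidHom N : W.toAffine.Point →+ W.toAffine.Point).ker hev
  have hP' : P ∈ (nsmulAddMonoidHom N : W.toAffine.Point →+ W.toAffine.Point).ker := by
    rw [this]; trivial
  exact hP hP'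

/-- Otherwise `n P = ± P` for almost all `x`, and `(n - 1)(n + 1)` kills almost all points. This
keeps the denominators of the recursion in `exists_isGenericMul` nonzero. -/
theorem IsGenericMul.sub_X_mul_ne_zero {n : ℕ} (hn : 2 ≤ n) {A B : Polynomial K} (hB : B ≠ 0)
    (h : IsGenericMul W n A B) : A - Polynomial.X * B ≠ 0 := by
  intro h0
  refine not_eventually_nsmul_eq_zero W (N := (n - 1) * (n + 1)) (by
    refine mul_ne_zero (by omega) (by omega)) ?_
  filter_upwards [h, eventually_eval_ne_zero hB] with x hx hBx y hy
  obtain ⟨x', y', h', hmul, hx'⟩ := hx y hy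
  have h1 := congrArg (Polynomial.eval x) h0
  simp only [Polynomial.eval_sub, Polynomial.eval_mul, Polynomial.eval_X,
    Polynomial.eval_zero] at h1
  obtain rfl : x' = x := mul_right_cancel₀ hBx (by linear_combination hx' + h1)
  obtain ⟨k, rfl⟩ : ∃ k, n = k + 1 := ⟨n - 1, by omega⟩
  rcases eq_or_eq_neg_of_X_eq (h := h') (h' := hy) with he | he
  · rw [he, succ_nsmul, add_eq_right] at hmul
    rw [mul_comm, mul_smul, Nat.add_sub_cancel, hmul, smul_zero]
  · rw [he] at hmul
    have : (k + 1 + 1) • Point.some (W' := W.toAffine) x' y hy = 0 := by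
      rw [succ_nsmul, hmul, neg_add_cancel]
    rw [mul_smul, this, smul_zero]

variable (W) in
-- The multiples `m - 1` and `m` give `m + 1` through `x(mP + P) + x(mP - P)`. Neither coprimality
-- nor the degrees of `A` and `B` are controlled; only `B ≠ 0` is carried along.
theorem exists_isGenericMul (n : ℕ) :
    ∃ A B : Polynomial K, B ≠ 0 ∧ IsGenericMul W (n + 1) A B := by
  induction n using Nat.twoStepInduction with
  | zero =>
    refine ⟨Polynomial.X, 1, one_ne_zero, Eventually.of_forall fun x y h => ⟨x, y, h, ?_, ?_⟩⟩
    · simp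
    · simp
  | one =>
    let B : Polynomial K := Polynomial.C 4 * Polynomial.X ^ 3 +
      Polynomial.C W.b₂ * Polynomial.X ^ 2 + Polynomial.C (2 * W.b₄) * Polynomial.X +
      Polynomial.C W.b₆
    have hB : B ≠ 0 := by
      have : B.natDegree = 3 := by simp only [B]; compute_degree!
      rintro h
      rw [h] at this
      simp at this
    refine ⟨Polynomial.X ^ 4 - Polynomial.C W.b₄ * Polynomial.X ^ 2 -
      Polynomial.C (2 * W.b₆) * Polynomial.X - Polynomial.C W.b₈, B, hB, ?_⟩
    filter_upwards [eventually_eval_ne_zero hB] with x hx y h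
    simp only [B, Polynomial.eval_add, Polynomial.eval_mul,
      Polynomial.eval_pow, Polynomial.eval_X, Polynomial.eval_C] at hx
    obtain ⟨x', y', h', h1, h2⟩ := two_nsmul_X (h := h) hx
    exact ⟨x', y', h', h1, by simp [B, h2]⟩
  | more n ih1 ih2 =>
    obtain ⟨A', B', hB', h1⟩ := ih1
    obtain ⟨A, B, hB, h2⟩ := ih2
    have hne := h2.sub_X_mul_ne_zero (by omega) hB
    refine ⟨(Polynomial.C 2 * A * Polynomial.X * (A + Polynomial.X * B) +
      Polynomial.C W.b₂ * A * Polynomial.X * B + Polynomial.C W.b₄ * B * (A + Polynomial.X * B) +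
      Polynomial.C W.b₆ * B ^ 2) * B' - A' * (A - Polynomial.X * B) ^ 2,
      (A - Polynomial.X * B) ^ 2 * B', mul_ne_zero (pow_ne_zero 2 hne) hB', ?_⟩
    filter_upwards [h1, h2, eventually_eval_ne_zero hB, eventually_eval_ne_zero hne]
      with x hx1 hx2 hBx hABx y hy
    obtain ⟨x₁, y₁, n₁, e₁, f₁⟩ := hx1 y hy
    obtain ⟨x₂, y₂, n₂, e₂, f₂⟩ := hx2 y hy
    simp only [Polynomial.eval_sub, Polynomial.eval_mul, Polynomial.eval_X] at hABx
    have hxx : x₂ ≠ x := by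
      rintro rfl
      exact hABx (by rw [← f₂]; ring)
    obtain ⟨x₃, y₃, n₃, x₄, y₄, n₄, g₁, g₂, g₃⟩ := add_X_add_sub_X n₂ hy hxx
    refine ⟨x₃, y₃, n₃, ?_, ?_⟩
    · rw [← g₁, ← e₂, ← succ_nsmul]
    · have : x₄ = x₁ := by
        rw [← e₂, succ_nsmul, add_sub_cancel_right, e₁] at g₂
        exact (Point.some.inj g₂).1.symm
      rw [this] at g₃
      simp only [Polynomial.eval_sub, Polynomial.eval_mul, Polynomial.eval_X, Polynomial.eval_add,
        Polynomial.eval_C, Polynomial.eval_pow]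
      rw [← f₁, ← f₂]
      linear_combination (B.eval x ^ 2 * B'.eval x) * g₃

/-- Multiplication by `n` is not constant on `x`-coordinates. If it were, with value `c`, then all
`n Q` would be multiples of one point `P` above `c`. Since `P` is itself `n` times a point divisible
by `2`, it would be torsion, and the group would have finite exponent. -/
theorem IsGenericMul.sub_C_mul_ne_zero {n : ℕ} (hn : n ≠ 0) {A B : Polynomial K} (hB : B ≠ 0)
    (h : IsGenericMul W n A B) (c : K) : A - Polynomial.C c * B ≠ 0 := by
  intro h0
  obtain ⟨d, hd⟩ := exists_point (W := W) c
  let P : W.toAffine.Point := Point.some c d hd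
  have htop := eq_top_of_eventually ((AddSubgroup.zmultiples P).comap
      (nsmulAddMonoidHom n : W.toAffine.Point →+ W.toAffine.Point)) (by
    filter_upwards [h, eventually_eval_ne_zero hB] with x hx hBx y hy
    obtain ⟨x', y', h', hmul, hx'⟩ := hx y hy
    have h1 := congrArg (Polynomial.eval x) h0
    simp only [Polynomial.eval_sub, Polynomial.eval_mul, Polynomial.eval_C,
      Polynomial.eval_zero] at h1
    obtain rfl : x' = c := mul_right_cancel₀ hBx (by linear_combination hx' + h1)
    rw [AddSubgroup.mem_comap, nsmulAddMonoidHom_apply, hmul]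
    rcases eq_or_eq_neg_of_X_eq (h := h') (h' := hd) with he | he
    · rw [he]; exact AddSubgroup.mem_zmultiples _
    · rw [he]; exact neg_mem (AddSubgroup.mem_zmultiples _))
  have hall : ∀ Q : W.toAffine.Point, ∃ k : ℤ, k • P = n • Q := fun Q => by
    have : Q ∈ (AddSubgroup.zmultiples P).comap
        (nsmulAddMonoidHom n : W.toAffine.Point →+ W.toAffine.Point) := by rw [htop]; trivial
    exact this
  obtain ⟨x, hx, hBx⟩ := (h.and (eventually_eval_ne_zero hB)).exists
  obtain ⟨y, hy⟩ := exists_point (W := W) x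
  obtain ⟨x', y', h', hmul, hx'⟩ := hx y hy
  have hP : ∃ Q, n • Q = P := by
    have h1 := congrArg (Polynomial.eval x) h0
    simp only [Polynomial.eval_sub, Polynomial.eval_mul, Polynomial.eval_C,
      Polynomial.eval_zero] at h1
    obtain rfl : x' = c := mul_right_cancel₀ hBx (by linear_combination hx' + h1)
    rcases eq_or_eq_neg_of_X_eq (h := h') (h' := hd) with he | he
    · exact ⟨_, hmul.trans he⟩
    · exact ⟨-Point.some _ y hy, by rw [smul_neg, hmul, he, neg_neg]⟩
  obtain ⟨Q, hQ⟩ := hP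
  obtain ⟨R, rfl⟩ := exists_two_nsmul_eq Q
  obtain ⟨k, hk⟩ := hall R
  -- From `P = n (2R) = 2 (n R) = 2k P`. The integer `2k - 1` is odd, hence nonzero.
  have hzero : (2 * k - 1) • P = 0 := by
    rw [sub_smul, mul_smul, hk, one_smul, ← hQ, smul_comm n, sub_eq_zero]
    exact ofNat_zsmul _ _
  have hzero' : (2 * k - 1).natAbs • P = 0 := by
    rcases Int.natAbs_eq (2 * k - 1) with he | he
    · rw [he, natCast_zsmul] at hzero
      exact hzero
    · rw [he, neg_smul, natCast_zsmul, neg_eq_zero] at hzero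
      exact hzero
  obtain ⟨S, hS⟩ := exists_nsmul_ne_zero W (N := (2 * k - 1).natAbs * n)
    (mul_ne_zero (by omega) hn)
  refine hS ?_
  obtain ⟨j, hj⟩ := hall S
  rw [mul_smul, ← hj, smul_comm, hzero', smul_zero]

/-- The group of points of an elliptic curve over an algebraically closed field of characteristic
zero is divisible. -/
theorem exists_nsmul_eq {n : ℕ} (hn : n ≠ 0) (P : W.toAffine.Point) : ∃ Q, n • Q = P := by
  obtain ⟨k, rfl⟩ := Nat.exists_eq_succ_of_ne_zero hn
  obtain ⟨A₀, B₀, hB₀, h₀⟩ := exists_isGenericMul W k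
  -- In lowest terms `B` does not vanish at any root of `A - c B`.
  obtain ⟨A, B, g, hAB, hA, hBg⟩ : ∃ A B g : Polynomial K, IsCoprime A B ∧ A₀ = g * A ∧
      B₀ = g * B := by
    obtain ⟨A, B, hA, hB, hu⟩ := extract_gcd A₀ B₀
    exact ⟨A, B, _, (gcd_isUnit_iff A B).1 hu, hA, hB⟩
  have hg : g ≠ 0 := by rintro rfl; exact hB₀ (by rw [hBg, zero_mul])
  have hB : B ≠ 0 := by rintro rfl; exact hB₀ (by rw [hBg, mul_zero])
  have h : IsGenericMul W (k + 1) A B := by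
    filter_upwards [h₀, eventually_eval_ne_zero hg] with x hx hgx y hy
    obtain ⟨x', y', h', hmul, hx'⟩ := hx y hy
    refine ⟨x', y', h', hmul, mul_left_cancel₀ hgx ?_⟩
    rw [hA, hBg, Polynomial.eval_mul, Polynomial.eval_mul] at hx'
    linear_combination hx'
  have hsub := h.sub_C_mul_ne_zero (Nat.succ_ne_zero k) hB
  -- Two such values of `c` would make `A` and `B` both constant, and then `A = c' B` for some `c'`,
  -- which `hsub` excludes.
  have hdeg : {c : K | (A - Polynomial.C c * B).natDegree = 0}.Subsingleton := by
    intro c hc c' hc'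
    by_contra hcc
    obtain ⟨a, ha⟩ := Polynomial.natDegree_eq_zero.1 hc
    obtain ⟨a', ha'⟩ := Polynomial.natDegree_eq_zero.1 hc'
    have hd : c' - c ≠ 0 := sub_ne_zero.2 (Ne.symm hcc)
    have hBc : Polynomial.C ((a - a') / (c' - c)) = B := by
      have hC : Polynomial.C (c' - c) ≠ 0 := Polynomial.C_ne_zero.2 hd
      refine mul_left_cancel₀ hC ?_
      rw [← Polynomial.C_mul, mul_div_cancel₀ _ hd, Polynomial.C_sub, Polynomial.C_sub, ha, ha']
      ring
    have hb : (a - a') / (c' - c) ≠ 0 := by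
      intro h0
      rw [h0, Polynomial.C_0] at hBc
      exact hB hBc.symm
    generalize (a - a') / (c' - c) = b at hBc hb
    refine hsub (c + a / b) ?_
    rw [Polynomial.C_add, add_mul, ← sub_sub, ← ha, ← hBc, ← Polynomial.C_mul,
      div_mul_cancel₀ _ hb, sub_self]
  have htop := eq_top_of_eventually
      (nsmulAddMonoidHom (k + 1) : W.toAffine.Point →+ W.toAffine.Point).range (by
    have hT := eventually_cofinite.1 h
    set T := {x | ¬∀ y h, ∃ x' y' h', (k + 1) • Point.some (W' := W.toAffine) x y h =
      Point.some x' y' h' ∧ x' * B.eval x = A.eval x} with hTdef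
    -- The values of `c` to avoid: those for which `A - c B` need not have a root, and the images of
    -- the finitely many exceptional `x`.
    have hbad := (hdeg.finite.union (hT.image fun t => A.eval t / B.eval t))
    filter_upwards [hbad.compl_mem_cofinite] with c hc y hy
    rw [Set.mem_compl_iff, Set.mem_union, not_or] at hc
    obtain ⟨x, hx⟩ := IsAlgClosed.exists_root (A - Polynomial.C c * B)
      (Polynomial.degree_ne_of_natDegree_ne hc.1)
    have hx : A.eval x = c * B.eval x := by
      rw [Polynomial.IsRoot.def, Polynomial.eval_sub, Polynomial.eval_mul, Polynomial.eval_C] at hx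
      exact sub_eq_zero.1 hx
    have hBx : B.eval x ≠ 0 := by
      intro h0
      obtain ⟨u, v, huv⟩ := hAB
      have := congrArg (Polynomial.eval x) huv
      simp [hx, h0] at this
    have hxT : x ∉ T := fun hxT => hc.2 ⟨x, hxT, by rw [div_eq_iff hBx, hx]⟩
    rw [hTdef, Set.mem_ofPred_eq, not_not] at hxT
    obtain ⟨y₁, hy₁⟩ := exists_point (W := W) x
    obtain ⟨x', y', h', hmul, hx'⟩ := hxT y₁ hy₁
    obtain rfl : x' = c := mul_right_cancel₀ hBx (hx'.trans hx)
    rcases eq_or_eq_neg_of_X_eq (h := hy) (h' := h') with he | he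
    · exact ⟨_, hmul.trans he.symm⟩
    · exact ⟨-Point.some x y₁ hy₁, by
        rw [nsmulAddMonoidHom_apply, smul_neg, hmul, he]⟩)
  have : P ∈ (nsmulAddMonoidHom (k + 1) : W.toAffine.Point →+ W.toAffine.Point).range := by
    rw [htop]; trivial
  exact this

end WeierstrassCurve.Affine

end

noncomputable section

/-! ### Torsion points and inertia -/

namespace WeierstrassCurve.Affine

open IsLocalRing

/-- Since `σ` does not change residue classes, the torsion point and its image have the same
reduction, and reduction is injective on torsion of order invertible in the residue field. -/
theorem fixed_of_inertia {K : Type*} [Field K] [DecidableEq K] {O : ValuationSubring K}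
    {W₀ : WeierstrassCurve O} {W : WeierstrassCurve K} (hW : W = W₀.map O.subtype) {n : ℕ}
    (hn : (n : ResidueField O) ≠ 0) (hΔ : residue O W₀.Δ ≠ 0) {σ : K → K}
    (hσ : ∀ x ∈ O, σ x ∈ O ∧ (σ x - x = 0 ∨ (σ x - x)⁻¹ ∉ O)) {x y : K}
    {h : W.toAffine.Nonsingular x y} {h' : W.toAffine.Nonsingular (σ x) (σ y)}
    (hP : n • Point.some x y h = 0) (hP' : n • Point.some (σ x) (σ y) h' = 0) :
    σ x = x ∧ σ y = y := by
  subst hW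
  have hx : x ∈ O := X_mem_of_nsmul_eq_zero hn hP
  have hy : y ∈ O := Y_mem_of_X_mem h.1 hx
  have key : ∀ (a : O), ∃ b : O, (b : K) = σ a ∧ residue O b = residue O a := by
    intro a
    obtain ⟨h1, h2⟩ := hσ a a.2
    refine ⟨⟨σ a, h1⟩, rfl, ?_⟩
    rw [← sub_eq_zero, ← map_sub]
    rcases h2 with h2 | h2
    · have : (⟨σ a, h1⟩ - a : O) = 0 := Subtype.ext h2
      rw [this, map_zero]
    · exact residue_eq_zero_of_inv_notMem h2
  lift x to O using hx
  lift y to O using hy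
  obtain ⟨x', hx', hxr⟩ := key x
  obtain ⟨y', hy', hyr⟩ := key y
  have e : ∀ X Y (hXY : (W₀.map O.subtype).toAffine.Nonsingular X Y), X = x' → Y = y' →
      n • Point.some X Y hXY = 0 → X = x ∧ Y = y := by
    rintro _ _ hXY rfl rfl h0
    exact Point.some.inj (some_eq_some_of_residue_eq hn hΔ h0 hP hxr hyr)
  exact e _ _ h' hx'.symm hy'.symm hP'

end WeierstrassCurve.Affine

namespace Pts

variable {F : Type*} [Field F] (E : WeierstrassCurve F) {L : Type*} [Field L] [Algebra F L]

theorem map_injective {L' : Type*} [Field L'] [Algebra F L'] (f : L →ₐ[F] L') :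
    Function.Injective (map E f) := by
  classical
  exact WeierstrassCurve.Affine.Point.map_injective (W' := E.toAffine) f

theorem rep_some (σ : Gal(L/F)) {x y : L} (h : (E.baseChange L).toAffine.Nonsingular x y) :
    ∃ h', rep E L σ (WeierstrassCurve.Affine.Point.some x y h : (E.baseChange L).toAffine.Point) =
      (WeierstrassCurve.Affine.Point.some (σ x) (σ y) h' : (E.baseChange L).toAffine.Point) :=
  ⟨_, rfl⟩

theorem exists_map_eq (M : IntermediateField F L) {x y : L}
    (h : (E.baseChange L).toAffine.Nonsingular x y) (hx : x ∈ M) (hy : y ∈ M) :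
    ∃ Q : Pts E M, map E M.val Q =
      (WeierstrassCurve.Affine.Point.some x y h : (E.baseChange L).toAffine.Point) := by
  lift x to M using hx
  lift y to M using hy
  have h' : (E.baseChange M).toAffine.Nonsingular x y :=
    (WeierstrassCurve.Affine.baseChange_nonsingular E.toAffine (f := M.val)
      M.val.injective x y).1 h
  exact ⟨(WeierstrassCurve.Affine.Point.some x y h' : (E.baseChange M).toAffine.Point), rfl⟩

end Pts

namespace FineSelmer

open NumberField IsDedekindDomain IsLocalRing

variable {F : Type*} [Field F] [NumberField F] {E : WeierstrassCurve F} {p : ℕ}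

/-- An integral model with unit discriminant at a place above a prime of good reduction. -/
theorem exists_good_model {v : HeightOneSpectrum (𝓞 F)} (hv : HasGoodReductionAt E v)
    {w : ValuationSubring (AlgebraicClosure F)} (hw : w ∈ placesOver (AlgebraicClosure F) v) :
    ∃ (C : WeierstrassCurve.VariableChange F) (W₀ : WeierstrassCurve w),
      (C.map (algebraMap F (AlgebraicClosure F))) • E.baseChange (AlgebraicClosure F) =
        W₀.map w.subtype ∧ residue w W₀.Δ ≠ 0 := by
  let R := (v.valuation F).valuationSubring
  have hg : (E.minimal R).HasGoodReduction R := hv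
  have hmem : ∀ x : R, algebraMap F (AlgebraicClosure F) x ∈ w := by
    intro x
    have hx := x.2
    rw [placesOver, Set.mem_ofPred_eq] at hw
    change (x : F) ∈ (v.valuation F).valuationSubring at hx
    rwa [← hw] at hx
  let φ : R →+* w := ((algebraMap F (AlgebraicClosure F)).comp R.subtype).codRestrict w hmem
  have hint := WeierstrassCurve.baseChange_integralModel_eq R (E.minimal R)
  refine ⟨(E.exists_isMinimal R).choose, (WeierstrassCurve.integralModel R (E.minimal R)).map φ,
    ?_, ?_⟩
  · rw [WeierstrassCurve.map_map]
    have h1 : w.subtype.comp φ = (algebraMap F (AlgebraicClosure F)).comp (algebraMap R F) := rfl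
    rw [h1, ← WeierstrassCurve.map_map]
    change _ = ((WeierstrassCurve.integralModel R (E.minimal R)).baseChange F).map _
    rw [hint]
    exact (WeierstrassCurve.map_variableChange ..)
  · have he := (WeierstrassCurve.hasGoodReduction_iff_isElliptic_reduction R).1 hg
    have hu : IsUnit (residue R (WeierstrassCurve.integralModel R (E.minimal R)).Δ) := by
      rw [← WeierstrassCurve.map_Δ]
      exact he.isUnit
    have hu' : IsUnit (WeierstrassCurve.integralModel R (E.minimal R)).Δ :=
      (residue_ne_zero_iff_isUnit _).1 hu.ne_zero
    rw [WeierstrassCurve.map_Δ, residue_ne_zero_iff_isUnit]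
    exact hu'.map φ

theorem natCast_residue_ne_zero {v : HeightOneSpectrum (𝓞 F)} (hv : (p : 𝓞 F) ∉ v.asIdeal)
    {w : ValuationSubring (AlgebraicClosure F)} (hw : w ∈ placesOver (AlgebraicClosure F) v) :
    (p : ResidueField w) ≠ 0 := by
  have h1 : v.valuation F (p : F) = 1 := by
    have := v.valuation_eq_one_iff_notMem (K := F) (r := (p : 𝓞 F)) |>.2 hv
    simpa using this
  have hp0 : (p : F) ≠ 0 := by
    rintro h0
    rw [h0, map_zero] at h1
    exact zero_ne_one h1
  have h2 : ((p : F))⁻¹ ∈ (v.valuation F).valuationSubring := by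
    rw [Valuation.mem_valuationSubring_iff, map_inv₀, h1, inv_one]
  rw [placesOver, Set.mem_ofPred_eq] at hw
  rw [← hw, ValuationSubring.mem_comap, map_inv₀, map_natCast] at h2
  rw [← map_natCast (residue w), residue_ne_zero_iff_isUnit, isUnit_iff_exists_inv]
  refine ⟨⟨_, h2⟩, Subtype.ext ?_⟩
  have : (p : AlgebraicClosure F) ≠ 0 := by
    rw [← map_natCast (algebraMap F (AlgebraicClosure F))]
    simpa using hp0
  exact mul_inv_cancel₀ this

open Pointwise in
-- The change of variables to a model with good reduction is defined over `F`, so it commutes with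
-- `σ`. This transports the question to an integral model with unit discriminant, where
-- `fixed_of_inertia` applies.
theorem rep_eq_of_mem_inertia {v : HeightOneSpectrum (𝓞 F)} (hv : v ∉ badPrimes E p)
    {w : ValuationSubring (AlgebraicClosure F)} (hw : w ∈ placesOver (AlgebraicClosure F) v)
    {σ : w.decompositionSubgroup F} (hσ : σ ∈ w.inertiaSubgroup F)
    {P : Pts E (AlgebraicClosure F)} {n : ℕ} (hP : p ^ n • P = 0) :
    Pts.rep E (AlgebraicClosure F) σ P = P := by
  classical
  rw [badPrimes, Set.mem_ofPred_eq, not_or, not_not] at hv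
  obtain ⟨C, W₀, hW, hΔ⟩ := exists_good_model hv.2 hw
  have hp : ((p ^ n : ℕ) : ResidueField w) ≠ 0 := by
    rw [Nat.cast_pow]
    exact pow_ne_zero n (natCast_residue_ne_zero hv.1 hw)
  have hst : ∀ x, (σ : Gal(AlgebraicClosure F/F)) x ∈ w ↔ x ∈ w := by
    intro x
    have h2 := ValuationSubring.smul_mem_pointwise_smul_iff
      (g := (σ : Gal(AlgebraicClosure F/F))) (S := w) (x := x)
    rwa [show (σ : Gal(AlgebraicClosure F/F)) • w = w from σ.2] at h2
  rw [mem_inertia_iff] at hσ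
  obtain ⟨Q, hQ⟩ := WeierstrassCurve.Affine.variableChangeHom_surjective
    (E.baseChange (AlgebraicClosure F)) (C.map (algebraMap F (AlgebraicClosure F))) P
  have hQ0 : p ^ n • Q = 0 := by
    apply WeierstrassCurve.Affine.variableChangeHom_injective
    rw [map_nsmul, hQ, map_zero]
    exact hP
  rcases Q with _ | ⟨x, y, h⟩
  · have h0 : P = 0 := hQ.symm
    rw [h0, map_zero]
  rw [WeierstrassCurve.Affine.variableChangeHom_some] at hQ
  have hX : ∀ a : AlgebraicClosure F, (σ : Gal(AlgebraicClosure F/F))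
      ((C.map (algebraMap F (AlgebraicClosure F))).u ^ 2 * a +
        (C.map (algebraMap F (AlgebraicClosure F))).r) =
      (C.map (algebraMap F (AlgebraicClosure F))).u ^ 2 *
        (σ : Gal(AlgebraicClosure F/F)) a + (C.map (algebraMap F (AlgebraicClosure F))).r := by
    intro a
    simp [WeierstrassCurve.VariableChange.map]
  have hY : ∀ a b : AlgebraicClosure F, (σ : Gal(AlgebraicClosure F/F))
      ((C.map (algebraMap F (AlgebraicClosure F))).u ^ 3 * b +
        (C.map (algebraMap F (AlgebraicClosure F))).u ^ 2 *
        (C.map (algebraMap F (AlgebraicClosure F))).s * a +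
        (C.map (algebraMap F (AlgebraicClosure F))).t) =
      (C.map (algebraMap F (AlgebraicClosure F))).u ^ 3 * (σ : Gal(AlgebraicClosure F/F)) b +
        (C.map (algebraMap F (AlgebraicClosure F))).u ^ 2 *
        (C.map (algebraMap F (AlgebraicClosure F))).s * (σ : Gal(AlgebraicClosure F/F)) a +
        (C.map (algebraMap F (AlgebraicClosure F))).t := by
    intro a b
    simp [WeierstrassCurve.VariableChange.map]
  obtain ⟨hns, hrep⟩ := Pts.rep_some E (σ : Gal(AlgebraicClosure F/F))
    ((WeierstrassCurve.Affine.variableChange_nonsingular _ _ _ _).1 h)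
  rw [hQ] at hrep
  have hns' : ((C.map (algebraMap F (AlgebraicClosure F))) •
      E.baseChange (AlgebraicClosure F)).toAffine.Nonsingular
      ((σ : Gal(AlgebraicClosure F/F)) x) ((σ : Gal(AlgebraicClosure F/F)) y) := by
    rw [WeierstrassCurve.Affine.variableChange_nonsingular, ← hX, ← hY]
    exact hns
  have hrep' : Pts.rep E (AlgebraicClosure F) σ P =
      WeierstrassCurve.Affine.variableChangeHom (E.baseChange (AlgebraicClosure F))
        (C.map (algebraMap F (AlgebraicClosure F))) (.some _ _ hns') := by
    rw [hrep, WeierstrassCurve.Affine.variableChangeHom_some]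
    congr 1
    · exact hX x
    · exact hY x y
  have hfix := WeierstrassCurve.Affine.fixed_of_inertia hW hp hΔ
    (σ := (σ : Gal(AlgebraicClosure F/F))) (fun a ha => ⟨(hst a).2 ha, hσ a ha⟩) (h := h)
    (h' := hns') hQ0 (by
      apply WeierstrassCurve.Affine.variableChangeHom_injective
      rw [map_nsmul, ← hrep', map_zero]
      refine (map_nsmul (Pts.rep E (AlgebraicClosure F) σ) (p ^ n) P).symm.trans ?_
      rw [hP, map_zero]
      rfl)
  rw [hrep', ← hQ]
  refine congrArg (WeierstrassCurve.Affine.variableChangeHom (E.baseChange (AlgebraicClosure F))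
    (C.map (algebraMap F (AlgebraicClosure F)))) (?_ : _ = WeierstrassCurve.Affine.Point.some x y h)
  rw [WeierstrassCurve.Affine.Point.some.injEq]
  exact hfix

/-- The field `F(x)` is then one of the fields whose compositum is `F_S`. -/
theorem mem_FS_of_fixed {x : AlgebraicClosure F}
    (hx : ∀ v ∉ badPrimes E p, ∀ w ∈ placesOver (AlgebraicClosure F) v,
      ∀ σ ∈ w.inertiaSubgroup F, (σ : Gal(AlgebraicClosure F/F)) x = x) : x ∈ FS E p := by
  have hle : IntermediateField.adjoin F {x} ≤ FS E p := by
    refine le_sSup ?_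
    intro v hv w hw σ hσ y hy
    have key : IntermediateField.adjoin F {x} ≤ IntermediateField.fixedField
        (Subgroup.zpowers (σ : Gal(AlgebraicClosure F/F))) := by
      rw [IntermediateField.adjoin_le_iff, Set.singleton_subset_iff, SetLike.mem_coe,
        IntermediateField.mem_fixedField_iff]
      have : Subgroup.zpowers (σ : Gal(AlgebraicClosure F/F)) ≤
          MulAction.stabilizer Gal(AlgebraicClosure F/F) x := by
        rw [Subgroup.zpowers_le]; exact hx v hv w hw σ hσ
      exact fun f hf => this hf
    exact (IntermediateField.mem_fixedField_iff _ _).1 (key hy) _ (Subgroup.mem_zpowers _)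
  exact hle (IntermediateField.mem_adjoin_simple_self F x)

/-- The points of `p`-power order over `F̄` are defined over `F_S`. -/
theorem exists_map_eq_of_pow_nsmul_eq_zero {P : Pts E (AlgebraicClosure F)} {n : ℕ}
    (hP : p ^ n • P = 0) : ∃ Q : Pts E (FS E p), Pts.map E (FS E p).val Q = P := by
  classical
  rcases P with _ | ⟨x, y, h⟩
  · exact ⟨0, map_zero _⟩
  have key : ∀ v ∉ badPrimes E p, ∀ w ∈ placesOver (AlgebraicClosure F) v,
      ∀ σ ∈ w.inertiaSubgroup F, (σ : Gal(AlgebraicClosure F/F)) x = x ∧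
        (σ : Gal(AlgebraicClosure F/F)) y = y := by
    intro v hv w hw σ hσ
    exact WeierstrassCurve.Affine.Point.some.inj (rep_eq_of_mem_inertia hv hw hσ hP)
  exact Pts.exists_map_eq E (FS E p) h
    (mem_FS_of_fixed fun v hv w hw σ hσ => (key v hv w hw σ hσ).1)
    (mem_FS_of_fixed fun v hv w hw σ hσ => (key v hv w hw σ hσ).2)

/-- `E[p ^ ∞]` is `p`-divisible. -/
theorem exists_nsmul_eq_pTors [E.IsElliptic] (hp : p ≠ 0) (a : pTors p ⊤ (Pts E (FS E p))) :
    ∃ b, p • b = a := by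
  classical
  have : (E.baseChange (AlgebraicClosure F)).IsElliptic :=
    inferInstanceAs (E.map (algebraMap F (AlgebraicClosure F))).IsElliptic
  obtain ⟨a, n, -, hn⟩ := a
  obtain ⟨Q, hQ⟩ : ∃ Q : Pts E (AlgebraicClosure F), p • Q = Pts.map E (FS E p).val a :=
    WeierstrassCurve.Affine.exists_nsmul_eq (W := E.baseChange (AlgebraicClosure F)) hp _
  -- The point is divided by `p` over `F̄`; the quotient again has `p`-power order, so it descends
  -- to `F_S`.
  have hQ0 : p ^ (n + 1) • Q = 0 := by
    rw [pow_succ, mul_smul, hQ, ← map_nsmul, hn, map_zero]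
  obtain ⟨b, rfl⟩ := exists_map_eq_of_pow_nsmul_eq_zero hQ0
  refine ⟨⟨b, n + 1, le_top, ?_⟩, Subtype.ext ?_⟩
  · apply Pts.map_injective E (FS E p).val
    rw [map_nsmul, hQ0, map_zero]
  · apply Pts.map_injective E (FS E p).val
    exact (map_nsmul (Pts.map E (FS E p).val) p b).trans hQ


end FineSelmer
end

noncomputable section

/-! ### The `p`-torsion of the fine Selmer group -/

/-- An additive group with a homomorphism to a finite group and finite kernel is finite, of order
at most the product of the orders. -/
theorem AddMonoidHom.finite_and_card_le {A B : Type*} [AddCommGroup A] [AddCommGroup B]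
    (f : A →+ B) [Finite f.ker] [Finite B] :
    Finite A ∧ Nat.card A ≤ Nat.card f.ker * Nat.card B := by
  have hq : Nat.card (A ⧸ f.ker) ≤ Nat.card B := by
    rw [Nat.card_congr (QuotientAddGroup.quotientKerEquivRange f).toEquiv]
    exact Nat.card_le_card_of_injective _ Subtype.val_injective
  have : Finite (A ⧸ f.ker) :=
    Finite.of_equiv _ (QuotientAddGroup.quotientKerEquivRange f).symm.toEquiv
  have e := AddSubgroup.addGroupEquivQuotientProdAddSubgroup (s := f.ker)
  refine ⟨Finite.of_equiv _ e.symm, ?_⟩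
  rw [Nat.card_congr e, Nat.card_prod, mul_comm]
  exact Nat.mul_le_mul_left _ hq

open Topology in
theorem isLocallyConstant_rep {G M : Type*} [Group G] [TopologicalSpace G] [IsTopologicalGroup G]
    [AddCommGroup M] (ρ : G →* AddMonoid.End M) {m : M} (hm : ∀ᶠ σ in 𝓝 (1 : G), ρ σ m = m) :
    IsLocallyConstant fun g => ρ g m := by
  rw [IsLocallyConstant.iff_eventually_eq]
  intro g
  have ht : Filter.Tendsto (fun h => g⁻¹ * h) (𝓝 g) (𝓝 1) := by
    have := (continuous_const_mul g⁻¹).tendsto g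
    rwa [inv_mul_cancel] at this
  filter_upwards [ht.eventually hm] with h hh
  have : ρ (g * (g⁻¹ * h)) m = ρ g (ρ (g⁻¹ * h) m) := by rw [map_mul]; rfl
  rwa [mul_inv_cancel_left, hh] at this

/-- If `M' ⊆ M` is the `p`-torsion of a `p`-divisible module `M`, then `H¹(G, M')` maps onto the
`p`-torsion of `H¹(G, M)`. -/
theorem ContH1.H1.exists_map_eq {G M M' : Type*} [Group G] [TopologicalSpace G] [AddCommGroup M]
    [AddCommGroup M'] {p : ℕ} {ρ : G →* AddMonoid.End M} {ρ' : G →* AddMonoid.End M'}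
    (hρ : ∀ m, IsLocallyConstant fun g => ρ g m) (hdiv : ∀ m : M, ∃ n, p • n = m) (u : M' →+ M)
    (hu : ∀ g m, u (ρ' (MonoidHom.id G g) m) = ρ g (u m)) (hinj : Function.Injective u)
    (hrange : ∀ m, p • m = 0 → ∃ m', u m' = m) {c : H1 ρ} (hc : p • c = 0) :
    ∃ c', H1.map (MonoidHom.id G) continuous_id u hu c' = c := by
  obtain ⟨c, rfl⟩ := H1.mk_surjective _ c
  rw [← map_nsmul] at hc
  obtain ⟨m, hm⟩ := (H1.mk_eq_zero (p • c)).1 hc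
  -- If `p c` is the coboundary of `m = p n`, then `c` minus the coboundary of `n` is a cohomologous
  -- cocycle killed by `p`, so its values lie in `M'`.
  obtain ⟨n, rfl⟩ := hdiv m
  have hb : ∀ g, p • (c.1 g - (ρ g n - n)) = 0 := by
    intro g
    have : p • c.1 g = ρ g (p • n) - p • n := hm g
    rw [smul_sub, this, map_nsmul, smul_sub, sub_self]
  choose b hincl using fun g => hrange _ (hb g)
  refine ⟨H1.mk _ ⟨b, ?_, ?_⟩, ?_⟩
  · refine IsLocallyConstant.desc b u ?_ hinj
    rw [show u ∘ b = fun g => c.1 g - (ρ g n - n) from funext hincl]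
    exact c.2.1.sub ((hρ n).sub (IsLocallyConstant.const n))
  · intro g h
    apply hinj
    have e1 : u (ρ' g (b h)) = ρ g (u (b h)) := hu g (b h)
    have e2 : ρ (g * h) n = ρ g (ρ h n) := by rw [map_mul]; rfl
    rw [map_add, e1, hincl, hincl, hincl, c.2.2 g h, map_sub, map_sub, e2]
    abel
  · rw [H1.map_mk, ← sub_eq_zero, ← map_sub, H1.mk_eq_zero]
    refine ⟨-n, fun g => ?_⟩
    change u (b g) - c.1 g = ρ g (-n) - -n
    rw [map_neg, hincl]
    abel

namespace FineSelmer

open NumberField IsDedekindDomain ContH1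

variable {F : Type*} [Field F] [NumberField F] (E : WeierstrassCurve F) (p : ℕ)
  (Finf : IntermediateField F (AlgebraicClosure F))

/-- The map `H¹(F_S/F_∞, E[p]) → H¹(F_S/F_∞, E[p ^ ∞])`. -/
def globalIncl : GlobalH1 E p 1 Finf →+ GlobalH1 E p ⊤ Finf :=
  H1.map (MonoidHom.id _) continuous_id (pTors.incl p 1 _) fun _ _ => rfl

variable {Finf} in
theorem loc_globalIncl (w : ValuationSubring Finf) (c : GlobalH1 E p 1 Finf) :
    loc E p ⊤ w (globalIncl E p Finf c) = hLocal E p w (loc E p 1 w c) := by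
  obtain ⟨c, rfl⟩ := H1.mk_surjective _ c
  rfl

theorem locMap_globalIncl (c : GlobalH1 E p 1 Finf) :
    locMap E p ⊤ Finf (globalIncl E p Finf c) = hMap E p Finf (locMap E p 1 Finf c) :=
  funext fun _ => funext fun w => loc_globalIncl E p w.1 c

theorem exists_globalIncl_eq [E.IsElliptic] (hp : p ≠ 0) {c : GlobalH1 E p ⊤ Finf}
    (hc : p • c = 0) : ∃ c', globalIncl E p Finf c' = c := by
  refine H1.exists_map_eq (fun n => ?_) (exists_nsmul_eq_pTors hp) (pTors.incl p 1 _)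
    (fun _ _ => rfl) (AddSubgroup.inclusion_injective _) (fun m hm => ?_) hc
  · have := isLocallyConstant_rep (globalRep E p ⊤) (m := n) (by
      filter_upwards [Pts.rep_eventually E n.1] with σ hσ
      exact Subtype.ext hσ)
    exact this.comp_continuous continuous_subtype_val
  · exact ⟨⟨m.1, 1, by simp, by rw [pow_one]; exact congrArg Subtype.val hm⟩, rfl⟩

/-- Each class of `R(E/F_∞)[p]` has a lift to `H¹(F_S/F_∞, E[p])`, and distinct classes have
distinct lifts, so it is enough to count the group `U` of classes whose localization lies in `ker
h`. Localization maps `U` to `ker h`, and its kernel embeds in `R(E[p]/F_∞)`. The lift is a mere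
choice, which suffices for an upper bound. -/
theorem finite_torsion_and_card_le [E.IsElliptic] (hp : p ≠ 0) [Finite (hMap E p Finf).ker]
    [Finite (fineSelmer E p 1 Finf)] :
    Finite {c : fineSelmer E p ⊤ Finf // p • c = 0} ∧
      Nat.card {c : fineSelmer E p ⊤ Finf // p • c = 0} ≤
        Nat.card (fineSelmer E p 1 Finf) * Nat.card (hMap E p Finf).ker := by
  let U : AddSubgroup (GlobalH1 E p 1 Finf) := ((hMap E p Finf).comp (locMap E p 1 Finf)).ker
  let f : U →+ (hMap E p Finf).ker :=
    ((locMap E p 1 Finf).comp U.subtype).codRestrict _ fun u => u.2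
  let i : f.ker → fineSelmer E p 1 Finf := fun u => ⟨u.1.1, congrArg Subtype.val u.2⟩
  have hi : Function.Injective i := fun u v h =>
    Subtype.ext (Subtype.ext (congrArg (fun x : fineSelmer E p 1 Finf => x.1) h))
  have : Finite f.ker := Finite.of_injective i hi
  obtain ⟨hU, hcard⟩ := f.finite_and_card_le
  choose s hs using fun c : {c : fineSelmer E p ⊤ Finf // p • c = 0} =>
    exists_globalIncl_eq E p Finf hp (c := c.1.1) (congrArg Subtype.val c.2)
  let j : {c : fineSelmer E p ⊤ Finf // p • c = 0} → U := fun c => ⟨s c, by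
    rw [AddMonoidHom.mem_ker, AddMonoidHom.comp_apply, ← locMap_globalIncl, hs]
    exact c.1.2⟩
  have hj : Function.Injective j := fun c d h => by
    have h1 : s c = s d := congrArg Subtype.val h
    exact Subtype.ext (Subtype.ext (by rw [← hs c, ← hs d, h1]))
  refine ⟨Finite.of_injective j hj, (Nat.card_le_card_of_injective j hj).trans (hcard.trans ?_)⟩
  exact Nat.mul_le_mul_right _ (Nat.card_le_card_of_injective i hi)

end FineSelmer
end

noncomputable section

/-! ### Duals of cofinitely generated `p`-primary groups -/

/-- Completion commutes with finite products. Nakayama's lemma for the dual uses this for `ℤ_p ^ B`.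
-/
instance IsPrecomplete.pi_const {R ι : Type*} [CommRing R] [Finite ι] (I : Ideal R)
    [IsPrecomplete I R] : IsPrecomplete I (ι → R) := by
  classical
  have := Fintype.ofFinite ι
  rw [← AdicCompletion.of_surjective_iff]
  intro y
  choose x hx using fun i => AdicCompletion.of_surjective I R
    (AdicCompletion.piEquivOfFintype I (fun _ : ι => R) y i)
  refine ⟨x, (AdicCompletion.piEquivOfFintype I (fun _ : ι => R)).injective (funext fun i => ?_)⟩
  rw [← hx i, AdicCompletion.piEquivOfFintype_apply]
  exact AdicCompletion.map_of I (LinearMap.proj (φ := fun _ : ι => R) i) x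

theorem Submodule.exists_span_range_eq_top_of_card_le (k : Type*) {V : Type*} [Field k] [Finite k]
    [AddCommGroup V] [Module k V] [Finite V] {B : ℕ} (hB : Nat.card V ≤ Nat.card k ^ B) :
    ∃ v : Fin B → V, Submodule.span k (Set.range v) = ⊤ := by
  have hd : Module.finrank k V ≤ B := by
    rw [Module.natCard_eq_pow_finrank (K := k) (V := V)] at hB
    exact (Nat.pow_le_pow_iff_right Finite.one_lt_card).1 hB
  let b := Module.finBasis k V
  -- A basis is padded with zeros to exactly `B` vectors.
  refine ⟨fun i => if h : i.1 < Module.finrank k V then b ⟨i, h⟩ else 0, ?_⟩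
  rw [eq_top_iff, ← b.span_eq, Submodule.span_le]
  rintro _ ⟨i, rfl⟩
  exact Submodule.subset_span ⟨⟨i, i.2.trans_le hd⟩, by simp⟩

theorem AddSubgroup.exists_closure_range_eq_top_of_card_le (p : ℕ) [Fact p.Prime] {V : Type*}
    [AddCommGroup V] [Finite V] (hV : ∀ v : V, p • v = 0) {B : ℕ} (hB : Nat.card V ≤ p ^ B) :
    ∃ v : Fin B → V, AddSubgroup.closure (Set.range v) = ⊤ := by
  have key [Module (ZMod p) V] : ∃ v : Fin B → V, AddSubgroup.closure (Set.range v) = ⊤ := by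
    obtain ⟨v, hv⟩ := Submodule.exists_span_range_eq_top_of_card_le (ZMod p) (V := V) (B := B)
      (by rwa [Nat.card_zmod])
    refine ⟨v, eq_top_iff.2 fun x _ => ?_⟩
    have hx : x ∈ Submodule.span (ZMod p) (Set.range v) := by rw [hv]; trivial
    exact Submodule.span_induction (p := fun y _ => y ∈ AddSubgroup.closure (Set.range v))
      (fun y hy => AddSubgroup.subset_closure hy) (zero_mem _) (fun _ _ _ _ => add_mem)
      (fun c y _ hy => ZMod.smul_mem hy c) hx
  exact @key (AddCommGroup.zmodModule hV)

namespace PontDual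

variable (p : ℕ) [Fact p.Prime]

/-- The group `ℚ_p / ℤ_p` is divisible. -/
instance divisibleBy : DivisibleBy (ℚ_[p] ⧸ (PadicInt.subring p).toAddSubgroup) ℤ :=
  have : DivisibleBy (ℚ_[p] ⧸ (PadicInt.subring p).toAddSubgroup) ℕ :=
    have : DivisibleBy ℚ_[p] ℕ := AddGroup.divisibleByNatOfDivisibleByInt _
    QuotientAddGroup.divisibleBy _
  AddGroup.divisibleByIntOfDivisibleByNat _

variable {p} in
/-- The homomorphism underlying an element of the dual. -/
def toHom {A : Type*} [AddCommGroup A] (g : PontDual p A) :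
    A →+ ℚ_[p] ⧸ (PadicInt.subring p).toAddSubgroup := g

/-- Such a `g` factors through `A / A[p] ≃ pA`, and it extends from `pA` to `A` because `ℚ_p / ℤ_p`
is injective. So the dual modulo `p` embeds in the dual of `A[p]`. -/
theorem exists_smul_eq_of_forall_apply_eq_zero {A : Type*} [AddCommGroup A] [Module ℤ_[p] A]
    (g : PontDual p A) (hg : ∀ a : A, p • a = 0 → toHom g a = 0) :
    ∃ g' : PontDual p A, (p : ℤ_[p]) • g' = g := by
  let m : A →+ A := nsmulAddMonoidHom p
  let g₀ : A →+ ℚ_[p] ⧸ (PadicInt.subring p).toAddSubgroup := g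
  let u : A ⧸ m.ker →+ ℚ_[p] ⧸ (PadicInt.subring p).toAddSubgroup :=
    QuotientAddGroup.lift m.ker g₀ fun a ha => hg a ha
  obtain ⟨h, hh⟩ := (Module.Baer.of_divisible _).extension_property_addMonoidHom
    (QuotientAddGroup.kerLift m) (QuotientAddGroup.kerLift_injective m) u
  refine ⟨h, AddMonoidHom.ext fun a => ?_⟩
  have h1 := DFunLike.congr_fun hh (QuotientAddGroup.mk a)
  change h ((p : ℤ_[p]) • a) = g₀ a
  rw [Nat.cast_smul_eq_nsmul]
  exact h1

/-- This bounds by `p` the number of values that a character can take on an element of `A[p]`. -/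
theorem exists_eq_mk_of_nsmul_eq_zero {x : ℚ_[p] ⧸ (PadicInt.subring p).toAddSubgroup}
    (hx : p • x = 0) : ∃ a : ZMod p, x = QuotientAddGroup.mk ((a.val : ℚ_[p]) / p) := by
  obtain ⟨x, rfl⟩ := QuotientAddGroup.mk_surjective x
  have hp : (p : ℚ_[p]) ≠ 0 := by exact_mod_cast (Fact.out : p.Prime).ne_zero
  have h1 : p • x ∈ (PadicInt.subring p).toAddSubgroup := by
    rw [← QuotientAddGroup.eq_zero_iff]; exact hx
  let z : ℤ_[p] := ⟨p • x, h1⟩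
  have h2 := PadicInt.toZMod_spec z
  rw [PadicInt.maximalIdeal_eq_span_p, Ideal.mem_span_singleton] at h2
  obtain ⟨w, hw⟩ := h2
  refine ⟨PadicInt.toZMod z, ?_⟩
  rw [QuotientAddGroup.eq]
  have h3 : -x + ((PadicInt.toZMod z).val : ℚ_[p]) / p = ((-w : ℤ_[p]) : ℚ_[p]) := by
    have h4 : (z : ℚ_[p]) - ((PadicInt.toZMod z).val : ℚ_[p]) = p * w := by
      have := congrArg (fun t : ℤ_[p] => (t : ℚ_[p])) hw
      rw [ZMod.cast_eq_val] at this
      simpa using this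
    have h5 : (z : ℚ_[p]) = p * x := by simp [z]
    rw [h5] at h4
    push_cast
    field_simp
    linear_combination -h4
  rw [h3]
  exact (-w).2

variable {A : Type*} [AddCommGroup A] [Module ℤ_[p] A]

/-- A multiple of `p ^ k` in the dual vanishes on `A[p ^ k]`, and these subgroups exhaust `A`. -/
theorem isHausdorff (hA : ∀ a : A, ∃ k : ℕ, p ^ k • a = 0) :
    IsHausdorff (IsLocalRing.maximalIdeal ℤ_[p]) (PontDual p A) := by
  refine ⟨fun x hx => AddMonoidHom.ext fun a => ?_⟩
  obtain ⟨k, hk⟩ := hA a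
  have h1 := hx k
  rw [SModEq.zero, PadicInt.maximalIdeal_eq_span_p, Ideal.span_singleton_pow,
    Submodule.ideal_span_singleton_smul, Submodule.mem_smul_pointwise_iff_exists] at h1
  obtain ⟨y, -, rfl⟩ := h1
  change toHom y (((p : ℤ_[p]) ^ k) • a) = 0
  have h2 : ((p : ℤ_[p]) ^ k) • a = p ^ k • a := by
    rw [← Nat.cast_pow, Nat.cast_smul_eq_nsmul]
  rw [h2, hk]
  exact map_zero (toHom y)

/-- Characters are counted modulo `p` by their values on `B` generators of `A[p]`, which gives `B`
generators modulo `p`. Their lifts generate the whole dual by completeness. -/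
theorem exists_surjective_of_card_le (hA : ∀ a : A, ∃ k : ℕ, p ^ k • a = 0) {B : ℕ}
    [Finite {a : A // p • a = 0}] (hB : Nat.card {a : A // p • a = 0} ≤ p ^ B) :
    ∃ f : (Fin B → ℤ_[p]) →ₗ[ℤ_[p]] PontDual p A, Function.Surjective f := by
  let T : AddSubgroup A := (nsmulAddMonoidHom p : A →+ A).ker
  have : Finite T := ‹Finite {a : A // p • a = 0}›
  obtain ⟨b, hb⟩ := AddSubgroup.exists_closure_range_eq_top_of_card_le p
    (fun a : T => Subtype.ext a.2) hB
  set I := IsLocalRing.maximalIdeal ℤ_[p] with hI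
  have hpI : (p : ℤ_[p]) ∈ I := by
    rw [hI, PadicInt.maximalIdeal_eq_span_p]
    exact Ideal.mem_span_singleton_self _
  let Q := PontDual p A ⧸ (I • ⊤ : Submodule ℤ_[p] (PontDual p A))
  have hval (g : PontDual p A) (i : Fin B) :
      ∃ c : ZMod p, toHom g (b i : A) = QuotientAddGroup.mk ((c.val : ℚ_[p]) / p) := by
    refine exists_eq_mk_of_nsmul_eq_zero p ?_
    rw [← map_nsmul]
    exact (congrArg _ (b i).2).trans (map_zero _)
  choose c hc using hval
  -- A class modulo `p` is recorded by the values of one representative on the generators `b i`.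
  -- Representatives with equal values agree on `A[p]`, so they differ by a multiple of `p`.
  let j : Q → Fin B → ZMod p := fun q => c q.out
  have hj : Function.Injective j := by
    intro q q' h
    rw [← q.out_eq, ← q'.out_eq]
    refine (Submodule.Quotient.eq _).2 ?_
    obtain ⟨g', hg'⟩ := exists_smul_eq_of_forall_apply_eq_zero p (q.out - q'.out) fun a ha => by
      have hV : AddSubgroup.closure (Set.range b) ≤
          ((toHom q.out - toHom q'.out).comp T.subtype).ker := by
        rw [AddSubgroup.closure_le]
        rintro _ ⟨i, rfl⟩
        change toHom q.out (b i : A) - toHom q'.out (b i : A) = 0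
        rw [hc, hc, sub_eq_zero, show c q.out i = c q'.out i from congrFun h i]
      exact hV (hb ▸ AddSubgroup.mem_top (⟨a, ha⟩ : T))
    rw [← hg']
    exact Submodule.smul_mem_smul hpI Submodule.mem_top
  have : Finite Q := Finite.of_injective j hj
  have hQ : Nat.card Q ≤ p ^ B := by
    simpa using Nat.card_le_card_of_injective j hj
  obtain ⟨v', hv'⟩ := AddSubgroup.exists_closure_range_eq_top_of_card_le p (fun q : Q => by
    obtain ⟨g, rfl⟩ := Submodule.Quotient.mk_surjective _ q
    rw [← Submodule.Quotient.mk_smul, Submodule.Quotient.mk_eq_zero, ← Nat.cast_smul_eq_nsmul ℤ_[p]]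
    exact Submodule.smul_mem_smul hpI Submodule.mem_top) hQ
  let v : Fin B → PontDual p A := fun i => (v' i).out
  have hv : Submodule.mkQ (I • ⊤) ∘ v = v' := funext fun i => (v' i).out_eq
  have := isHausdorff p hA
  -- The dual is not yet known to be finitely generated, so the form of Nakayama's lemma with a
  -- complete source and a separated target is needed.
  refine ⟨Fintype.linearCombination ℤ_[p] v, surjective_of_mkQ_comp_surjective (I := I) ?_⟩
  rw [← LinearMap.range_eq_top, LinearMap.range_comp, Fintype.range_linearCombination,
    Submodule.map_span, ← Set.range_comp, hv, eq_top_iff]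
  intro q _
  have hq : q ∈ AddSubgroup.closure (Set.range v') := hv' ▸ AddSubgroup.mem_top q
  exact (AddSubgroup.closure_le (Submodule.span ℤ_[p] (Set.range v')).toAddSubgroup).2
    Submodule.subset_span hq

end PontDual
end

noncomputable section

/-! ### Modules over `ℤ_p⟦T⟧` that are finitely generated over `ℤ_p` -/

namespace IwasawaAlg

open Polynomial

variable {p : ℕ} [Fact p.Prime]

instance : IsAdicComplete (Ideal.span {(p : ℤ_[p])}) ℤ_[p] := by
  rw [← PadicInt.maximalIdeal_eq_span_p]
  infer_instance

section

variable {M : Type*} [AddCommGroup M] [Module (IwasawaAlg p) M] [Module ℤ_[p] M]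
  [IsScalarTower ℤ_[p] (IwasawaAlg p) M]

variable (p M) in
/-- Weierstrass preparation turns the characteristic polynomial of `T` into a distinguished
annihilator. -/
theorem exists_distinguished_smul_eq_zero [Module.Finite ℤ_[p] M] :
    ∃ h : ℤ_[p][X], h.IsDistinguishedAt (Ideal.span {(p : ℤ_[p])}) ∧
      ∀ m : M, (h : IwasawaAlg p) • m = 0 := by
  let φ : IwasawaAlg p →ₐ[ℤ_[p]] Module.End ℤ_[p] M := Algebra.lsmul ℤ_[p] ℤ_[p] M
  obtain ⟨q, hq, hq0⟩ := LinearMap.exists_monic_and_aeval_eq_zero ℤ_[p] (φ PowerSeries.X)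
  have hφ : φ (q : IwasawaAlg p) = 0 := by
    have h1 : (q : IwasawaAlg p) = aeval (PowerSeries.X : IwasawaAlg p) q := by
      have h2 : Polynomial.coeToPowerSeries.algHom ℤ_[p] =
          aeval (R := ℤ_[p]) (PowerSeries.X : IwasawaAlg p) := Polynomial.algHom_ext (by simp)
      rw [← h2]
      simp
    rw [h1, ← hq0, Polynomial.aeval_algHom_apply]
  have hmap : (q : IwasawaAlg p).map (IsLocalRing.residue ℤ_[p]) ≠ 0 := by
    intro h0
    have h2 := congrArg (PowerSeries.coeff q.natDegree) h0
    simp [hq.coeff_natDegree] at h2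
  obtain ⟨f, u, hf⟩ := PowerSeries.exists_isWeierstrassFactorization hmap
  refine ⟨f, PadicInt.maximalIdeal_eq_span_p (p := p) ▸ hf.isDistinguishedAt, fun m => ?_⟩
  have h3 : (u * f : IwasawaAlg p) • m = 0 := by
    rw [mul_comm, ← hf.eq_mul]
    exact LinearMap.congr_fun hφ m
  rw [mul_smul] at h3
  exact (hf.isUnit.smul_eq_zero).1 h3

variable (p M) in
theorem isTorsion_of_finite [Module.Finite ℤ_[p] M] : Module.IsTorsion (IwasawaAlg p) M := by
  obtain ⟨h, hh, hM⟩ := exists_distinguished_smul_eq_zero p M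
  intro m
  refine ⟨⟨h, mem_nonZeroDivisors_of_ne_zero ?_⟩, hM m⟩
  rw [Ne, Polynomial.coe_eq_zero_iff]
  exact hh.monic.ne_zero

/-- Dividing `g` by a distinguished polynomial that kills both modules leaves a polynomial remainder
with the same action. Applying the existence of an annihilator to `M × N` produces a common one. -/
theorem map_smul_of_polynomial {N : Type*} [AddCommGroup N] [Module (IwasawaAlg p) N]
    [Module ℤ_[p] N] [IsScalarTower ℤ_[p] (IwasawaAlg p) N] [Module.Finite ℤ_[p] M]
    [Module.Finite ℤ_[p] N] (φ : M →+ N)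
    (hφ : ∀ (q : ℤ_[p][X]) (m : M), φ ((q : IwasawaAlg p) • m) = (q : IwasawaAlg p) • φ m)
    (g : IwasawaAlg p) (m : M) : φ (g • m) = g • φ m := by
  obtain ⟨h, hh, hMN⟩ := exists_distinguished_smul_eq_zero p (M × N)
  have hM (m : M) : (h : IwasawaAlg p) • m = 0 := congrArg Prod.fst (hMN (m, 0))
  have hN (n : N) : (h : IwasawaAlg p) • n = 0 := congrArg Prod.snd (hMN (0, n))
  have h1 := (hh.isWeierstrassDivisorAt'.isWeierstrassDivisionAt_div_mod g).2
  rw [h1, mul_comm, add_smul, add_smul, mul_smul, mul_smul, hM, smul_zero, zero_add, hφ, hN,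
    smul_zero, zero_add]

end

theorem finite_of_pow_smul_eq_zero {Q : Type*} [AddCommGroup Q] [Module ℤ_[p] Q]
    [Module.Finite ℤ_[p] Q] (hQ : ∀ x : Q, ∃ k : ℕ, (p : ℤ_[p]) ^ k • x = 0) : Finite Q := by
  obtain ⟨s, hs⟩ := Module.Finite.fg_top (R := ℤ_[p]) (M := Q)
  choose k hk using hQ
  let N := s.sup k
  have hN (x : Q) : (p : ℤ_[p]) ^ N • x = 0 := by
    have hx : x ∈ Submodule.span ℤ_[p] (s : Set Q) := hs ▸ Submodule.mem_top
    induction hx using Submodule.span_induction with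
    | mem y hy =>
      obtain ⟨d, hd⟩ := Nat.exists_eq_add_of_le (Finset.le_sup (f := k) hy : k y ≤ N)
      rw [show N = k y + d from hd, add_comm, pow_add, mul_smul, hk, smul_zero]
    | zero => rw [smul_zero]
    | add y z _ _ hy hz => rw [smul_add, hy, hz, add_zero]
    | smul c y _ hy => rw [smul_comm, hy, smul_zero]
  let I : Ideal ℤ_[p] := Ideal.span {(p : ℤ_[p]) ^ N}
  have hI : Module.IsTorsionBySet ℤ_[p] Q I := by
    rw [Module.isTorsionBySet_span_singleton_iff]
    exact fun x => hN x
  let _ : Module (ℤ_[p] ⧸ I) Q := hI.module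
  have : IsScalarTower ℤ_[p] (ℤ_[p] ⧸ I) Q := hI.isScalarTower
  have : Module.Finite (ℤ_[p] ⧸ I) Q := Module.Finite.of_restrictScalars_finite ℤ_[p] _ _
  have : NeZero (p ^ N) := ⟨pow_ne_zero _ (Fact.out : p.Prime).ne_zero⟩
  have : Finite (ℤ_[p] ⧸ I) := by
    have e := Ideal.quotEquivOfEq (PadicInt.ker_toZModPow (p := p) N)
    exact Finite.of_injective _ ((RingHom.kerLift_injective (PadicInt.toZModPow N)).comp
      e.symm.injective)
  exact Module.finite_of_finite (ℤ_[p] ⧸ I)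

/-- Modulo `p` the polynomial `h` is a power of `X`, so its monic divisor `g` reduces to a power of
`X` as well. -/
theorem isDistinguishedAt_of_dvd {g h : ℤ_[p][X]} (hg : g.Monic)
    (hh : h.IsDistinguishedAt (Ideal.span {(p : ℤ_[p])})) (hgh : g ∣ h) :
    g.IsDistinguishedAt (Ideal.span {(p : ℤ_[p])}) := by
  rw [← PadicInt.maximalIdeal_eq_span_p] at hh ⊢
  refine ⟨⟨fun {n} hn => ?_⟩, hg⟩
  have h1 := Polynomial.map_dvd (IsLocalRing.residue ℤ_[p]) hgh
  rw [show h.map (IsLocalRing.residue ℤ_[p]) = X ^ h.natDegree from hh.map_eq_X_pow,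
    dvd_prime_pow Polynomial.prime_X] at h1
  obtain ⟨k, -, hk⟩ := h1
  have h2 := Polynomial.eq_of_monic_of_associated (hg.map _) (monic_X_pow k) hk
  have h3 : k = g.natDegree := by
    rw [← hg.natDegree_map (IsLocalRing.residue ℤ_[p]), h2, natDegree_X_pow]
  have h4 := congrArg (fun q => q.coeff n) h2
  simp only [coeff_map, coeff_X_pow, h3, hn.ne, if_false] at h4
  exact (IsLocalRing.residue_eq_zero_iff _).1 h4

/-- Gauss's lemma: a factor over `ℚ_p` of a monic polynomial over `ℤ_p` becomes integral once it is
made monic. -/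
theorem exists_distinguished_associated {P : ℚ_[p][X]} (hP : Irreducible P) {h : ℤ_[p][X]}
    (hh : h.IsDistinguishedAt (Ideal.span {(p : ℤ_[p])}))
    (hPh : P ∣ h.map (algebraMap ℤ_[p] ℚ_[p])) :
    ∃ g : ℤ_[p][X], g.IsDistinguishedAt (Ideal.span {(p : ℤ_[p])}) ∧ Irreducible g ∧
      Associated P (g.map (algebraMap ℤ_[p] ℚ_[p])) := by
  obtain ⟨g, hg⟩ := IsIntegrallyClosed.eq_map_mul_C_of_dvd ℚ_[p] hh.monic hPh
  have hlc : P.leadingCoeff ≠ 0 := leadingCoeff_ne_zero.2 hP.ne_zero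
  have hass : Associated P (g.map (algebraMap ℤ_[p] ℚ_[p])) := by
    refine Associated.symm ⟨(isUnit_C.2 hlc.isUnit).unit, ?_⟩
    exact hg
  have hmonic : g.Monic := by
    have h1 := congrArg leadingCoeff hg
    rw [leadingCoeff_mul, leadingCoeff_C, mul_eq_right₀ hlc] at h1
    exact Polynomial.monic_of_injective (FaithfulSMul.algebraMap_injective ℤ_[p] ℚ_[p]) h1
  refine ⟨g, isDistinguishedAt_of_dvd hmonic hh ?_, ?_, hass⟩
  · exact (Polynomial.map_dvd_map _ (FaithfulSMul.algebraMap_injective ℤ_[p] ℚ_[p]) hmonic).1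
      (hass.symm.dvd.trans hPh)
  · exact (hmonic.irreducible_iff_irreducible_map_fraction_map (K := ℚ_[p])).2
      (hass.irreducible hP)

end IwasawaAlg
end

noncomputable section

/-! ### Existence of the Iwasawa invariants -/

theorem Ideal.isLocalizedModule_mapQ {R K : Type*} [CommRing R] [CommRing K] [Algebra R K]
    (S : Submonoid R) [IsLocalization S K] (a : R) :
    ∃ f : (R ⧸ Ideal.span {a}) →ₗ[R] (K ⧸ Ideal.span {algebraMap R K a}),
      IsLocalizedModule S f := by
  have h : (Ideal.span {a} : Submodule R R).localized' K S (Algebra.linearMap R K) =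
      Ideal.span {algebraMap R K a} := by
    rw [Ideal.span, Submodule.localized'_span, Set.image_singleton]
    rfl
  rw [← h]
  exact ⟨_, IsLocalizedModule.toLocalizedQuotient' K S (Algebra.linearMap R K) _⟩

open TensorProduct in
-- A map out of a finitely presented module is defined over `R` after multiplication by an element
-- of `S`. An isomorphism after localization thus comes from a map whose kernel and cokernel are
-- `S`-torsion.
theorem Module.exists_linearMap_pi_quotient {R K M : Type*} [CommRing R] [CommRing K] [Algebra R K]
    (S : Submonoid R) [IsLocalization S K] [AddCommGroup M] [Module R M]
    [Module.FinitePresentation R M] {ι : Type*} [Finite ι] (a : ι → R)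
    (e : (K ⊗[R] M) ≃ₗ[K] ((i : ι) → K ⧸ Ideal.span {algebraMap R K (a i)})) :
    ∃ φ : M →ₗ[R] ((i : ι) → R ⧸ Ideal.span {a i}),
      (∀ m, φ m = 0 → ∃ s ∈ S, s • m = 0) ∧ ∀ n, ∃ s ∈ S, s • n ∈ LinearMap.range φ := by
  choose f hf using fun i => Ideal.isLocalizedModule_mapQ (K := K) S (a i)
  let F : ((i : ι) → R ⧸ Ideal.span {a i}) →ₗ[R]
      ((i : ι) → K ⧸ Ideal.span {algebraMap R K (a i)}) := .pi fun i ↦ f i ∘ₗ .proj i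
  have hF : IsLocalizedModule S F := IsLocalizedModule.pi S f
  let g₀ : M →ₗ[R] K ⊗[R] M := TensorProduct.mk R K M 1
  have hg₀ : IsLocalizedModule S g₀ :=
    (isLocalizedModule_iff_isBaseChange S K _).2 (TensorProduct.isBaseChange R M K)
  obtain ⟨φ, s, hφ⟩ := Module.FinitePresentation.exists_lift_of_isLocalizedModule S F
    ((e.restrictScalars R).toLinearMap ∘ₗ g₀)
  have hφ' (m : M) : F (φ m) = (s : R) • e (g₀ m) := LinearMap.congr_fun hφ m
  refine ⟨φ, fun m hm => ?_, fun n => ?_⟩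
  · have h1 := hφ' m
    rw [hm, map_zero, ← smul_zero (s : R)] at h1
    have h2 : e (g₀ m) = 0 := (IsLocalizedModule.smul_injective F s h1).symm
    rw [LinearEquiv.map_eq_zero_iff, IsLocalizedModule.eq_zero_iff S g₀] at h2
    obtain ⟨s', hs'⟩ := h2
    exact ⟨s', s'.2, hs'⟩
  · obtain ⟨⟨m, s₁⟩, h1⟩ := IsLocalizedModule.surj S g₀ (e.symm (F n))
    have h2 : (s₁ : R) • F n = e (g₀ m) := by
      rw [← h1, Submonoid.smul_def, ← LinearEquiv.restrictScalars_apply R e, map_smul,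
        LinearEquiv.restrictScalars_apply, e.apply_symm_apply]
    have h3 : F (φ m) = F ((s * s₁ : R) • n) := by
      rw [hφ', ← h2, map_smul, mul_smul]
    obtain ⟨s₂, h4⟩ := IsLocalizedModule.exists_of_eq (S := S) (f := F) h3
    refine ⟨s₂ * (s * s₁), mul_mem s₂.2 (mul_mem s.2 s₁.2), (s₂ : R) • m, ?_⟩
    rw [map_smul, mul_smul]
    exact h4

theorem LinearMap.bijective_pi_proj_of_subsingleton {R ι κ : Type*} [CommRing R] (σ : κ → ι)
    (hσ : Function.Injective σ) (N : ι → Type*) [∀ i, AddCommGroup (N i)] [∀ i, Module R (N i)]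
    (hN : ∀ i, i ∉ Set.range σ → Subsingleton (N i)) :
    Function.Bijective
      (LinearMap.pi (fun j => LinearMap.proj (σ j)) : ((i : ι) → N i) →ₗ[R] (j : κ) → N (σ j)) := by
  classical
  refine ⟨fun x y h => funext fun i => ?_, fun y => ?_⟩
  · by_cases hi : i ∈ Set.range σ
    · obtain ⟨j, rfl⟩ := hi
      exact congrFun h j
    · exact (hN i hi).elim _ _
  · refine ⟨fun i => if hi : i ∈ Set.range σ then hi.choose_spec ▸ y hi.choose else 0,
      funext fun j => ?_⟩
    have hj : σ j ∈ Set.range σ := ⟨j, rfl⟩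
    have key : ∀ (j' : κ) (h : σ j' = σ j), (h ▸ y j' : N (σ j)) = y j := by
      intro j' h
      obtain rfl := hσ h
      rfl
    simp only [LinearMap.pi_apply, LinearMap.proj_apply, dif_pos hj]
    exact key _ _

namespace IwasawaAlg

open Polynomial TensorProduct

variable {p : ℕ} [Fact p.Prime]

attribute [local instance] Polynomial.algebra

theorem _root_.Polynomial.IsDistinguishedAt.pow {R : Type*} [CommRing R] {I : Ideal R} {f : R[X]}
    (hf : f.IsDistinguishedAt I) (n : ℕ) : (f ^ n).IsDistinguishedAt I := by
  induction n with
  | zero => exact ⟨⟨fun {n} hn => by simp at hn⟩, by simp⟩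
  | succ n ih => rw [pow_succ]; exact ih.mul hf

/-- The structure theorem over `ℚ_p[X]`, with the prime powers chosen integral. -/
theorem exists_equiv_pi_quotient (M : Type*) [AddCommGroup M] [Module ℤ_[p][X] M]
    [Module.Finite ℤ_[p][X] M] {h : ℤ_[p][X]}
    (hh : h.IsDistinguishedAt (Ideal.span {(p : ℤ_[p])})) (hM : ∀ m : M, h • m = 0) :
    ∃ (t : ℕ) (g : Fin t → ℤ_[p][X]) (e : Fin t → ℕ),
      (∀ j, (g j).IsDistinguishedAt (Ideal.span {(p : ℤ_[p])})) ∧ (∀ j, Irreducible (g j)) ∧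
      (∀ j, 0 < e j) ∧
      Nonempty ((ℚ_[p][X] ⊗[ℤ_[p][X]] M) ≃ₗ[ℚ_[p][X]]
        ((j : Fin t) → ℚ_[p][X] ⧸ Ideal.span {algebraMap ℤ_[p][X] ℚ_[p][X] (g j ^ e j)})) := by
  classical
  have hV (x : ℚ_[p][X] ⊗[ℤ_[p][X]] M) : algebraMap ℤ_[p][X] ℚ_[p][X] h • x = 0 := by
    induction x using TensorProduct.induction_on with
    | zero => rw [smul_zero]
    | tmul c m => rw [algebraMap_smul, ← TensorProduct.tmul_smul, hM, TensorProduct.tmul_zero]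
    | add x y hx hy => rw [smul_add, hx, hy, add_zero]
  have hh0 : algebraMap ℤ_[p][X] ℚ_[p][X] h ≠ 0 := (hh.monic.map _).ne_zero
  have htors : Module.IsTorsion ℚ_[p][X] (ℚ_[p][X] ⊗[ℤ_[p][X]] M) := fun {x} =>
    ⟨⟨_, mem_nonZeroDivisors_of_ne_zero hh0⟩, hV x⟩
  obtain ⟨ι, _, P, hP, e, ⟨E⟩⟩ := Module.equiv_directSum_of_isTorsion htors
  let E₁ := E.trans (DirectSum.linearEquivFunOnFintype ℚ_[p][X] ι _)
  -- Apply `h`, which acts as zero, to the generator of the `i`-th cyclic summand.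
  have hdvd (i : ι) : P i ^ e i ∣ h.map (algebraMap ℤ_[p] ℚ_[p]) := by
    have h1 := congrArg (fun z => E₁ z i) (hV (E₁.symm (Pi.single i (Submodule.Quotient.mk 1))))
    simp only [map_smul, LinearEquiv.apply_symm_apply, map_zero, Pi.smul_apply, Pi.single_eq_same,
      Pi.zero_apply] at h1
    rw [← Submodule.Quotient.mk_smul, Submodule.Quotient.mk_eq_zero, smul_eq_mul, mul_one] at h1
    exact Ideal.mem_span_singleton.1 h1
  -- The structure theorem permits zero exponents, whose summands are trivial; they are dropped
  -- because elementary modules require positive exponents.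
  let σ := (Fintype.equivFin {i // 0 < e i}).symm
  choose g hg hgi hga using fun j => exists_distinguished_associated (hP (σ j).1) hh
    ((dvd_pow_self _ (σ j).2.ne').trans (hdvd (σ j).1))
  refine ⟨_, g, fun j => e (σ j), hg, hgi, fun j => (σ j).2, ⟨?_⟩⟩
  have hb := LinearMap.bijective_pi_proj_of_subsingleton (R := ℚ_[p][X]) (fun j => (σ j).1)
    (Subtype.val_injective.comp σ.injective) (fun i => ℚ_[p][X] ⧸ ℚ_[p][X] ∙ P i ^ e i) (by
      intro i hi
      have : e i = 0 := by
        by_contra h0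
        exact hi ⟨σ.symm ⟨i, Nat.pos_of_ne_zero h0⟩, by simp⟩
      rw [this, pow_zero]
      exact Ideal.Quotient.subsingleton_iff.2 Ideal.span_singleton_one)
  refine (E₁.trans (LinearEquiv.ofBijective _ hb)).trans (LinearEquiv.piCongrRight fun j => ?_)
  refine Submodule.quotEquivOfEq _ _ ?_
  rw [map_pow]
  exact Ideal.span_singleton_eq_span_singleton.2 ((hga j).pow_pow)

end IwasawaAlg
end

/-! ### From `ℤ_p[X]` to `Λ`, and construction of the elementary module. -/

noncomputable section

namespace IwasawaAlg

open Polynomial TensorProduct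

variable {p : ℕ} [Fact p.Prime]

attribute [local instance] Polynomial.algebra

theorem finite_of_smul_eq_zero {Q : Type*} [AddCommGroup Q] [Module ℤ_[p] Q]
    [Module.Finite ℤ_[p] Q] (hQ : ∀ x : Q, ∃ a : ℤ_[p], a ≠ 0 ∧ a • x = 0) : Finite Q := by
  refine finite_of_pow_smul_eq_zero (p := p) fun x => ?_
  obtain ⟨a, ha, hx⟩ := hQ x
  rw [PadicInt.unitCoeff_spec ha, mul_smul] at hx
  exact ⟨a.valuation, ((PadicInt.unitCoeff ha).isUnit.smul_eq_zero).1 hx⟩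

section

variable {f : ℤ_[p][X]} (hf : f.IsDistinguishedAt (Ideal.span {(p : ℤ_[p])})) (n : ℕ)

/-- `ℤ_p[X] / (f ^ n) ≃ ℤ_p⟦X⟧ / (f ^ n)` for a distinguished polynomial `f`. -/
def quotientPowEquiv : (ℤ_[p][X] ⧸ Ideal.span {f ^ n}) ≃ₐ[ℤ_[p]]
    (IwasawaAlg p ⧸ Ideal.span {(f : IwasawaAlg p) ^ n}) :=
  (hf.pow n).algEquivQuotient.trans
    (Ideal.quotientEquivAlgOfEq ℤ_[p] (by rw [Polynomial.coe_pow]))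

theorem quotientPowEquiv_smul (q : ℤ_[p][X]) (x : ℤ_[p][X] ⧸ Ideal.span {f ^ n}) :
    quotientPowEquiv hf n (q • x) = (q : IwasawaAlg p) • quotientPowEquiv hf n x := by
  obtain ⟨x, rfl⟩ := Ideal.Quotient.mk_surjective x
  have h1 : q • Ideal.Quotient.mk (Ideal.span {f ^ n}) x =
      Ideal.Quotient.mk (Ideal.span {f ^ n}) q * Ideal.Quotient.mk (Ideal.span {f ^ n}) x := rfl
  rw [h1, map_mul]
  have h2 : quotientPowEquiv hf n (Ideal.Quotient.mk (Ideal.span {f ^ n}) q) =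
      Ideal.Quotient.mk _ (q : IwasawaAlg p) := by
    simp [quotientPowEquiv]
  rw [h2]
  rfl

include hf in
theorem finite_quotient_pow :
    Module.Finite ℤ_[p] (IwasawaAlg p ⧸ Ideal.span {(f : IwasawaAlg p) ^ n}) := by
  have : Module.Finite ℤ_[p] (ℤ_[p][X] ⧸ Ideal.span {f ^ n}) :=
    (AdjoinRoot.powerBasis' (hf.monic.pow n)).finite
  exact Module.Finite.equiv (quotientPowEquiv hf n).toLinearEquiv

include hf in
theorem finrank_quotient_pow :
    Module.finrank ℤ_[p] (IwasawaAlg p ⧸ Ideal.span {(f : IwasawaAlg p) ^ n}) =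
      n * f.natDegree := by
  rw [← (quotientPowEquiv hf n).toLinearEquiv.finrank_eq, ← hf.monic.natDegree_pow]
  exact (AdjoinRoot.powerBasis' (hf.monic.pow n)).finrank

include hf in
theorem free_quotient_pow :
    Module.Free ℤ_[p] (IwasawaAlg p ⧸ Ideal.span {(f : IwasawaAlg p) ^ n}) := by
  have : Module.Free ℤ_[p] (ℤ_[p][X] ⧸ Ideal.span {f ^ n}) :=
    Module.Free.of_basis (AdjoinRoot.powerBasis' (hf.monic.pow n)).basis
  exact Module.Free.of_equiv (quotientPowEquiv hf n).toLinearEquiv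

end

theorem isPseudoIso_of_smul {M N : Type*} [AddCommGroup M] [Module (IwasawaAlg p) M]
    [Module ℤ_[p] M] [IsScalarTower ℤ_[p] (IwasawaAlg p) M] [Module.Finite ℤ_[p] M]
    [AddCommGroup N] [Module (IwasawaAlg p) N] [Module ℤ_[p] N]
    [IsScalarTower ℤ_[p] (IwasawaAlg p) N] [Module.Finite ℤ_[p] N] (ψ : M →ₗ[IwasawaAlg p] N)
    (hker : ∀ m, ψ m = 0 → ∃ a : ℤ_[p], a ≠ 0 ∧ a • m = 0)
    (hcoker : ∀ n, ∃ a : ℤ_[p], a ≠ 0 ∧ a • n ∈ LinearMap.range ψ) : IsPseudoIso ψ := by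
  let ψ' : M →ₗ[ℤ_[p]] N := ψ.restrictScalars ℤ_[p]
  have h1 : Finite (LinearMap.ker ψ') := finite_of_smul_eq_zero (p := p) fun x => by
    obtain ⟨a, ha, h1⟩ := hker x.1 x.2
    exact ⟨a, ha, Subtype.ext h1⟩
  have h2 : Finite (N ⧸ LinearMap.range ψ') := finite_of_smul_eq_zero (p := p) fun x => by
    obtain ⟨n, rfl⟩ := Submodule.mkQ_surjective _ x
    obtain ⟨a, ha, h1⟩ := hcoker n
    refine ⟨a, ha, ?_⟩
    rw [← map_smul]
    exact (Submodule.Quotient.mk_eq_zero _).2 h1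
  exact ⟨h1, h2⟩

/-- The ring `ℚ_p[X]` is the localization of `ℤ_p[X]` at the nonzero constants and a principal ideal
domain. Its structure theorem, with denominators cleared, gives a map over `ℤ_p[X]` whose kernel and
cokernel are torsion over `ℤ_p`; being finitely generated over `ℤ_p`, they are finite. Quotients by
powers of a distinguished polynomial are the same over `ℤ_p[X]` and over `Λ`. -/
theorem exists_hasIwasawaInvariants (M : Type*) [AddCommGroup M] [Module (IwasawaAlg p) M]
    [Module ℤ_[p] M] [IsScalarTower ℤ_[p] (IwasawaAlg p) M] [Module.Finite ℤ_[p] M] :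
    ∃ m l, HasIwasawaInvariants p M m l := by
  let _ : Module ℤ_[p][X] M := Module.compHom M (algebraMap ℤ_[p][X] (IwasawaAlg p))
  have hsmul (q : ℤ_[p][X]) (m : M) : q • m = (q : IwasawaAlg p) • m := by
    change algebraMap ℤ_[p][X] (IwasawaAlg p) q • m = _
    congr 1
  have : IsScalarTower ℤ_[p] ℤ_[p][X] M := ⟨fun a q m => by
    rw [hsmul, hsmul, ← smul_assoc, Polynomial.smul_eq_C_mul, Polynomial.coe_mul, Polynomial.coe_C,
      PowerSeries.smul_eq_C_mul]⟩
  have : Module.Finite ℤ_[p][X] M := Module.Finite.of_restrictScalars_finite ℤ_[p] _ _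
  have : Module.FinitePresentation ℤ_[p][X] M := Module.finitePresentation_of_finite _ _
  obtain ⟨h, hh, hM⟩ := exists_distinguished_smul_eq_zero p M
  obtain ⟨t, g, e, hg, hgi, he, ⟨E⟩⟩ := exists_equiv_pi_quotient M hh
    (fun m => (hsmul h m).trans (hM m))
  have := Polynomial.isLocalization (nonZeroDivisors ℤ_[p]) ℚ_[p]
  obtain ⟨φ, hker, hcoker⟩ := Module.exists_linearMap_pi_quotient
    ((nonZeroDivisors ℤ_[p]).map C) (fun j => g j ^ e j) E
  -- Inverting `p` kills the `p`-power torsion, which is finite here, so no summands `Λ` or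
  -- `Λ/(p^μ)` are needed.
  let D : ElementaryData p :=
    { r := 0, s := 0, mu := Fin.elim0, mu_pos := fun i => i.elim0, t := t, f := g,
      distinguished := hg, irreducible := hgi, lam := e, lam_pos := he }
  have hfin (j : Fin t) :
      Module.Finite ℤ_[p] (IwasawaAlg p ⧸ Ideal.span {(g j : IwasawaAlg p) ^ e j}) :=
    finite_quotient_pow (hg j) (e j)
  have : IsEmpty (Fin D.s) := inferInstanceAs (IsEmpty (Fin 0))
  have : IsEmpty (Fin D.r) := inferInstanceAs (IsEmpty (Fin 0))
  have : Module.Finite ℤ_[p] ((j : Fin D.t) →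
      IwasawaAlg p ⧸ Ideal.span {(D.f j : IwasawaAlg p) ^ D.lam j}) :=
    Module.Finite.pi (ι := Fin t)
  have : Module.Finite ℤ_[p] D.Mod := inferInstance
  let ψ₀ : M →+ D.Mod :=
    { toFun := fun m => (0, 0, fun j => quotientPowEquiv (hg j) (e j) (φ m j))
      map_zero' := by simp only [map_zero, Pi.zero_apply]; rfl
      map_add' := fun a b => by
        simp only [map_add, Pi.add_apply, Prod.mk_add_mk, add_zero]; rfl }
  have hψ₀ (q : ℤ_[p][X]) (m : M) : ψ₀ ((q : IwasawaAlg p) • m) = (q : IwasawaAlg p) • ψ₀ m := by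
    refine Prod.ext (Subsingleton.elim _ _) (Prod.ext (Subsingleton.elim _ _) (funext fun j => ?_))
    change quotientPowEquiv (hg j) (e j) (φ ((q : IwasawaAlg p) • m) j) =
      (q : IwasawaAlg p) • quotientPowEquiv (hg j) (e j) (φ m j)
    rw [← hsmul, map_smul, Pi.smul_apply, quotientPowEquiv_smul]
  -- Linearity over polynomials extends to `Λ` because both sides are finitely generated over `ℤ_p`.
  let ψ : M →ₗ[IwasawaAlg p] D.Mod :=
    { ψ₀ with map_smul' := map_smul_of_polynomial ψ₀ hψ₀ }
  have hψker (m : M) (hm : ψ m = 0) : ∃ a : ℤ_[p], a ≠ 0 ∧ a • m = 0 := by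
    have h1 : φ m = 0 := funext fun j => (quotientPowEquiv (hg j) (e j)).injective
      ((congrFun (congrArg (fun z => z.2.2) hm) j).trans (map_zero _).symm)
    obtain ⟨_, ⟨a, ha, rfl⟩, hs⟩ := hker m h1
    exact ⟨a, nonZeroDivisors.ne_zero ha, by rw [← hs, ← algebraMap_smul ℤ_[p][X] a m]; rfl⟩
  have hψcoker (n : D.Mod) : ∃ a : ℤ_[p], a ≠ 0 ∧ a • n ∈ LinearMap.range ψ := by
    obtain ⟨_, ⟨a, ha, rfl⟩, m, hm⟩ := hcoker fun j => (quotientPowEquiv (hg j) (e j)).symm (n.2.2 j)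
    refine ⟨a, nonZeroDivisors.ne_zero ha, m, ?_⟩
    refine Prod.ext (Subsingleton.elim _ _) (Prod.ext (Subsingleton.elim _ _) (funext fun j => ?_))
    change quotientPowEquiv (hg j) (e j) (φ m j) = a • n.2.2 j
    rw [hm, Pi.smul_apply, quotientPowEquiv_smul, AlgEquiv.apply_symm_apply,
      Polynomial.coe_C, ← algebraMap_smul (IwasawaAlg p) a (n.2.2 j)]
    rfl
  exact ⟨_, _, D, ψ, isPseudoIso_of_smul ψ hψker hψcoker, rfl, rfl⟩

end IwasawaAlg
end

/-! ### Bounding the invariants by the `ℤ_p`-rank. -/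

noncomputable section

namespace IwasawaAlg

open Polynomial

variable {p : ℕ} [Fact p.Prime]

theorem _root_.IsPseudoIso.finite_of_finite {M N : Type*} [AddCommGroup M] [Module (IwasawaAlg p) M]
    [Module ℤ_[p] M] [IsScalarTower ℤ_[p] (IwasawaAlg p) M] [Module.Finite ℤ_[p] M]
    [AddCommGroup N] [Module (IwasawaAlg p) N] [Module ℤ_[p] N]
    [IsScalarTower ℤ_[p] (IwasawaAlg p) N] {φ : M →ₗ[IwasawaAlg p] N} (hφ : IsPseudoIso φ) :
    Module.Finite ℤ_[p] N := by
  have : Finite (N ⧸ LinearMap.range (φ.restrictScalars ℤ_[p])) := hφ.2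
  exact Module.Finite.of_submodule_quotient (LinearMap.range (φ.restrictScalars ℤ_[p]))

theorem _root_.IsPseudoIso.finrank_le {M N : Type*} [AddCommGroup M] [Module (IwasawaAlg p) M]
    [Module ℤ_[p] M] [IsScalarTower ℤ_[p] (IwasawaAlg p) M] [Module.Finite ℤ_[p] M]
    [AddCommGroup N] [Module (IwasawaAlg p) N] [Module ℤ_[p] N]
    [IsScalarTower ℤ_[p] (IwasawaAlg p) N] {φ : M →ₗ[IwasawaAlg p] N} (hφ : IsPseudoIso φ) :
    Module.finrank ℤ_[p] N ≤ Module.finrank ℤ_[p] M := by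
  have := hφ.finite_of_finite
  have : Finite (N ⧸ LinearMap.range (φ.restrictScalars ℤ_[p])) := hφ.2
  rw [← (LinearMap.range (φ.restrictScalars ℤ_[p])).finrank_quotient_add_finrank]
  have h0 : Module.finrank ℤ_[p] (N ⧸ LinearMap.range (φ.restrictScalars ℤ_[p])) = 0 := by
    rw [Module.finrank_eq_zero_iff_isTorsion]
    intro x
    refine ⟨⟨(Nat.card (N ⧸ LinearMap.range (φ.restrictScalars ℤ_[p])) : ℤ_[p]),
      mem_nonZeroDivisors_of_ne_zero (Nat.cast_ne_zero.2 Nat.card_pos.ne')⟩, ?_⟩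
    change (Nat.card (N ⧸ LinearMap.range (φ.restrictScalars ℤ_[p])) : ℤ_[p]) • x = 0
    rw [Nat.cast_smul_eq_nsmul, card_nsmul_eq_zero']
  rw [h0, zero_add]
  exact LinearMap.finrank_range_le _

theorem not_dvd_of_isDistinguishedAt {h : ℤ_[p][X]}
    (hh : h.IsDistinguishedAt (Ideal.span {(p : ℤ_[p])})) : ¬ (p : IwasawaAlg p) ∣ h := by
  rintro ⟨q, hq⟩
  have h1 := congrArg (PowerSeries.coeff h.natDegree) hq
  have h2 : (p : IwasawaAlg p) = PowerSeries.C (p : ℤ_[p]) := by simp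
  rw [h2, PowerSeries.coeff_C_mul, Polynomial.coeff_coe, hh.monic.coeff_natDegree] at h1
  exact PadicInt.prime_p.not_isUnit (IsUnit.of_mul_eq_one _ h1.symm)

/-- A distinguished polynomial kills the elementary module. It kills no nonzero element of `Λ`, and
it is not divisible by `p`, so only the summands `Λ/(f^λ)` can occur; these are free over `ℤ_p` of
rank `λ deg f`. The argument applies to every elementary module pseudo-isomorphic to `M`, so
uniqueness of the invariants is not needed. -/
theorem invariants_of_finite {M : Type*} [AddCommGroup M] [Module (IwasawaAlg p) M]
    [Module ℤ_[p] M] [IsScalarTower ℤ_[p] (IwasawaAlg p) M] [Module.Finite ℤ_[p] M] {m l : ℕ}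
    (hM : HasIwasawaInvariants p M m l) : m = 0 ∧ l ≤ Module.finrank ℤ_[p] M := by
  obtain ⟨D, φ, hφ, rfl, rfl⟩ := hM
  have hfin : Module.Finite ℤ_[p] D.Mod := hφ.finite_of_finite
  obtain ⟨h, hh, hD⟩ := exists_distinguished_smul_eq_zero p D.Mod
  have hr : IsEmpty (Fin D.r) := ⟨fun i => by
    have h1 : h * (1 : IwasawaAlg p) = 0 := congrFun (congrArg Prod.fst (hD (fun _ => 1, 0, 0))) i
    rw [mul_one, Polynomial.coe_eq_zero_iff] at h1
    exact hh.monic.ne_zero h1⟩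
  have hs : IsEmpty (Fin D.s) := ⟨fun i => by
    have h1 : (h : IwasawaAlg p) • (Ideal.Quotient.mk (Ideal.span {(p : IwasawaAlg p) ^ D.mu i}) 1)
        = 0 := congrFun (congrArg (fun z => z.2.1) (hD (0, fun i => Ideal.Quotient.mk _ 1, 0))) i
    have h2 : (h : IwasawaAlg p) ∈ Ideal.span {(p : IwasawaAlg p) ^ D.mu i} := by
      rw [← Ideal.Quotient.eq_zero_iff_mem, ← h1]
      exact congrArg (Ideal.Quotient.mk _) (mul_one (h : IwasawaAlg p)).symm
    rw [Ideal.mem_span_singleton] at h2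
    exact not_dvd_of_isDistinguishedAt hh ((dvd_pow_self _ (D.mu_pos i).ne').trans h2)⟩
  refine ⟨Fintype.sum_empty _, ?_⟩
  have h1 (j : Fin D.t) := finite_quotient_pow (D.distinguished j) (D.lam j)
  have h2 (j : Fin D.t) := free_quotient_pow (D.distinguished j) (D.lam j)
  have h3 : Module.finrank ℤ_[p] D.Mod = ∑ j, D.lam j * (D.f j).natDegree := by
    rw [Module.finrank_prod, Module.finrank_prod, Module.finrank_zero_of_subsingleton,
      Module.finrank_zero_of_subsingleton, zero_add, zero_add, Module.finrank_pi_fintype]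
    exact Finset.sum_congr rfl fun j _ => finrank_quotient_pow (D.distinguished j) (D.lam j)
  rw [← h3]
  exact hφ.finrank_le

end IwasawaAlg
end

noncomputable section

/-! ### The fine Selmer group -/

theorem PontDual.isScalarTower (p : ℕ) [Fact p.Prime] {A R S : Type*} [AddCommGroup A] [CommRing R]
    [CommRing S] [Algebra R S] [Module R A] [Module S A] [IsScalarTower R S A] :
    IsScalarTower R S (PontDual p A) :=
  ⟨fun r s f => AddMonoidHom.ext fun a => congrArg (toHom f) (by
    change (r • s) • a = s • r • a
    rw [smul_assoc, smul_comm])⟩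

/-- The dual of a `p`-primary `Λ`-module whose `p`-torsion has order at most `p ^ B`. -/
theorem PontDual.iwasawaInvariants_of_card_le (p : ℕ) [Fact p.Prime] {A : Type*} [AddCommGroup A]
    [Module (IwasawaAlg p) A] (hA : ∀ a : A, ∃ k : ℕ, p ^ k • a = 0) {B : ℕ}
    [Finite {a : A // p • a = 0}] (hB : Nat.card {a : A // p • a = 0} ≤ p ^ B) :
    Module.Finite (IwasawaAlg p) (PontDual p A) ∧
    Module.IsTorsion (IwasawaAlg p) (PontDual p A) ∧
    (∃ m l, HasIwasawaInvariants p (PontDual p A) m l) ∧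
    ∀ m l, HasIwasawaInvariants p (PontDual p A) m l → m = 0 ∧ l ≤ B := by
  -- The `ℤ_p`-structure comes from the constants of `Λ`, so the two structures on the dual are
  -- compatible.
  let _ : Module ℤ_[p] A := Module.compHom A (algebraMap ℤ_[p] (IwasawaAlg p))
  have : IsScalarTower ℤ_[p] (IwasawaAlg p) A := ⟨fun a g x => by
    change (a • g) • x = (algebraMap ℤ_[p] (IwasawaAlg p) a) • g • x
    rw [Algebra.smul_def, mul_smul]⟩
  have := PontDual.isScalarTower p (A := A) (R := ℤ_[p]) (S := IwasawaAlg p)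
  obtain ⟨f, hf⟩ := PontDual.exists_surjective_of_card_le p hA hB
  have hfin : Module.Finite ℤ_[p] (PontDual p A) := Module.Finite.of_surjective f hf
  refine ⟨Module.Finite.of_restrictScalars_finite ℤ_[p] _ _, IwasawaAlg.isTorsion_of_finite p _,
    IwasawaAlg.exists_hasIwasawaInvariants _, fun m l h => ?_⟩
  obtain ⟨h0, hl⟩ := IwasawaAlg.invariants_of_finite h
  refine ⟨h0, hl.trans ?_⟩
  have h1 := LinearMap.finrank_range_le f
  rwa [LinearMap.range_eq_top.2 hf, finrank_top, Module.finrank_fin_fun] at h1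

open NumberField IsDedekindDomain FineSelmer in
-- The arithmetic enters through the order of the `p`-torsion of `R(E/F_∞)`; duality over `Λ` does
-- the rest, with `B` the sum of the two dimensions over `ℤ/p`.
theorem proposition3p1 {F : Type*} [Field F] [NumberField F] (p : ℕ) [Fact p.Prime] (hp : p ≠ 2)
    (E : WeierstrassCurve F) [E.IsElliptic]
    (hgood : ∀ v : HeightOneSpectrum (𝓞 F), (p : 𝓞 F) ∈ v.asIdeal → HasGoodReductionAt E v)
    (Finf : IntermediateField F (AlgebraicClosure F)) [IsGalois F Finf] [IsZpExtension p F Finf]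
    (γ : Gal(Finf/F)) (hγ : (Subgroup.zpowers γ).topologicalClosure = ⊤)
    (hker : Finite (hMap E p Finf).ker)
    (hR : Finite (fineSelmer E p 1 Finf)) :
    Module.Finite (IwasawaAlg p) (PontDual p (SelmerModule E p γ)) ∧
    Module.IsTorsion (IwasawaAlg p) (PontDual p (SelmerModule E p γ)) ∧
    (∃ m l, HasIwasawaInvariants p (PontDual p (SelmerModule E p γ)) m l) ∧
    ∀ m l, HasIwasawaInvariants p (PontDual p (SelmerModule E p γ)) m l →
      m = 0 ∧ l ≤ Module.finrank (ZMod p) (fineSelmer E p 1 Finf) +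
        Module.finrank (ZMod p) (hMap E p Finf).ker := by
  have hp0 : p ≠ 0 := (Fact.out : p.Prime).ne_zero
  obtain ⟨hfin, hcard⟩ := finite_torsion_and_card_le E p Finf hp0
  have hfin' : Finite {c : SelmerModule E p γ // p • c = 0} := hfin
  have hprim (c : SelmerModule E p γ) : ∃ k : ℕ, p ^ k • c = 0 := by
    obtain ⟨k, hk, -⟩ := gammaAct_nilpotent E p ⊤ γ c
    exact ⟨k, hk⟩
  refine PontDual.iwasawaInvariants_of_card_le p hprim (hcard.trans_eq ?_)
  rw [pow_add, Module.natCard_eq_pow_finrank (K := ZMod p) (V := fineSelmer E p 1 Finf),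
    Module.natCard_eq_pow_finrank (K := ZMod p) (V := (hMap E p Finf).ker), Nat.card_zmod]

end
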